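/- **Setting.** For $\tau\in\mathbb{H}$ let $\Lambda_\tau=\mathbb{Z}+\mathbb{Z}\tau$, $E_\tau=\mathbb{C}/\Lambda_\tau$, let $E_\tau[2]$ be the set of $z$ with $2z\in\Lambda_\tau$, let $\wp(z|\tau)$, $\zeta(z|\tau)$ be the Weierstrass functions of $\Lambda_\tau$, $\eta_1=\zeta(z+1|\tau)-\zeta(z|\tau)$, $\eta_2=\zeta(z+\tau|\tau)-\zeta(z|\tau)$, $e_1=\wp(\tfrac12|\tau)$, $e_2=\wp(\tfrac\tau2|\tau)$, $e_3=\wp(\tfrac{1+\tau}2|\tau)$ and $t=t(\tau)=\frac{e_3-e_1}{e_2-e_1}$. Fix $(r,s)\in\mathbb{C}^2\setminus\frac12\mathbb{Z}^2$ and put $a(\tau)=r+s\tau$, $Z_{r,s}(\tau)=\zeta(a(\tau)|\tau)-r\eta_1(\tau)-s\eta_2(\tau)$. *The solutions.* All functions of $t$ below are regarded, through $t=t(\tau)$, as meromorphic functions of $\tau\in\mathbb{H}$. Let $\lambda^{(0)}_{r,s}=\frac{1}{e_2-e_1}\Big(\wp(a|\tau)+\frac{\wp'(a|\tau)}{2Z_{r,s}(\tau)}-e_1\Big)$,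 and let $\mu^{(0)}_{r,s}$ be defined by $$t(t-1)\frac{d\lambda}{dt}=2\lambda(\lambda-1)(\lambda-t)\mu-\tfrac12(\lambda-1)(\lambda-t)-\tfrac12\lambda(\lambda-t)+\tfrac12\lambda(\lambda-1),\qquad \lambda=\lambda^{(0)}_{r,s}.$$ The Okamoto transformations act on $(\theta_0,\dots,\theta_4;\lambda,\mu)$ as follows: $\kappa_0$ sends it to $(-\theta_0,\theta_1+\theta_0,\theta_2+\theta_0,\theta_3+\theta_0,\theta_4+\theta_0;\lambda+\frac{\theta_0}{\mu},\mu)$; for $j=1,2,3$, $\kappa_j$ replaces $\theta_0,\theta_j,\mu$ by $\theta_0+\theta_j,-\theta_j,\mu-\frac{\theta_j}{\lambda-c_j}$ with $(c_1,c_2,c_3)=(0,1,t)$; and $\kappa_4$ replaces $\theta_0,\theta_4$ by $\theta_0+\theta_4,-\theta_4$. Let $\kappa_5=\kappa_0(\kappa_3\kappa_2\kappa_1\kappa_0)^2\kappa_4$, $\kappa^{0,2m}=\kappa_5^m$ and $\kappa^{0,2m+1}=\kappa_5^m\kappa_0\kappa_3\kappa_2\kappa_1$. For $n\ge0$, $(\lambda^{(n)}_{r,s},\mu^{(n)}_{r,s})$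 is the image of $(\lambda^{(0)}_{r,s},\mu^{(0)}_{r,s})$, with parameter $(-\frac12,\frac12,\frac12,\frac12,\frac12)$, under $\kappa^{0,n}$, and $p^{(n)}_{r,s}(\tau)$ is determined, up to sign and up to $\Lambda_\tau$, by $\frac{\wp(p^{(n)}_{r,s}(\tau)|\tau)-e_1}{e_2-e_1}=\lambda^{(n)}_{r,s}$. A pole $t_0=t(\tau_0)$ of $\lambda^{(n)}_{r,s}$ is called positive (resp. negative) if its residue in the variable $t$ is $\frac{t_0(t_0-1)}{n+1/2}$ (resp. $-\frac{t_0(t_0-1)}{n+1/2}$). *The polynomials.* Let $\tau$ be such that $a(\tau)\notin E_\tau[2]$, and let $H(x;y)=x(x-y)(x-ty)$, $H'=\partial H/\partial x$. Put $Q_{-2}=Q_{-1}=1$, $Q_0=X$, $G_0=\frac{\wp'(a|\tau)}{e_2-e_1}$, $R_0=\frac{\wp(a|\tau)-e_1}{e_2-e_1}X+\frac12G_0$ and, for $n\ge1$, with $\varphi_{n-1}=R_{n-1}Q_{n-2}+\frac{n-1}2G_{n-1}$ and $D_{n-1}=Q_{n-3}Q_{n-2}Q_{n-1}$, $$G_n=\frac{H(\varphi_{n-1};D_{n-1})}{G_{n-1}Q_{n-3}^3},\quad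 Q_n=\frac{H(\varphi_{n-1};D_{n-1})}{G_{n-1}^2Q_{n-3}^2}-\frac n2\,\frac{H'(\varphi_{n-1};D_{n-1})}{G_{n-1}Q_{n-3}^2},\quad R_n=\frac{\varphi_{n-1}Q_n+\frac{n+1}2Q_{n-3}G_n}{Q_{n-3}Q_{n-1}}.$$ Put $p_0=Q_0/G_0$, $q_0=R_0/Q_0$ and, for $n\ge1$, with $b=q_{n-1}+\frac{n-1}{2p_{n-1}}$, $p_n=p_{n-1}-\frac n2\big(\frac1b+\frac1{b-1}+\frac1{b-t}\big)$, $q_n=b+\frac{n+1}{2p_n}$. These are elements of $\mathbb{C}(X)$ depending on $\tau$; we write $Q_n(X|\tau)$, etc. **Theorem.** For every $n\ge0$ and every $\tau$ with $a(\tau)\notin E_\tau[2]$, $Q_n,G_n,R_n$ are polynomials in $X$, and the following hold. (i) For every $\tau$ with $a(\tau)\notin E_\tau[2]$, with $Z=Z_{r,s}(\tau)$ (as an equality of values of meromorphic functions), $$\lambda^{(n)}_{r,s}(t)=q_n(Z)=\frac{R_n(Z|\tau)}{Q_{n-2}(Z|\tau)Q_n(Z|\tau)},\qquad \mu^{(n)}_{r,s}(t)=p_n(Z)=\frac{Q_{n-2}(Z|\tau)Q_{n-1}(Z|\tau)Q_n(Z|\tau)}{G_n(Z|\tau)},$$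 $$\wp(p^{(n)}_{r,s}(\tau)|\tau)=\frac{(e_2(\tau)-e_1(\tau))R_n(Z|\tau)}{Q_{n-2}(Z|\tau)Q_n(Z|\tau)}+e_1(\tau),$$ where $p^{(n)}_{r,s}(\tau)$ exists, and lies in $\Lambda_\tau$ exactly when $Q_{n-2}(Z|\tau)Q_n(Z|\tau)=0$. (ii) Let $t_0=t(\tau_0)$ with $a(\tau_0)\notin E_{\tau_0}[2]$. Then $t_0$ is a positive pole of $\lambda^{(n)}_{r,s}$ if and only if $Q_{n-2}(Z_{r,s}(\tau_0)|\tau_0)=0$, and a negative pole of $\lambda^{(n)}_{r,s}$ if and only if $Q_n(Z_{r,s}(\tau_0)|\tau_0)=0$. In particular, if $(r,s)\in\mathbb{R}^2\setminus\frac12\mathbb{Z}^2$, then $\lambda^{(0)}_{r,s}$ and $\lambda^{(1)}_{r,s}$ have no positive poles in $\mathbb{C}\setminus\{0,1\}$. -/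

import Mathlib

noncomputable section

namespace LamePVI

open UpperHalfPlane

/-! ### Weierstrass functions of the lattice `Λ_τ = ℤ + ℤτ` -/

theorem linearIndependent_one_tau (τ : UpperHalfPlane) :
    LinearIndependent ℝ ![(1 : ℂ), (τ : ℂ)] := by
  rw [LinearIndependent.pair_iff]
  intro u v h
  have him := congrArg Complex.im h
  have hre := congrArg Complex.re h
  simp at him hre
  have hv : v = 0 := him.resolve_right τ.im_ne_zero
  subst hv
  simpa using hre

/-- The period pair `(1, τ)`. -/
def periods (τ : UpperHalfPlane) : PeriodPair := ⟨1, τ, linearIndependent_one_tau τ⟩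

/-- `℘(z|τ)`; at a lattice point (a pole) it takes the default value `0`. -/
def wp (z : ℂ) (τ : UpperHalfPlane) : ℂ := (periods τ).weierstrassP z

/-- `℘'(z|τ)`, the derivative in `z`. -/
def wp' (z : ℂ) (τ : UpperHalfPlane) : ℂ := (periods τ).derivWeierstrassP z

/-- The Weierstrass zeta function
`ζ(z|τ) = 1/z + ∑_{ω ≠ 0} (1/(z-ω) + 1/ω + z/ω²)`: the summand of index `ω = 0` is `1/z`,
because division by `0` gives `0`. -/
def zeta (z : ℂ) (τ : UpperHalfPlane) : ℂ :=
  ∑' ω : (periods τ).lattice, (1 / (z - (ω : ℂ)) + 1 / (ω : ℂ) + z / (ω : ℂ) ^ 2)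

/-- The quasi-period `η₁(τ) = ζ(z+1|τ) - ζ(z|τ)`, taken at `z = -1/2`. -/
def eta₁ (τ : UpperHalfPlane) : ℂ := zeta (1 / 2) τ - zeta (-1 / 2) τ

/-- The quasi-period `η₂(τ) = ζ(z+τ|τ) - ζ(z|τ)`, taken at `z = -τ/2`. -/
def eta₂ (τ : UpperHalfPlane) : ℂ := zeta ((τ : ℂ) / 2) τ - zeta (-(τ : ℂ) / 2) τ

def e₁ (τ : UpperHalfPlane) : ℂ := wp (1 / 2) τ
def e₂ (τ : UpperHalfPlane) : ℂ := wp ((τ : ℂ) / 2) τ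
def e₃ (τ : UpperHalfPlane) : ℂ := wp ((1 + (τ : ℂ)) / 2) τ

/-- `t(τ) = (e₃ - e₁)/(e₂ - e₁)`, the covering map `ℍ → ℂ \ {0,1}`. -/
def tt (τ : UpperHalfPlane) : ℂ := (e₃ τ - e₁ τ) / (e₂ τ - e₁ τ)

/-- The points of `ℂ` lying over `E_τ[2]`. -/
def twoTorsion (τ : UpperHalfPlane) : Set ℂ := {z | 2 * z ∈ (periods τ).lattice}

/-- `a(τ) = r + sτ`. -/
def aa (r s : ℂ) (τ : UpperHalfPlane) : ℂ := r + s * τ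

/-- `Z_{r,s}(τ) = ζ(r+sτ|τ) - r η₁(τ) - s η₂(τ)`. -/
def ZZ (r s : ℂ) (τ : UpperHalfPlane) : ℂ := zeta (aa r s τ) τ - r * eta₁ τ - s * eta₂ τ

/-! ### Okamoto transformations -/

/-- Parameters `θ = (θ₀,…,θ₄)` of the Hamiltonian system of Painlevé VI together with the
values of `(λ, μ)`. -/
structure OkState where
  θ₀ : ℂ
  θ₁ : ℂ
  θ₂ : ℂ
  θ₃ : ℂ
  θ₄ : ℂ
  lam : ℂ
  mu : ℂ

def kappa₀ (S : OkState) : OkState :=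
  ⟨-S.θ₀, S.θ₁ + S.θ₀, S.θ₂ + S.θ₀, S.θ₃ + S.θ₀, S.θ₄ + S.θ₀, S.lam + S.θ₀ / S.mu, S.mu⟩

def kappa₁ (S : OkState) : OkState :=
  ⟨S.θ₀ + S.θ₁, -S.θ₁, S.θ₂, S.θ₃, S.θ₄, S.lam, S.mu - S.θ₁ / S.lam⟩

def kappa₂ (S : OkState) : OkState :=
  ⟨S.θ₀ + S.θ₂, S.θ₁, -S.θ₂, S.θ₃, S.θ₄, S.lam, S.mu - S.θ₂ / (S.lam - 1)⟩

def kappa₃ (t : ℂ) (S : OkState) : OkState :=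
  ⟨S.θ₀ + S.θ₃, S.θ₁, S.θ₂, -S.θ₃, S.θ₄, S.lam, S.mu - S.θ₃ / (S.lam - t)⟩

def kappa₄ (S : OkState) : OkState :=
  ⟨S.θ₀ + S.θ₄, S.θ₁, S.θ₂, S.θ₃, -S.θ₄, S.lam, S.mu⟩

/-- `κ₅ = κ₀ (κ₃ κ₂ κ₁ κ₀)² κ₄`. -/
def kappa₅ (t : ℂ) : OkState → OkState :=
  kappa₀ ∘ (kappa₃ t ∘ kappa₂ ∘ kappa₁ ∘ kappa₀)^[2] ∘ kappa₄

/-- `κ^{0,n}`: `κ₅^m` if `n = 2m`, and `κ₅^m ∘ κ₀ κ₃ κ₂ κ₁` if `n = 2m+1`. -/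
def kappaZero (n : ℕ) (t : ℂ) : OkState → OkState :=
  (kappa₅ t)^[n / 2] ∘ (if Even n then id else kappa₀ ∘ kappa₃ t ∘ kappa₂ ∘ kappa₁)

/-! ### The solutions `λ^{(n)}_{r,s}`, `μ^{(n)}_{r,s}`, lifted to `ℍ` by `t = t(τ)`

The functions with suffix `Raw` are given by formulas that are evaluated point by point, so that
they have default values at isolated points; the meromorphic functions themselves are `lam` and
`mu`. -/

/-- Hitchin's solution `λ^{(0)}_{r,s}`. -/
def lamZeroRaw (r s : ℂ) (τ : UpperHalfPlane) : ℂ :=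
  (wp (aa r s τ) τ + wp' (aa r s τ) τ / (2 * ZZ r s τ) - e₁ τ) / (e₂ τ - e₁ τ)

/-- `dλ^{(0)}_{r,s}/dt = (dλ^{(0)}_{r,s}/dτ) / (dt/dτ)`. -/
def derivLamZeroRaw (r s : ℂ) (τ : UpperHalfPlane) : ℂ :=
  deriv (lamZeroRaw r s ∘ ofComplex) (τ : ℂ) / deriv (tt ∘ ofComplex) (τ : ℂ)

/-- `μ^{(0)}_{r,s}`, the solution `μ` of the first equation of the Hamiltonian system
`t(t-1) dλ/dt = 2λ(λ-1)(λ-t)μ - θ₁(λ-1)(λ-t) - θ₂λ(λ-t) - (θ₃-1)λ(λ-1)`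
with `λ = λ^{(0)}_{r,s}` and `θ₁ = θ₂ = θ₃ = 1/2`. -/
def muZeroRaw (r s : ℂ) (τ : UpperHalfPlane) : ℂ :=
  let t := tt τ
  let l := lamZeroRaw r s τ
  (t * (t - 1) * derivLamZeroRaw r s τ
      + 1 / 2 * (l - 1) * (l - t) + 1 / 2 * l * (l - t) + (1 / 2 - 1) * l * (l - 1))
    / (2 * l * (l - 1) * (l - t))

/-- The image of `(λ^{(0)}_{r,s}, μ^{(0)}_{r,s})`, whose parameter is
`θ⁰ = (-1/2, 1/2, 1/2, 1/2, 1/2)`, under `κ^{0,n}`. -/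
def okState (r s : ℂ) (n : ℕ) (τ : UpperHalfPlane) : OkState :=
  kappaZero n (tt τ)
    ⟨-1 / 2, 1 / 2, 1 / 2, 1 / 2, 1 / 2, lamZeroRaw r s τ, muZeroRaw r s τ⟩

def lamRaw (r s : ℂ) (n : ℕ) (τ : UpperHalfPlane) : ℂ := (okState r s n τ).lam

def muRaw (r s : ℂ) (n : ℕ) (τ : UpperHalfPlane) : ℂ := (okState r s n τ).mu

/-- The meromorphic function `τ ↦ λ^{(n)}_{r,s}(t(τ))` on `ℍ`: removable singularities are
removed, and the value at a pole is `0`. -/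
def lam (r s : ℂ) (n : ℕ) (τ : UpperHalfPlane) : ℂ :=
  toMeromorphicNFAt (lamRaw r s n ∘ ofComplex) (τ : ℂ) (τ : ℂ)

/-- The meromorphic function `τ ↦ μ^{(n)}_{r,s}(t(τ))` on `ℍ`: removable singularities are
removed, and the value at a pole is `0`. -/
def mu (r s : ℂ) (n : ℕ) (τ : UpperHalfPlane) : ℂ :=
  toMeromorphicNFAt (muRaw r s n ∘ ofComplex) (τ : ℂ) (τ : ℂ)

/-- `λ^{(n)}_{r,s}` has a pole at `t₀ = t(τ₀)` (on the branch given by `τ₀`). -/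
def IsPole (r s : ℂ) (n : ℕ) (τ₀ : UpperHalfPlane) : Prop :=
  meromorphicOrderAt (lam r s n ∘ ofComplex) (τ₀ : ℂ) < 0

/-- `λ^{(n)}_{r,s}` has a (simple) pole at `t₀ = t(τ₀)` with residue `ξ` in the variable `t`. -/
def IsPoleWithResidue (r s : ℂ) (n : ℕ) (τ₀ : UpperHalfPlane) (ξ : ℂ) : Prop :=
  IsPole r s n τ₀ ∧
    Filter.Tendsto (fun τ : UpperHalfPlane => (tt τ - tt τ₀) * lam r s n τ)
      (nhdsWithin τ₀ {τ₀}ᶜ) (nhds ξ)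

/-- Positive pole: the residue is `t₀(t₀-1)/θ₄`, where `θ₄ = n + 1/2`. -/
def IsPositivePole (r s : ℂ) (n : ℕ) (τ₀ : UpperHalfPlane) : Prop :=
  IsPoleWithResidue r s n τ₀ (tt τ₀ * (tt τ₀ - 1) / ((n : ℂ) + 1 / 2))

/-- Negative pole: the residue is `-t₀(t₀-1)/θ₄`, where `θ₄ = n + 1/2`. -/
def IsNegativePole (r s : ℂ) (n : ℕ) (τ₀ : UpperHalfPlane) : Prop :=
  IsPoleWithResidue r s n τ₀ (-(tt τ₀ * (tt τ₀ - 1) / ((n : ℂ) + 1 / 2)))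

/-- `p` represents `p^{(n)}_{r,s}(τ)`, which is determined up to sign and up to `Λ_τ` by
`(℘(p|τ) - e₁)/(e₂ - e₁) = λ^{(n)}_{r,s}`, both sides being `∞` if `p ∈ Λ_τ`. -/
def RepresentsP (r s : ℂ) (n : ℕ) (τ : UpperHalfPlane) (p : ℂ) : Prop :=
  (p ∈ (periods τ).lattice ∧ IsPole r s n τ) ∨
    (p ∉ (periods τ).lattice ∧ ¬ IsPole r s n τ ∧
      (wp p τ - e₁ τ) / (e₂ τ - e₁ τ) = lam r s n τ)

/-! ### The sequences `Q_n`, `G_n`, `R_n` and `p_n`, `q_n` in `ℂ(X)`, for fixed `τ` -/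

/-- `H(x;y) = x(x-y)(x-ty)`. -/
def HH (t x y : RatFunc ℂ) : RatFunc ℂ := x * (x - y) * (x - t * y)

/-- `H'(x;y) = ∂H/∂x`. -/
def HH' (t x y : RatFunc ℂ) : RatFunc ℂ :=
  x * (x - y) + x * (x - t * y) + (x - y) * (x - t * y)

/-- The tuple `(Q_{n-2}, Q_{n-1}, Q_n, G_n, R_n)`. -/
structure QGR where
  Qpp : RatFunc ℂ
  Qp : RatFunc ℂ
  Q : RatFunc ℂ
  G : RatFunc ℂ
  R : RatFunc ℂ

/-- The step from index `n` to index `n + 1`. -/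
def QGR.next (t : RatFunc ℂ) (n : ℕ) (S : QGR) : QGR :=
  let φ := S.R * S.Qp + (n : RatFunc ℂ) / 2 * S.G
  let D := S.Qpp * S.Qp * S.Q
  let G' := HH t φ D / (S.G * S.Qpp ^ 3)
  let Q' := HH t φ D / (S.G ^ 2 * S.Qpp ^ 2)
    - ((n : RatFunc ℂ) + 1) / 2 * (HH' t φ D / (S.G * S.Qpp ^ 2))
  let R' := (φ * Q' + ((n : RatFunc ℂ) + 2) / 2 * S.Qpp * G') / (S.Qpp * S.Q)
  ⟨S.Qp, S.Q, Q', G', R'⟩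

def qgr (r s : ℂ) (τ : UpperHalfPlane) : ℕ → QGR
  | 0 =>
    { Qpp := 1
      Qp := 1
      Q := RatFunc.X
      G := RatFunc.C (wp' (aa r s τ) τ / (e₂ τ - e₁ τ))
      R := RatFunc.C ((wp (aa r s τ) τ - e₁ τ) / (e₂ τ - e₁ τ)) * RatFunc.X
        + RatFunc.C (1 / 2 * (wp' (aa r s τ) τ / (e₂ τ - e₁ τ))) }
  | n + 1 => (qgr r s τ n).next (RatFunc.C (tt τ)) n

/-- `Q_k(X|τ)` for `k ≥ -2`, with `Q_{-2} = Q_{-1} = 1`. -/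
def Qf (r s : ℂ) (τ : UpperHalfPlane) (k : ℤ) : RatFunc ℂ :=
  if k < 0 then 1 else (qgr r s τ k.toNat).Q

/-- `G_n(X|τ)`. -/
def Gf (r s : ℂ) (τ : UpperHalfPlane) (n : ℕ) : RatFunc ℂ := (qgr r s τ n).G

/-- `R_n(X|τ)`. -/
def Rf (r s : ℂ) (τ : UpperHalfPlane) (n : ℕ) : RatFunc ℂ := (qgr r s τ n).R

theorem qgr_Q (r s : ℂ) (τ : UpperHalfPlane) (n : ℕ) : (qgr r s τ n).Q = Qf r s τ n := by
  simp [Qf]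

theorem qgr_Qp (r s : ℂ) (τ : UpperHalfPlane) (n : ℕ) :
    (qgr r s τ n).Qp = Qf r s τ ((n : ℤ) - 1) := by
  cases n with
  | zero => simp [qgr, Qf]
  | succ n =>
    have : (((n + 1 : ℕ) : ℤ) - 1) = n := by push_cast; ring
    rw [this, ← qgr_Q]
    rfl

theorem qgr_Qpp (r s : ℂ) (τ : UpperHalfPlane) (n : ℕ) :
    (qgr r s τ n).Qpp = Qf r s τ ((n : ℤ) - 2) := by
  cases n with
  | zero => simp [qgr, Qf]
  | succ n =>
    have : (((n + 1 : ℕ) : ℤ) - 2) = (n : ℤ) - 1 := by push_cast; ring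
    rw [this, ← qgr_Qp]
    rfl

/-- The pair `(p_n, q_n)` of rational functions, for fixed `τ`. -/
def pq (r s : ℂ) (τ : UpperHalfPlane) : ℕ → RatFunc ℂ × RatFunc ℂ
  | 0 => (Qf r s τ 0 / Gf r s τ 0, Rf r s τ 0 / Qf r s τ 0)
  | n + 1 =>
    let p := (pq r s τ n).1
    let q := (pq r s τ n).2
    let b := q + (n : RatFunc ℂ) / (2 * p)
    let p' := p - ((n : RatFunc ℂ) + 1) / 2
      * (1 / b + 1 / (b - 1) + 1 / (b - RatFunc.C (tt τ)))
    (p', b + ((n : RatFunc ℂ) + 2) / (2 * p'))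

/-- `p_n(X)`. -/
def pf (r s : ℂ) (τ : UpperHalfPlane) (n : ℕ) : RatFunc ℂ := (pq r s τ n).1

/-- `q_n(X)`. -/
def qf (r s : ℂ) (τ : UpperHalfPlane) (n : ℕ) : RatFunc ℂ := (pq r s τ n).2

/-- The value at `z` of an element of `ℂ(X)` written in lowest terms; it is `0` at a pole. -/
def ev (f : RatFunc ℂ) (z : ℂ) : ℂ := RatFunc.eval (RingHom.id ℂ) z f

/-- An element of `ℂ(X)` that is a polynomial. -/
def IsPoly (f : RatFunc ℂ) : Prop := ∃ P : Polynomial ℂ, algebraMap (Polynomial ℂ) (RatFunc ℂ) P = f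

end LamePVI

end

/-! Write x = (℘(a) - e₁)/(e₂ - e₁), g = G_0 and c = (0, 1, t). The definitions conceal a two-step
recursion started at b_0 = x, p_0 = X/g: b_{n+1} = b_n + (n + 1/2)/p_n and p_{n+1} = p_n - (n+1)/2 ·
∑ 1/(b_{n+1} - c_i). In these terms q_n = b_n + (n+1)/(2p_n), Q_{n-2} Q_{n-1} Q_n = p_n G_n, and the
word κ^{0,n} performs exactly these steps (`kappaZero_chainState`). Hence λ^{(n)} and μ^{(n)} are
q_n and p_n at X = Z, away from the singularities of the recursion.

Polynomiality is singularity confinement. The recursion breaks down in two ways. If p_k = 0, then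
b_{k+1} and b_{k+2} are infinite, but b_{k+3} is finite again (`confined_of_regB_zero`). If b_{m+1}
= c_i, then p_{m+1} is infinite, but p_{m+2} is finite again (`confined_of_regA_eq`). In both cases
Q, G and R keep finite limits, and their limits are known well enough to exclude cancellation in
R_n/(Q_{n-2} Q_n) and in Q_{n-2} Q_{n-1} Q_n/G_n. A rational function with a finite limit at every
point is a polynomial.

The limits are taken in the space of all (t, x, g, X), along the filter `nonDegFilter` of
nondegenerate parameters near a point. Both the line of varying X and the curve τ ↦ (t, x, g, Z)
tend to this filter, so the same five limits u, v, w, Γ, ρ give the values of the polynomials at Z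
and those of the meromorphic functions at τ. This proves (i), default values at poles included.

That the curve avoids degenerate parameters comes from Painlevé VI itself. The pair (x, Z/g)
satisfies its Hamiltonian system (`hamCurve`), by the heat equation for ζ, which Liouville's theorem
yields (`heat_eq_zero`). Each step of the recursion is a canonical transformation to the system with
shifted parameters, and that system forbids p_n, or b_{n+1} - c_i, to vanish identically. It also
fixes dp_k/dt where p_k = 0. A zero of Q_n is a zero of p_n, a zero of Q_{n-2} is a zero of p_{n-2};
multiplying the rate of vanishing by the limit of q_n p_n, respectively q_n p_{n-2}, gives the two
residues in (ii) (`tendsto_residue`). -/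

noncomputable section

namespace LamePVI

open Filter Topology

/-! ### First-order expansions along a filter -/

section Jets

variable {α : Type*} {l : Filter α}

/-- `y = y₀ + O(ε)`, where the first-order coefficient `(y - y₀)/ε` has a limit along `l`. -/
def Jet (l : Filter α) (ε y : α → ℂ) (y₀ : ℂ) : Prop :=
  ∃ L, Tendsto (fun a => (y a - y₀) / ε a) l (𝓝 L)

/-- `f` has a nonzero limit along `l`. -/
def UnitLim (l : Filter α) (f : α → ℂ) : Prop := ∃ L, L ≠ 0 ∧ Tendsto f l (𝓝 L)

theorem UnitLim.congr {f g : α → ℂ} (h : UnitLim l f) (e : ∀ᶠ a in l, f a = g a) :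
    UnitLim l g := by
  obtain ⟨L, h0, hL⟩ := h
  exact ⟨L, h0, hL.congr' e⟩

theorem UnitLim.mul {f g : α → ℂ} (hf : UnitLim l f) (hg : UnitLim l g) :
    UnitLim l (fun a => f a * g a) := by
  obtain ⟨L, h0, hL⟩ := hf
  obtain ⟨M, h1, hM⟩ := hg
  exact ⟨L * M, mul_ne_zero h0 h1, hL.mul hM⟩

theorem UnitLim.div {f g : α → ℂ} (hf : UnitLim l f) (hg : UnitLim l g) :
    UnitLim l (fun a => f a / g a) := by
  obtain ⟨L, h0, hL⟩ := hf
  obtain ⟨M, h1, hM⟩ := hg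
  exact ⟨L / M, div_ne_zero h0 h1, hL.div hM h1⟩

theorem UnitLim.pow {f : α → ℂ} (hf : UnitLim l f) (n : ℕ) :
    UnitLim l (fun a => f a ^ n) := by
  obtain ⟨L, h0, hL⟩ := hf
  exact ⟨L ^ n, pow_ne_zero n h0, hL.pow n⟩

theorem UnitLim.prod {ι : Type*} (s : Finset ι) {f : ι → α → ℂ}
    (hf : ∀ i ∈ s, UnitLim l (f i)) : UnitLim l (fun a => ∏ i ∈ s, f i a) := by
  choose! L h0 hL using hf
  exact ⟨∏ i ∈ s, L i, Finset.prod_ne_zero_iff.2 h0, tendsto_finsetProd s hL⟩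

variable {ε : α → ℂ}

theorem Jet.congr {y z : α → ℂ} {y₀ : ℂ} (h : Jet l ε y y₀) (e : ∀ᶠ a in l, y a = z a) :
    Jet l ε z y₀ := by
  obtain ⟨L, hL⟩ := h
  refine ⟨L, hL.congr' ?_⟩
  filter_upwards [e] with a ha
  rw [ha]

theorem Jet.const (c : ℂ) : Jet l ε (fun _ => c) c :=
  ⟨0, by simpa using tendsto_const_nhds⟩

theorem Jet.add {y z : α → ℂ} {y₀ z₀ : ℂ} (hy : Jet l ε y y₀) (hz : Jet l ε z z₀) :
    Jet l ε (fun a => y a + z a) (y₀ + z₀) := by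
  obtain ⟨L, hL⟩ := hy
  obtain ⟨M, hM⟩ := hz
  refine ⟨L + M, (hL.add hM).congr fun a => ?_⟩
  ring

theorem Jet.const_mul {y : α → ℂ} {y₀ : ℂ} (c : ℂ) (hy : Jet l ε y y₀) :
    Jet l ε (fun a => c * y a) (c * y₀) := by
  obtain ⟨L, hL⟩ := hy
  refine ⟨c * L, (hL.const_mul c).congr fun a => ?_⟩
  ring

theorem Jet.sub {y z : α → ℂ} {y₀ z₀ : ℂ} (hy : Jet l ε y y₀) (hz : Jet l ε z z₀) :
    Jet l ε (fun a => y a - z a) (y₀ - z₀) := by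
  have := hy.add (hz.const_mul (-1))
  simpa [sub_eq_add_neg] using this

theorem Jet.sum {ι : Type*} (s : Finset ι) {y : ι → α → ℂ} {y₀ : ι → ℂ}
    (h : ∀ i ∈ s, Jet l ε (y i) (y₀ i)) :
    Jet l ε (fun a => ∑ i ∈ s, y i a) (∑ i ∈ s, y₀ i) := by
  choose! L hL using h
  refine ⟨∑ i ∈ s, L i, (tendsto_finsetSum s hL).congr fun a => ?_⟩
  rw [← Finset.sum_sub_distrib, Finset.sum_div]

/-- The points c_i are known only to converge. Multiplied by ε they still have a first-order
expansion, with leading value 0, so they do not affect the leading coefficients below. -/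
theorem Jet.eps_mul (hε0 : ∀ᶠ a in l, ε a ≠ 0) {z : α → ℂ} {z₀ : ℂ} (hz : Tendsto z l (𝓝 z₀)) :
    Jet l ε (fun a => ε a * z a) 0 := by
  refine ⟨z₀, hz.congr' ?_⟩
  filter_upwards [hε0] with a ha
  field_simp
  ring

theorem Jet.tendsto (hε : Tendsto ε l (𝓝 0)) (hε0 : ∀ᶠ a in l, ε a ≠ 0) {y : α → ℂ} {y₀ : ℂ}
    (h : Jet l ε y y₀) : Tendsto y l (𝓝 y₀) := by
  obtain ⟨L, hL⟩ := h
  have h1 := (hL.mul hε).add_const y₀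
  rw [mul_zero, zero_add] at h1
  refine h1.congr' ?_
  filter_upwards [hε0] with a ha
  field_simp
  ring

theorem Jet.inv (hε : Tendsto ε l (𝓝 0)) (hε0 : ∀ᶠ a in l, ε a ≠ 0) {y : α → ℂ} {y₀ : ℂ}
    (h : Jet l ε y y₀) (h0 : y₀ ≠ 0) : Jet l ε (fun a => (y a)⁻¹) y₀⁻¹ := by
  have ht := h.tendsto hε hε0
  obtain ⟨L, hL⟩ := h
  refine ⟨-L / (y₀ * y₀), (hL.neg.div (ht.mul_const y₀) (mul_ne_zero h0 h0)).congr' ?_⟩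
  filter_upwards [hε0, ht.eventually_ne h0] with a ha hy
  simp only [Pi.div_apply]
  field_simp
  ring

theorem Jet.tendsto_div {y : α → ℂ} (h : Jet l ε y 0) :
    ∃ L, Tendsto (fun a => y a / ε a) l (𝓝 L) := by
  simpa [Jet] using h

theorem Jet.unitLim (hε : Tendsto ε l (𝓝 0)) (hε0 : ∀ᶠ a in l, ε a ≠ 0) {y : α → ℂ} {y₀ : ℂ}
    (h : Jet l ε y y₀) (h0 : y₀ ≠ 0) : UnitLim l y := ⟨y₀, h0, h.tendsto hε hε0⟩

end Jets

/-! ### Confinement of the singularities of the chain -/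

section Confinement

variable {α : Type*} {l : Filter α}

/-- The recursion satisfied by `b_n = φ_{n-1}/D_{n-1}`, `p_n`, `Q_n`, `G_n`, along a filter on which
no denominator vanishes. The index of `Q` is shifted: `Q n` stands for `Q_{n-2}`. -/
structure Chain (l : Filter α) (c : Fin 3 → α → ℂ) (c₀ : Fin 3 → ℂ) (b p Q G : ℕ → α → ℂ) :
    Prop where
  c_lim : ∀ i, Tendsto (c i) l (𝓝 (c₀ i))
  c_inj : Function.Injective c₀
  p_ne : ∀ n, ∀ᶠ a in l, p n a ≠ 0
  b_ne : ∀ n i, ∀ᶠ a in l, b n a - c i a ≠ 0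
  Q_ne : ∀ n, ∀ᶠ a in l, Q n a ≠ 0
  b_succ : ∀ n, ∀ᶠ a in l, b (n + 1) a = b n a + ((n : ℂ) + 1 / 2) / p n a
  p_succ : ∀ n, ∀ᶠ a in l,
    p (n + 1) a = p n a - ((n : ℂ) + 1) / 2 * ∑ i, (b (n + 1) a - c i a)⁻¹
  G_succ : ∀ n, ∀ᶠ a in l,
    G (n + 1) a = (∏ i, (b (n + 1) a - c i a)) * (Q (n + 1) a * Q (n + 2) a) ^ 3 / G n a
  Q_eq : ∀ n, ∀ᶠ a in l, Q (n + 2) a = p n a * G n a / (Q n a * Q (n + 1) a)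

variable {c : Fin 3 → α → ℂ} {c₀ : Fin 3 → ℂ} {b p Q G : ℕ → α → ℂ}

/-- The point `(b_n, p_n)` stays finite. -/
structure RegB (l : Filter α) (b p Q G : ℕ → α → ℂ) (n : ℕ) (β π : ℂ) : Prop where
  b_lim : Tendsto (b n) l (𝓝 β)
  p_lim : Tendsto (p n) l (𝓝 π)
  Q_lim : UnitLim l (Q n)
  Q_lim' : UnitLim l (Q (n + 1))
  G_lim : UnitLim l (G n)

/-- The point `(b_{n+1}, p_n)` stays finite. -/
structure RegA (l : Filter α) (b p Q G : ℕ → α → ℂ) (n : ℕ) (β π : ℂ) : Prop where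
  b_lim : Tendsto (b (n + 1)) l (𝓝 β)
  p_lim : Tendsto (p n) l (𝓝 π)
  Q_lim : UnitLim l (Q (n + 1))
  Q_lim' : UnitLim l (Q (n + 2))
  G_lim : UnitLim l (G n)

/-- `q_n = b_n + (n+1)/(2 p_n)`. -/
def qOf (b p : ℕ → α → ℂ) (n : ℕ) (a : α) : ℂ := b n a + ((n : ℂ) + 1) / (2 * p n a)

/-- Values and mutual coprimality of `Q_{n-2}`, `Q_{n-1}`, `Q_n`, `G_n`, `R_n = q_n Q_{n-2} Q_n` in
the limit, with the asymptotics of `q_n` where `Q_{n-2}` or `Q_n` vanishes. -/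
structure Confined (l : Filter α) (b p Q G : ℕ → α → ℂ) (n : ℕ) (u v w Γ ρ : ℂ) : Prop where
  u_lim : Tendsto (Q n) l (𝓝 u)
  v_lim : Tendsto (Q (n + 1)) l (𝓝 v)
  w_lim : Tendsto (Q (n + 2)) l (𝓝 w)
  Γ_lim : Tendsto (G n) l (𝓝 Γ)
  ρ_lim : Tendsto (fun a => qOf b p n a * (Q n a * Q (n + 2) a)) l (𝓝 ρ)
  of_Γ : Γ = 0 → u * v * w ≠ 0
  of_uw : u * w = 0 → ρ ≠ 0
  of_w : w = 0 → u ≠ 0 ∧ ∃ β, Tendsto (b n) l (𝓝 β) ∧ Tendsto (p n) l (𝓝 0) ∧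
    Tendsto (fun a => qOf b p n a * p n a) l (𝓝 (((n : ℂ) + 1) / 2))
  of_u : u = 0 → w ≠ 0 ∧ ∃ k, n = k + 2 ∧ ∃ β, Tendsto (b k) l (𝓝 β) ∧ Tendsto (p k) l (𝓝 0) ∧
    Tendsto (fun a => qOf b p n a * p k a) l
      (𝓝 (-(((k : ℂ) + 1) * (2 * k + 1) / (2 * (2 * k + 5)))))

theorem natCast_add_ne_zero (n k : ℕ) (hk : k ≠ 0) : (n : ℂ) + k ≠ 0 := by
  exact_mod_cast (by omega : n + k ≠ 0)

theorem two_mul_natCast_add_ne_zero (n k : ℕ) (hk : k ≠ 0) : 2 * (n : ℂ) + k ≠ 0 := by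
  exact_mod_cast (by omega : 2 * n + k ≠ 0)

namespace Chain

variable (h : Chain l c c₀ b p Q G)
include h

/-- When b ~ N/ε, each of the three terms 1/(b - c_i) is ε/N to leading order, whatever c_i is;
whence 3N⁻¹. -/
theorem jet_p_succ {ε : α → ℂ} (hε : Tendsto ε l (𝓝 0)) (hε0 : ∀ᶠ a in l, ε a ≠ 0) {m : ℕ}
    {N u : ℂ} (hN : N ≠ 0) (hb : Jet l ε (fun a => b (m + 1) a * ε a) N)
    (hp : Jet l ε (fun a => p m a / ε a) u) :
    Jet l ε (fun a => p (m + 1) a / ε a) (u - ((m : ℂ) + 1) / 2 * (3 * N⁻¹)) := by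
  have h1 : ∀ i ∈ (Finset.univ : Finset (Fin 3)),
      Jet l ε (fun a => (b (m + 1) a * ε a - ε a * c i a)⁻¹) N⁻¹ := fun i _ => by
    have := hb.sub (Jet.eps_mul hε0 (h.c_lim i))
    rw [sub_zero] at this
    exact this.inv hε hε0 hN
  have h2 := hp.sub ((Jet.sum _ h1).const_mul (((m : ℂ) + 1) / 2))
  simp only [Finset.sum_const, Finset.card_univ, Fintype.card_fin, nsmul_eq_mul] at h2
  rw [Nat.cast_ofNat] at h2
  refine h2.congr ?_
  filter_upwards [h.p_succ m, hε0] with a ha h0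
  have : ∀ i : Fin 3, (b (m + 1) a * ε a - ε a * c i a)⁻¹ = (b (m + 1) a - c i a)⁻¹ / ε a :=
    fun i => by
      rw [show b (m + 1) a * ε a - ε a * c i a = (b (m + 1) a - c i a) * ε a by ring, mul_inv]
      rfl
  simp only [this, ← Finset.sum_div]
  rw [ha, sub_div, mul_div_assoc]

theorem jet_b_succ {ε : α → ℂ} (hε : Tendsto ε l (𝓝 0)) (hε0 : ∀ᶠ a in l, ε a ≠ 0) {m : ℕ}
    {N u : ℂ} (hu : u ≠ 0) (hb : Jet l ε (fun a => b m a * ε a) N)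
    (hp : Jet l ε (fun a => p m a / ε a) u) :
    Jet l ε (fun a => b (m + 1) a * ε a) (N + ((m : ℂ) + 1 / 2) * u⁻¹) := by
  refine (hb.add ((hp.inv hε hε0 hu).const_mul ((m : ℂ) + 1 / 2))).congr ?_
  filter_upwards [h.b_succ m, hε0] with a ha h0
  rw [ha, inv_div]
  ring

theorem tendsto_sum_inv {f : α → ℂ} {β : ℂ} (hf : Tendsto f l (𝓝 β)) (s : Finset (Fin 3))
    (hs : ∀ i ∈ s, β ≠ c₀ i) :
    Tendsto (fun a => ∑ i ∈ s, (f a - c i a)⁻¹) l (𝓝 (∑ i ∈ s, (β - c₀ i)⁻¹)) :=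
  tendsto_finsetSum s fun i hi => (hf.sub (h.c_lim i)).inv₀ (sub_ne_zero.2 (hs i hi))

theorem unitLim_prod {f : α → ℂ} {β : ℂ} (hf : Tendsto f l (𝓝 β)) (s : Finset (Fin 3))
    (hs : ∀ i ∈ s, β ≠ c₀ i) : UnitLim l (fun a => ∏ i ∈ s, (f a - c i a)) :=
  UnitLim.prod s fun i hi => ⟨β - c₀ i, sub_ne_zero.2 (hs i hi), hf.sub (h.c_lim i)⟩

/-- At a finite point only Q_n can vanish, and it does so exactly with p_n. There q_n has a pole,
whose strength is read off from q_n p_n = b_n p_n + (n+1)/2. -/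
theorem confined_of_regB {n : ℕ} {β π : ℂ} (hB : RegB l b p Q G n β π) :
    ∃ u v w Γ ρ, Confined l b p Q G n u v w Γ ρ := by
  obtain ⟨u, hu0, hu⟩ := hB.Q_lim
  obtain ⟨v, hv0, hv⟩ := hB.Q_lim'
  obtain ⟨Γ, hΓ0, hΓ⟩ := hB.G_lim
  have hw : Tendsto (Q (n + 2)) l (𝓝 (π * Γ / (u * v))) := by
    refine ((hB.p_lim.mul hΓ).div (hu.mul hv) (mul_ne_zero hu0 hv0)).congr' ?_
    filter_upwards [h.Q_eq n] with a ha
    exact ha.symm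
  have hq : Tendsto (fun a => qOf b p n a * p n a) l (𝓝 (β * π + ((n : ℂ) + 1) / 2)) := by
    refine ((hB.b_lim.mul hB.p_lim).add_const (((n : ℂ) + 1) / 2)).congr' ?_
    filter_upwards [h.p_ne n] with a ha
    rw [qOf]
    field_simp
  have hρ : Tendsto (fun a => qOf b p n a * (Q n a * Q (n + 2) a)) l
      (𝓝 ((β * π + ((n : ℂ) + 1) / 2) * Γ / v)) := by
    refine ((hq.mul hΓ).div hv hv0).congr' ?_
    filter_upwards [h.Q_eq n, h.Q_ne n, h.Q_ne (n + 1)] with a h1 h2 h3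
    rw [h1]
    simp only [Pi.div_apply]
    field_simp
  have hn := natCast_add_ne_zero n 1 one_ne_zero
  have hn' : ((n : ℂ) + 1) / 2 ≠ 0 := div_ne_zero (by simpa using hn) two_ne_zero
  have hπ : π * Γ / (u * v) = 0 → π = 0 := fun h0 => by
    simpa [hu0, hv0, hΓ0] using h0
  refine ⟨u, v, _, Γ, _, hu, hv, hw, hΓ, hρ, fun h0 => (hΓ0 h0).elim, fun h0 => ?_, fun h0 => ?_,
    fun h0 => (hu0 h0).elim⟩
  · have := hπ ((mul_eq_zero.1 h0).resolve_left hu0)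
    rw [this, mul_zero, zero_add]
    exact div_ne_zero (mul_ne_zero hn' hΓ0) hv0
  · have := hπ h0
    subst this
    refine ⟨hu0, β, hB.b_lim, hB.p_lim, ?_⟩
    simpa using hq

theorem regA_of_regB {n : ℕ} {β π : ℂ} (hB : RegB l b p Q G n β π) (hπ : π ≠ 0) :
    ∃ β', RegA l b p Q G n β' π := by
  refine ⟨β + ((n : ℂ) + 1 / 2) / π, ?_, hB.p_lim, hB.Q_lim', ?_, hB.G_lim⟩
  · refine (hB.b_lim.add (tendsto_const_nhds.div hB.p_lim hπ)).congr' ?_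
    filter_upwards [h.b_succ n] with a ha
    exact ha.symm
  · refine ((UnitLim.mul ⟨π, hπ, hB.p_lim⟩ hB.G_lim).div
      (hB.Q_lim.mul hB.Q_lim')).congr ?_
    filter_upwards [h.Q_eq n] with a ha
    exact ha.symm

/-- Confinement of b = ∞. With ε = p_k as small parameter, b_{k+1} and b_{k+2} are of order 1/ε and
p_{k+1}, p_{k+2} of order ε. The leading coefficients are explicit rational numbers in k, nonzero
until the orbit becomes finite again. -/
theorem confined_of_regB_zero {k : ℕ} {β : ℂ} (hB : RegB l b p Q G k β 0) :
    (∃ u v w Γ ρ, Confined l b p Q G (k + 1) u v w Γ ρ) ∧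
    (∃ u v w Γ ρ, Confined l b p Q G (k + 2) u v w Γ ρ) ∧
    ∃ β', RegA l b p Q G (k + 2) β' 0 := by
  have hε := hB.p_lim
  have hε0 := h.p_ne k
  have k1 : (k : ℂ) + 1 ≠ 0 := by simpa using natCast_add_ne_zero k 1 one_ne_zero
  have k2 : (k : ℂ) + 2 ≠ 0 := by simpa using natCast_add_ne_zero k 2 two_ne_zero
  have k3 : 2 * (k : ℂ) + 1 ≠ 0 := by simpa using two_mul_natCast_add_ne_zero k 1 one_ne_zero
  have k5 : 2 * (k : ℂ) + 5 ≠ 0 := by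
    simpa using two_mul_natCast_add_ne_zero k 5 (by norm_num)
  have jb0 : Jet l (p k) (fun a => b k a * p k a) 0 :=
    (Jet.eps_mul hε0 hB.b_lim).congr (Eventually.of_forall fun a => mul_comm _ _)
  have jp0 : Jet l (p k) (fun a => p k a / p k a) 1 :=
    (Jet.const 1).congr (hε0.mono fun a ha => (div_self ha).symm)
  have jb1 : Jet l (p k) (fun a => b (k + 1) a * p k a) ((2 * k + 1) / 2) := by
    have := h.jet_b_succ hε hε0 one_ne_zero jb0 jp0
    rwa [show (0 : ℂ) + ((k : ℂ) + 1 / 2) * 1⁻¹ = (2 * k + 1) / 2 by ring] at this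
  have n1 : (2 * (k : ℂ) + 1) / 2 ≠ 0 := div_ne_zero k3 two_ne_zero
  have jp1 : Jet l (p k) (fun a => p (k + 1) a / p k a) (-(k + 2) / (2 * k + 1)) := by
    have := h.jet_p_succ hε hε0 n1 jb1 jp0
    rwa [show (1 : ℂ) - ((k : ℂ) + 1) / 2 * (3 * ((2 * (k : ℂ) + 1) / 2)⁻¹)
      = -(k + 2) / (2 * k + 1) by
        rw [inv_div, eq_div_iff k3, sub_mul, mul_assoc, mul_assoc, div_mul_cancel₀ _ k3]; ring] at this
  have n1' : -((k : ℂ) + 2) / (2 * k + 1) ≠ 0 := div_ne_zero (neg_ne_zero.2 k2) k3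
  have jb2 : Jet l (p k) (fun a => b (k + 2) a * p k a)
      (-((2 * k + 1) * (k + 1) / (2 * (k + 2)))) := by
    have := h.jet_b_succ hε hε0 n1' jb1 jp1
    push_cast at this
    rwa [show (2 * (k : ℂ) + 1) / 2 + ((k : ℂ) + 1 + 1 / 2) * (-((k : ℂ) + 2) / (2 * k + 1))⁻¹
      = -((2 * k + 1) * (k + 1) / (2 * (k + 2))) by
        rw [inv_div]; field_simp; ring] at this
  have n2 : -((2 * (k : ℂ) + 1) * (k + 1) / (2 * (k + 2))) ≠ 0 :=
    neg_ne_zero.2 (div_ne_zero (mul_ne_zero k3 k1) (mul_ne_zero two_ne_zero k2))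
  have jp2 : Jet l (p k) (fun a => p (k + 2) a / p k a)
      ((k + 2) * (2 * k + 5) / ((2 * k + 1) * (k + 1))) := by
    have := h.jet_p_succ hε hε0 n2 jb2 jp1
    push_cast at this
    rwa [show -((k : ℂ) + 2) / (2 * k + 1) - ((k : ℂ) + 1 + 1) / 2 *
        (3 * (-((2 * (k : ℂ) + 1) * (k + 1) / (2 * (k + 2))))⁻¹)
      = (k + 2) * (2 * k + 5) / ((2 * k + 1) * (k + 1)) by
        rw [inv_neg, inv_div]; field_simp; ring] at this
  have n2' : ((k : ℂ) + 2) * (2 * k + 5) / ((2 * k + 1) * (k + 1)) ≠ 0 :=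
    div_ne_zero (mul_ne_zero k2 k5) (mul_ne_zero k3 k1)
  -- The 1/ε terms of b_{k+3} cancel. The jet also controls the next order, so dividing by ε leaves
  -- a finite limit for b_{k+3}; a mere limit of b_{k+3} ε would not suffice.
  have jb3 : Jet l (p k) (fun a => b (k + 3) a * p k a) 0 := by
    have := h.jet_b_succ hε hε0 n2' jb2 jp2
    push_cast at this
    rwa [show -((2 * (k : ℂ) + 1) * (k + 1) / (2 * (k + 2))) + ((k : ℂ) + 2 + 1 / 2) *
        (((k : ℂ) + 2) * (2 * k + 5) / ((2 * k + 1) * (k + 1)))⁻¹ = 0 by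
        rw [inv_div]; field_simp; ring] at this
  -- The same kind of cancellation keeps q_{k+1} finite although b_{k+1} is not.
  have jq1 : Jet l (p k) (fun a => qOf b p (k + 1) a * p k a) 0 := by
    have := jb1.add ((jp1.inv hε hε0 n1').const_mul (((k : ℂ) + 2) / 2))
    rw [show (2 * (k : ℂ) + 1) / 2 + ((k : ℂ) + 2) / 2 * (-((k : ℂ) + 2) / (2 * k + 1))⁻¹ = 0 by
      rw [inv_div]; field_simp; ring] at this
    refine this.congr ?_
    filter_upwards [h.p_ne (k + 1)] with a ha
    rw [qOf, inv_div]
    push_cast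
    field_simp
    ring
  have jq2 : Jet l (p k) (fun a => qOf b p (k + 2) a * p k a)
      (-(((k : ℂ) + 1) * (2 * k + 1) / (2 * (2 * k + 5)))) := by
    have := jb2.add ((jp2.inv hε hε0 n2').const_mul (((k : ℂ) + 3) / 2))
    rw [show -((2 * (k : ℂ) + 1) * (k + 1) / (2 * (k + 2))) + ((k : ℂ) + 3) / 2 *
        (((k : ℂ) + 2) * (2 * k + 5) / ((2 * k + 1) * (k + 1)))⁻¹
        = -(((k : ℂ) + 1) * (2 * k + 1) / (2 * (2 * k + 5))) by
      rw [inv_div]; field_simp; ring] at this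
    refine this.congr ?_
    filter_upwards [h.p_ne (k + 2)] with a ha
    rw [qOf, inv_div]
    push_cast
    field_simp
    ring
  have nq2 : -(((k : ℂ) + 1) * (2 * k + 1) / (2 * (2 * k + 5))) ≠ 0 :=
    neg_ne_zero.2 (div_ne_zero (mul_ne_zero k1 k3) (mul_ne_zero two_ne_zero k5))
  have jbc : ∀ {N : ℂ} {m : ℕ}, N ≠ 0 → Jet l (p k) (fun a => b m a * p k a) N →
      UnitLim l (fun a => ∏ i, (b m a * p k a - p k a * c i a)) := fun {N m} hN hj =>
    UnitLim.prod _ fun i _ => by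
      have := hj.sub (Jet.eps_mul hε0 (h.c_lim i))
      rw [sub_zero] at this
      exact this.unitLim hε hε0 hN
  have prod_eq : ∀ m a, (∏ i, (b m a * p k a - p k a * c i a))
      = (∏ i, (b m a - c i a)) * p k a ^ 3 := fun m a => by
    simp only [Fin.prod_univ_three]
    ring
  -- the polynomials `Q_k/p_k`, `G_{k+1}`, `Q_{k+1}`, `G_{k+2}`, `Q_{k+2}` have nonzero limits
  have uQ2 : UnitLim l (fun a => Q (k + 2) a / p k a) := by
    refine (hB.G_lim.div (hB.Q_lim.mul hB.Q_lim')).congr ?_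
    filter_upwards [h.Q_eq k, hε0] with a h1 h2
    rw [h1]
    field_simp
  have uG1 : UnitLim l (G (k + 1)) := by
    refine (((jbc n1 jb1).mul ((hB.Q_lim'.mul uQ2).pow 3)).div hB.G_lim).congr ?_
    filter_upwards [h.G_succ k, hε0] with a h1 h2
    rw [prod_eq, h1]
    field_simp
  have uQ3 : UnitLim l (Q (k + 3)) := by
    refine (((jp1.unitLim hε hε0 n1').mul uG1).div (hB.Q_lim'.mul uQ2)).congr ?_
    filter_upwards [h.Q_eq (k + 1), hε0] with a h1 h2
    rw [h1]
    field_simp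
  have uG2 : UnitLim l (G (k + 2)) := by
    refine (((jbc n2 jb2).mul ((uQ2.mul uQ3).pow 3)).div uG1).congr ?_
    filter_upwards [h.G_succ (k + 1), hε0] with a h1 h2
    rw [prod_eq, h1]
    field_simp
  have uQ4 : UnitLim l (Q (k + 4)) := by
    refine (((jp2.unitLim hε hε0 n2').mul uG2).div (uQ2.mul uQ3)).congr ?_
    filter_upwards [h.Q_eq (k + 2), hε0] with a h1 h2
    rw [h1]
    field_simp
  have zQ2 : Tendsto (Q (k + 2)) l (𝓝 0) := by
    obtain ⟨M, -, hM⟩ := uQ2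
    have := hM.mul hε
    rw [mul_zero] at this
    refine this.congr' ?_
    filter_upwards [hε0] with a h2
    field_simp
  -- The zero of Q_k is the middle one of the three Q's at index k+1, where it does no harm, and the
  -- first one at index k+2, where it makes q_{k+2} infinite.
  refine ⟨?_, ?_, ?_⟩
  · obtain ⟨u, hu0, hu⟩ := hB.Q_lim'
    obtain ⟨w, hw0, hw⟩ := uQ3
    obtain ⟨Γ, hΓ0, hΓ⟩ := uG1
    obtain ⟨L, hL⟩ := jq1.tendsto_div
    have hq : Tendsto (fun a => qOf b p (k + 1) a) l (𝓝 L) := by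
      refine hL.congr' ?_
      filter_upwards [hε0] with a h2
      field_simp
    exact ⟨u, 0, w, Γ, _, hu, zQ2, hw, hΓ, hq.mul (hu.mul hw), fun h0 => (hΓ0 h0).elim,
      fun h0 => (mul_ne_zero hu0 hw0 h0).elim, fun h0 => (hw0 h0).elim, fun h0 => (hu0 h0).elim⟩
  · have hρ := ((jq2.unitLim hε hε0 nq2).mul uQ2).mul uQ4
    obtain ⟨v, hv0, hv⟩ := uQ3
    obtain ⟨w, hw0, hw⟩ := uQ4
    obtain ⟨Γ, hΓ0, hΓ⟩ := uG2
    obtain ⟨ρ, hρ0, hρ⟩ := hρ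
    refine ⟨0, v, w, Γ, ρ, zQ2, hv, hw, hΓ, hρ.congr' ?_, fun h0 => (hΓ0 h0).elim,
      fun _ => hρ0, fun h0 => (hw0 h0).elim, fun _ => ⟨hw0, k, rfl, β, hB.b_lim, hε,
        jq2.tendsto hε hε0⟩⟩
    filter_upwards [hε0] with a h2
    field_simp
  · obtain ⟨L, hL⟩ := jb3.tendsto_div
    refine ⟨L, ?_, ?_, uQ3, uQ4, uG2⟩
    · refine hL.congr' ?_
      filter_upwards [hε0] with a h2
      field_simp
    · have := (jp2.tendsto hε hε0).mul hε
      rw [mul_zero] at this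
      refine this.congr' ?_
      filter_upwards [hε0] with a h2
      field_simp

theorem regB_of_regA {n : ℕ} {β π : ℂ} (hA : RegA l b p Q G n β π) (hβ : ∀ i, β ≠ c₀ i) :
    ∃ π', RegB l b p Q G (n + 1) β π' := by
  refine ⟨π - ((n : ℂ) + 1) / 2 * ∑ i, (β - c₀ i)⁻¹, hA.b_lim, ?_, hA.Q_lim, hA.Q_lim', ?_⟩
  · refine (hA.p_lim.sub ((h.tendsto_sum_inv hA.b_lim _ fun i _ => hβ i).const_mul _)).congr' ?_
    filter_upwards [h.p_succ n] with a ha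
    exact ha.symm
  · refine (((h.unitLim_prod hA.b_lim Finset.univ fun i _ => hβ i).mul
      ((hA.Q_lim.mul hA.Q_lim').pow 3)).div hA.G_lim).congr ?_
    filter_upwards [h.G_succ n] with a ha
    exact ha.symm

/-- Confinement of b = c_i. With δ = b_{m+1} - c_i as small parameter, p_{m+1} ~ -(m+1)/(2δ) and
b_{m+2} - c_i ~ -(m+2)/(m+1) · δ. Here G_{m+1} is the only one of the Q's and G's involved that
tends to 0. -/
theorem confined_of_regA_eq {m : ℕ} {π : ℂ} (i : Fin 3)
    (hA : RegA l b p Q G m (c₀ i) π) :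
    (∃ u v w Γ ρ, Confined l b p Q G (m + 1) u v w Γ ρ) ∧
    ∃ β' π', RegB l b p Q G (m + 2) β' π' := by
  have m1 : (m : ℂ) + 1 ≠ 0 := by simpa using natCast_add_ne_zero m 1 one_ne_zero
  have m2 : (m : ℂ) + 2 ≠ 0 := by simpa using natCast_add_ne_zero m 2 two_ne_zero
  set δ : α → ℂ := fun a => b (m + 1) a - c i a with hδdef
  have hδ : Tendsto δ l (𝓝 0) := by simpa using hA.b_lim.sub (h.c_lim i)
  have hδ0 : ∀ᶠ a in l, δ a ≠ 0 := h.b_ne (m + 1) i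
  have hne : ∀ j ∈ Finset.univ.erase i, c₀ i ≠ c₀ j := fun j hj e =>
    (Finset.ne_of_mem_erase hj) (h.c_inj e).symm
  have jw : Jet l δ (fun a => δ a * p (m + 1) a) (-((m : ℂ) + 1) / 2) := by
    have hS := hA.p_lim.sub ((h.tendsto_sum_inv hA.b_lim _ hne).const_mul (((m : ℂ) + 1) / 2))
    have := (Jet.const (l := l) (ε := δ) (-((m : ℂ) + 1) / 2)).add (Jet.eps_mul hδ0 hS)
    rw [add_zero] at this
    refine this.congr ?_
    filter_upwards [h.p_succ m, hδ0] with a h1 h2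
    rw [h1, ← Finset.add_sum_erase _ _ (Finset.mem_univ i)]
    change _ = δ a * (p m a - ((m : ℂ) + 1) / 2 * ((δ a)⁻¹ + _))
    field_simp
    ring
  have w0 : -((m : ℂ) + 1) / 2 ≠ 0 := div_ne_zero (neg_ne_zero.2 m1) two_ne_zero
  have jy : Jet l δ (fun a => (b (m + 2) a - c i a) / δ a) (-(m + 2) / (m + 1)) := by
    have := (Jet.const (l := l) (ε := δ) 1).add
      ((jw.inv hδ hδ0 w0).const_mul ((m : ℂ) + 1 + 1 / 2))
    rw [show (1 : ℂ) + ((m : ℂ) + 1 + 1 / 2) * (-((m : ℂ) + 1) / 2)⁻¹ = -(m + 2) / (m + 1) by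
      rw [inv_div]; field_simp; ring] at this
    refine this.congr ?_
    filter_upwards [h.b_succ (m + 1), hδ0, h.p_ne (m + 1)] with a h1 h2 h3
    rw [h1]
    push_cast
    rw [show b (m + 1) a + ((m : ℂ) + 1 + 1 / 2) / p (m + 1) a - c i a
      = δ a + ((m : ℂ) + 1 + 1 / 2) / p (m + 1) a by rw [hδdef]; ring]
    field_simp
  have y0 : -((m : ℂ) + 2) / (m + 1) ≠ 0 := div_ne_zero (neg_ne_zero.2 m2) m1
  have hb2 : Tendsto (b (m + 2)) l (𝓝 (c₀ i)) := by
    have := ((jy.tendsto hδ hδ0).mul hδ).add (h.c_lim i)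
    rw [mul_zero, zero_add] at this
    refine this.congr' ?_
    filter_upwards [hδ0] with a h2
    field_simp
    ring
  -- The 1/δ terms of p_{m+1} and of (m+2)/2 · 1/(b_{m+2} - c_i) cancel. The other two points c_j
  -- contribute finite terms.
  have hp2 : ∃ π', Tendsto (p (m + 2)) l (𝓝 π') := by
    have := jw.sub ((jy.inv hδ hδ0 y0).const_mul (((m : ℂ) + 1 + 1) / 2))
    rw [show -((m : ℂ) + 1) / 2 - ((m : ℂ) + 1 + 1) / 2 * (-((m : ℂ) + 2) / (m + 1))⁻¹ = 0 by
      rw [inv_div]; field_simp; ring] at this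
    obtain ⟨L, hL⟩ := this.tendsto_div
    refine ⟨_, (hL.sub ((h.tendsto_sum_inv hb2 _ hne).const_mul (((m : ℂ) + 1 + 1) / 2))).congr' ?_⟩
    filter_upwards [h.p_succ (m + 1), hδ0] with a h1 h2
    rw [h1, ← Finset.add_sum_erase _ _ (Finset.mem_univ i), inv_div]
    push_cast
    field_simp
    ring
  have uG1 : UnitLim l (fun a => G (m + 1) a / δ a) := by
    refine (((h.unitLim_prod hA.b_lim _ hne).mul ((hA.Q_lim.mul hA.Q_lim').pow 3)).div
      hA.G_lim).congr ?_
    filter_upwards [h.G_succ m, hδ0] with a h1 h2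
    rw [h1, ← Finset.mul_prod_erase _ _ (Finset.mem_univ i)]
    change _ = δ a * _ * _ / _ / _
    field_simp
  have uQ3 : UnitLim l (Q (m + 3)) := by
    refine (((jw.unitLim hδ hδ0 w0).mul uG1).div (hA.Q_lim.mul hA.Q_lim')).congr ?_
    filter_upwards [h.Q_eq (m + 1), hδ0] with a h1 h2
    rw [h1]
    field_simp
  have uG2 : UnitLim l (G (m + 2)) := by
    refine ((((jy.unitLim hδ hδ0 y0).mul (h.unitLim_prod hb2 _ hne)).mul
      ((hA.Q_lim'.mul uQ3).pow 3)).div uG1).congr ?_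
    filter_upwards [h.G_succ (m + 1), hδ0] with a h1 h2
    rw [h1, ← Finset.mul_prod_erase _ _ (Finset.mem_univ i)]
    field_simp
  refine ⟨?_, ?_⟩
  · obtain ⟨u, hu0, hu⟩ := hA.Q_lim
    obtain ⟨v, hv0, hv⟩ := hA.Q_lim'
    obtain ⟨w, hw0, hw⟩ := uQ3
    have hΓ : Tendsto (G (m + 1)) l (𝓝 0) := by
      obtain ⟨M, -, hM⟩ := uG1
      have := hM.mul hδ
      rw [mul_zero] at this
      refine this.congr' ?_
      filter_upwards [hδ0] with a h2
      field_simp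
    have hq : Tendsto (fun a => qOf b p (m + 1) a) l (𝓝 (c₀ i)) := by
      have := hA.b_lim.add ((hδ.const_mul (((m : ℂ) + 2) / 2)).div (jw.tendsto hδ hδ0) w0)
      rw [mul_zero, zero_div, add_zero] at this
      refine this.congr' ?_
      filter_upwards [hδ0, h.p_ne (m + 1)] with a h2 h3
      simp only [Pi.div_apply]
      rw [qOf]
      push_cast
      field_simp
      ring
    exact ⟨u, v, w, 0, _, hu, hv, hw, hΓ, hq.mul (hu.mul hw),
      fun _ => mul_ne_zero (mul_ne_zero hu0 hv0) hw0,
      fun h0 => (mul_ne_zero hu0 hw0 h0).elim, fun h0 => (hw0 h0).elim, fun h0 => (hu0 h0).elim⟩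
  · obtain ⟨π', hπ'⟩ := hp2
    exact ⟨_, π', hb2, hπ', hA.Q_lim', uQ3, uG2⟩

/-- An orbit that enters a singularity leaves it after finitely many steps at a finite point, so the
two confinement lemmas can be iterated. -/
theorem exists_confined {β π : ℂ} (h0 : RegB l b p Q G 0 β π) (n : ℕ) :
    ∃ u v w Γ ρ, Confined l b p Q G n u v w Γ ρ := by
  let Cf : ℕ → Prop := fun n => ∃ u v w Γ ρ, Confined l b p Q G n u v w Γ ρ
  let B : ℕ → Prop := fun n => ∃ β π, RegB l b p Q G n β π
  let A : ℕ → Prop := fun n => ∃ β π, RegA l b p Q G n β π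
  have hBC : ∀ n, B n → Cf n := fun n ⟨_, _, hB⟩ => h.confined_of_regB hB
  have hBn : ∀ n, B n → A n ∨ (Cf (n + 1) ∧ Cf (n + 2) ∧ A (n + 2)) := fun n ⟨β, π, hB⟩ => by
    by_cases hπ : π = 0
    · subst hπ
      obtain ⟨h1, h2, β', h3⟩ := h.confined_of_regB_zero hB
      exact Or.inr ⟨h1, h2, β', 0, h3⟩
    · obtain ⟨β', h1⟩ := h.regA_of_regB hB hπ
      exact Or.inl ⟨β', π, h1⟩
  have hAn : ∀ n, A n → B (n + 1) ∨ (Cf (n + 1) ∧ B (n + 2)) := fun n ⟨β, π, hA⟩ => by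
    by_cases hβ : ∃ i, β = c₀ i
    · obtain ⟨i, rfl⟩ := hβ
      exact Or.inr (h.confined_of_regA_eq i hA)
    · push Not at hβ
      obtain ⟨π', h1⟩ := h.regB_of_regA hA hβ
      exact Or.inl ⟨β, π', h1⟩
  -- The alternatives say where the orbit is next known to be finite, together with the confinement
  -- of the indices skipped inside a singularity.
  have key : ∀ n, Cf n ∧ (B n ∨ A n ∨ B (n + 1) ∨ (Cf (n + 1) ∧ A (n + 1))
      ∨ (Cf (n + 1) ∧ Cf (n + 2) ∧ A (n + 2))) := by
    intro n
    induction n with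
    | zero => exact ⟨hBC 0 ⟨β, π, h0⟩, Or.inl ⟨β, π, h0⟩⟩
    | succ n ih =>
      have fromB : B (n + 1) → Cf (n + 1) ∧ (B (n + 1) ∨ A (n + 1) ∨ B (n + 1 + 1) ∨
          (Cf (n + 1 + 1) ∧ A (n + 1 + 1)) ∨ (Cf (n + 1 + 1) ∧ Cf (n + 1 + 2) ∧ A (n + 1 + 2))) :=
        fun hB => ⟨hBC _ hB, Or.inl hB⟩
      have fromA : A n → Cf (n + 1) ∧ (B (n + 1) ∨ A (n + 1) ∨ B (n + 1 + 1) ∨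
          (Cf (n + 1 + 1) ∧ A (n + 1 + 1)) ∨ (Cf (n + 1 + 1) ∧ Cf (n + 1 + 2) ∧ A (n + 1 + 2))) :=
        fun hA => (hAn n hA).elim fromB fun ⟨h1, h2⟩ => ⟨h1, Or.inr (Or.inr (Or.inl h2))⟩
      rcases ih.2 with hB | hA | hB | ⟨h1, hA⟩ | ⟨h1, h2, hA⟩
      · rcases hBn n hB with hA | ⟨h1, h2, hA⟩
        · exact fromA hA
        · exact ⟨h1, Or.inr (Or.inr (Or.inr (Or.inl ⟨h2, hA⟩)))⟩
      · exact fromA hA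
      · exact fromB hB
      · exact ⟨h1, Or.inr (Or.inl hA)⟩
      · exact ⟨h1, Or.inr (Or.inr (Or.inr (Or.inl ⟨h2, hA⟩)))⟩
  exact (key n).1

end Chain

end Confinement

/-! ### The chain over a field -/

section ChainDef

variable {K : Type*} [Field K]

/-- The pair `(b_n, p_n)`, where `b_0 = x` and `p_0 = y`. -/
def bp (t x y : K) : ℕ → K × K
  | 0 => (x, y)
  | n + 1 =>
    let b := (bp t x y n).1 + ((n : K) + 1 / 2) / (bp t x y n).2
    (b, (bp t x y n).2 - ((n : K) + 1) / 2 * (1 / b + 1 / (b - 1) + 1 / (b - t)))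

/-- The tuple `(Q_{n-2}, Q_{n-1}, Q_n, G_n)` expressed through `(b_n, p_n)`. -/
def chainQG (t x g X : K) : ℕ → K × K × K × K
  | 0 => (1, 1, X, g)
  | n + 1 =>
    let S := chainQG t x g X n
    let b := (bp t x (X / g) (n + 1)).1
    let G' := b * (b - 1) * (b - t) * (S.2.1 * S.2.2.1) ^ 3 / S.2.2.2
    (S.2.1, S.2.2.1, (bp t x (X / g) (n + 1)).2 * G' / (S.2.1 * S.2.2.1), G')

/-- No denominator vanishes at the `n`-th step of the chain. -/
def NonDeg (t x g X : K) (n : ℕ) : Prop :=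
  g ≠ 0 ∧ (bp t x (X / g) n).2 ≠ 0 ∧ (bp t x (X / g) n).1 ≠ 0 ∧
    (bp t x (X / g) n).1 - 1 ≠ 0 ∧ (bp t x (X / g) n).1 - t ≠ 0

theorem chainQG_ne_zero {t x g X : K} {n : ℕ} (h : ∀ k ≤ n, NonDeg t x g X k) :
    (chainQG t x g X n).1 ≠ 0 ∧ (chainQG t x g X n).2.1 ≠ 0 ∧ (chainQG t x g X n).2.2.1 ≠ 0 ∧
      (chainQG t x g X n).2.2.2 ≠ 0 := by
  induction n with
  | zero =>
    obtain ⟨h1, h2, -⟩ := h 0 le_rfl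
    refine ⟨one_ne_zero, one_ne_zero, ?_, h1⟩
    rintro (rfl : X = 0)
    simp [bp] at h2
  | succ n ih =>
    obtain ⟨-, h2, h3, h4⟩ := ih fun k hk => h k (hk.trans n.le_succ)
    obtain ⟨-, h5, h6, h7, h8⟩ := h (n + 1) le_rfl
    have hG : (chainQG t x g X (n + 1)).2.2.2 ≠ 0 :=
      div_ne_zero (mul_ne_zero (mul_ne_zero (mul_ne_zero h6 h7) h8)
        (pow_ne_zero 3 (mul_ne_zero h2 h3))) h4
    exact ⟨h2, h3, div_ne_zero (mul_ne_zero h5 hG) (mul_ne_zero h2 h3), hG⟩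

theorem chainQG_eq {t x g X : K} {n : ℕ} (h : ∀ k ≤ n, NonDeg t x g X k) :
    (chainQG t x g X n).2.2.1 = (bp t x (X / g) n).2 * (chainQG t x g X n).2.2.2 /
      ((chainQG t x g X n).1 * (chainQG t x g X n).2.1) := by
  cases n with
  | zero =>
    obtain ⟨h1, -⟩ := h 0 le_rfl
    simp [chainQG, bp, h1]
  | succ n => rfl

end ChainDef

/-! ### The universal filter of nondegenerate parameters near a point -/

/-- Parameters `(t, x, g, X)`. -/
abbrev Params : Type := ℂ × ℂ × ℂ × ℂ

def bC (n : ℕ) (P : Params) : ℂ := (bp P.1 P.2.1 (P.2.2.2 / P.2.2.1) n).1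
def pC (n : ℕ) (P : Params) : ℂ := (bp P.1 P.2.1 (P.2.2.2 / P.2.2.1) n).2
def QC (n : ℕ) (P : Params) : ℂ := (chainQG P.1 P.2.1 P.2.2.1 P.2.2.2 n).1
def GC (n : ℕ) (P : Params) : ℂ := (chainQG P.1 P.2.1 P.2.2.1 P.2.2.2 n).2.2.2

/-- A limit along this filter restricts to every family of parameters tending to it. Only such
restrictions are used, so the filter need not be shown proper. -/
def nonDegFilter (P₀ : Params) : Filter Params :=
  𝓝 P₀ ⊓ ⨅ k : ℕ, 𝓟 {P | NonDeg P.1 P.2.1 P.2.2.1 P.2.2.2 k}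

theorem tendsto_nonDegFilter {β : Type*} {m : Filter β} {γ : β → Params} {P₀ : Params} :
    Tendsto γ m (nonDegFilter P₀) ↔ Tendsto γ m (𝓝 P₀) ∧
      ∀ k, ∀ᶠ a in m, NonDeg (γ a).1 (γ a).2.1 (γ a).2.2.1 (γ a).2.2.2 k := by
  simp [nonDegFilter, tendsto_inf, tendsto_iInf, tendsto_principal]

theorem eventually_nonDeg (P₀ : Params) (n : ℕ) :
    ∀ᶠ P in nonDegFilter P₀, ∀ k ≤ n, NonDeg P.1 P.2.1 P.2.2.1 P.2.2.2 k := by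
  have h := (tendsto_nonDegFilter (γ := id) (m := nonDegFilter P₀) (P₀ := P₀)).1 tendsto_id
  exact (Set.finite_Iic n).eventually_all.2 fun k _ => h.2 k

theorem chain_nonDegFilter {P₀ : Params} (h0 : P₀.1 ≠ 0) (h1 : P₀.1 ≠ 1) :
    Chain (nonDegFilter P₀) ![fun _ => 0, fun _ => 1, fun P => P.1] ![0, 1, P₀.1] bC pC QC GC where
  c_lim i := by
    have ht : Tendsto (fun P : Params => P.1) (nonDegFilter P₀) (𝓝 P₀.1) :=
      (continuous_fst.tendsto P₀).mono_left inf_le_left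
    fin_cases i
    · exact tendsto_const_nhds
    · exact tendsto_const_nhds
    · exact ht
  c_inj i j hij := by
    fin_cases i <;> fin_cases j <;> simp_all [eq_comm]
  p_ne n := (eventually_nonDeg P₀ n).mono fun P hP => (hP n le_rfl).2.1
  b_ne n i := by
    filter_upwards [eventually_nonDeg P₀ n] with P hP
    obtain ⟨-, -, h3, h4, h5⟩ := hP n le_rfl
    fin_cases i
    · simpa [bC] using h3
    · simpa [bC] using h4
    · simpa [bC] using h5
  Q_ne n := (eventually_nonDeg P₀ n).mono fun P hP => (chainQG_ne_zero hP).1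
  b_succ n := Eventually.of_forall fun P => rfl
  p_succ n := Eventually.of_forall fun P => by
    simp [Fin.sum_univ_three, pC, bC, bp]
  G_succ n := Eventually.of_forall fun P => by
    simp [Fin.prod_univ_three, GC, QC, bC, chainQG]
  Q_eq n := (eventually_nonDeg P₀ n).mono fun P hP => chainQG_eq hP

theorem exists_confined_nonDegFilter {P₀ : Params} (h0 : P₀.1 ≠ 0) (h1 : P₀.1 ≠ 1)
    (hg : P₀.2.2.1 ≠ 0) (n : ℕ) :
    ∃ u v w Γ ρ, Confined (nonDegFilter P₀) bC pC QC GC n u v w Γ ρ := by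
  have hid : Tendsto (fun P : Params => P) (nonDegFilter P₀) (𝓝 P₀) := inf_le_left
  have hx : Tendsto (fun P : Params => P.2.1) (nonDegFilter P₀) (𝓝 P₀.2.1) :=
    (continuous_snd.fst.tendsto P₀).comp hid
  have hgl : Tendsto (fun P : Params => P.2.2.1) (nonDegFilter P₀) (𝓝 P₀.2.2.1) :=
    (continuous_snd.snd.fst.tendsto P₀).comp hid
  have hX : Tendsto (fun P : Params => P.2.2.2) (nonDegFilter P₀) (𝓝 P₀.2.2.2) :=
    (continuous_snd.snd.snd.tendsto P₀).comp hid
  exact (chain_nonDegFilter h0 h1).exists_confined (β := P₀.2.1) (π := P₀.2.2.2 / P₀.2.2.1)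
    ⟨hx, hX.div hgl hg, ⟨1, one_ne_zero, tendsto_const_nhds⟩,
      ⟨1, one_ne_zero, tendsto_const_nhds⟩, ⟨_, hg, hgl⟩⟩ n

/-! ### Values of rational functions -/

/-- `f` takes the value `φ z` at all but finitely many `z`. -/
def EvEq (f : RatFunc ℂ) (φ : ℂ → ℂ) : Prop := ∀ᶠ z in cofinite, ev f z = φ z

theorem eventually_eval_ne_zero {P : Polynomial ℂ} (hP : P ≠ 0) :
    ∀ᶠ z in cofinite, P.eval z ≠ 0 := by
  have : {z | P.eval z = 0} ⊆ P.roots.toFinset := fun z hz => by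
    simpa [hP] using hz
  simpa [Filter.Eventually, mem_cofinite, Set.compl_ofPred] using
    (Finset.finite_toSet _).subset this

theorem eventually_denom_ne_zero (f : RatFunc ℂ) :
    ∀ᶠ z in cofinite, Polynomial.eval₂ (RingHom.id ℂ) z f.denom ≠ 0 :=
  eventually_eval_ne_zero f.denom_ne_zero

namespace EvEq

variable {f g : RatFunc ℂ} {φ ψ : ℂ → ℂ}

theorem const (c : ℂ) : EvEq (RatFunc.C c) fun _ => c :=
  Eventually.of_forall fun z => by simp [ev]

theorem X : EvEq RatFunc.X fun z => z := Eventually.of_forall fun z => by simp [ev]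

theorem one : EvEq 1 fun _ => 1 := Eventually.of_forall fun z => by simp [ev]

theorem natCast (n : ℕ) : EvEq (n : RatFunc ℂ) fun _ => n := by
  simpa using const (n : ℂ)

theorem add (hf : EvEq f φ) (hg : EvEq g ψ) : EvEq (f + g) fun z => φ z + ψ z := by
  filter_upwards [hf, hg, eventually_denom_ne_zero f, eventually_denom_ne_zero g] with z h1 h2 h3 h4
  rw [← h1, ← h2]
  exact RatFunc.eval_add _ _ h3 h4

theorem mul (hf : EvEq f φ) (hg : EvEq g ψ) : EvEq (f * g) fun z => φ z * ψ z := by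
  filter_upwards [hf, hg, eventually_denom_ne_zero f, eventually_denom_ne_zero g] with z h1 h2 h3 h4
  rw [← h1, ← h2]
  exact RatFunc.eval_mul _ _ h3 h4

theorem sub (hf : EvEq f φ) (hg : EvEq g ψ) : EvEq (f - g) fun z => φ z - ψ z := by
  have := hf.add ((const (-1)).mul hg)
  simpa [sub_eq_add_neg] using this

/-- The rule for products applied to f · f⁻¹ = 1; for f = 0 both sides are 0 by convention. -/
theorem inv (hf : EvEq f φ) : EvEq f⁻¹ fun z => (φ z)⁻¹ := by
  by_cases h0 : f = 0
  · subst h0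
    filter_upwards [hf] with z hz
    rw [← hz]
    simp [ev]
  · have h1 : EvEq (f * f⁻¹) _ :=
      mul (φ := φ) (ψ := ev f⁻¹) hf (Eventually.of_forall fun _ => rfl)
    filter_upwards [h1] with z hz
    rw [mul_inv_cancel₀ h0] at hz
    refine eq_inv_of_mul_eq_one_right ?_
    rw [← hz]
    simp [ev]

theorem div (hf : EvEq f φ) (hg : EvEq g ψ) : EvEq (f / g) fun z => φ z / ψ z := by
  simpa only [div_eq_mul_inv] using hf.mul hg.inv

theorem nhdsNE (hf : EvEq f φ) (z₀ : ℂ) : ∀ᶠ z in 𝓝[≠] z₀, φ z = ev f z :=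
  (Filter.Eventually.filter_mono (nhdsNE_le_cofinite z₀) hf).mono fun _ hz => hz.symm

theorem pow (hf : EvEq f φ) (n : ℕ) : EvEq (f ^ n) fun z => φ z ^ n := by
  induction n with
  | zero => simpa using one
  | succ n ih => simpa only [pow_succ] using ih.mul hf

end EvEq

/-- If the denominator vanished at z₀, the finite limit would force the numerator to vanish there as
well, against coprimality. -/
theorem denom_eval_ne_zero_of_tendsto {f : RatFunc ℂ} {z₀ L : ℂ}
    (h : Tendsto (ev f) (𝓝[≠] z₀) (𝓝 L)) : f.denom.eval z₀ ≠ 0 := by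
  intro h0
  have hn : f.num.eval z₀ = 0 := by
    have h1 : Tendsto (fun z => ev f z * f.denom.eval z) (𝓝[≠] z₀) (𝓝 (L * f.denom.eval z₀)) :=
      h.mul ((f.denom.continuous.tendsto z₀).mono_left nhdsWithin_le_nhds)
    have h2 : Tendsto (fun z => f.num.eval z) (𝓝[≠] z₀) (𝓝 (f.num.eval z₀)) :=
      (f.num.continuous.tendsto z₀).mono_left nhdsWithin_le_nhds
    have h3 := tendsto_nhds_unique h2 (h1.congr' ?_)
    · rw [h3, h0, mul_zero]
    · filter_upwards [nhdsNE_le_cofinite z₀ (eventually_denom_ne_zero f)] with z hz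
      have hz : f.denom.eval z ≠ 0 := hz
      change f.num.eval z / f.denom.eval z * f.denom.eval z = _
      field_simp
  obtain ⟨a, b, hab⟩ := RatFunc.isCoprime_num_denom f
  have := congrArg (Polynomial.eval z₀) hab
  simp [hn, h0] at this

/-- A rational function with a finite limit at each point is a polynomial. -/
theorem isPoly_of_tendsto {f : RatFunc ℂ}
    (h : ∀ z₀, ∃ L, Tendsto (ev f) (𝓝[≠] z₀) (𝓝 L)) : IsPoly f := by
  have key : ∀ z, f.denom.eval z ≠ 0 := fun z₀ =>
    denom_eval_ne_zero_of_tendsto (h z₀).choose_spec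
  have hd : f.denom.degree = 0 := by
    by_contra hne
    obtain ⟨z, hz⟩ := IsAlgClosed.exists_root f.denom hne
    exact key z hz
  have hd1 : f.denom = 1 := (RatFunc.monic_denom f).degree_le_zero_iff_eq_one.1 hd.le
  refine ⟨f.num, ?_⟩
  conv_rhs => rw [← RatFunc.num_div_denom f, hd1]
  simp

/-- The value of a rational function at a point where it has a finite limit. -/
theorem ev_eq_of_tendsto {f : RatFunc ℂ} {z₀ L : ℂ}
    (h : Tendsto (ev f) (𝓝[≠] z₀) (𝓝 L)) : ev f z₀ = L := by
  have hd := denom_eval_ne_zero_of_tendsto h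
  have h1 : Tendsto (ev f) (𝓝[≠] z₀) (𝓝 (ev f z₀)) :=
    ((f.num.continuous.tendsto z₀).div (f.denom.continuous.tendsto z₀) hd).mono_left
      nhdsWithin_le_nhds
  exact tendsto_nhds_unique h1 h

/-- The value `0` of a rational function at a pole. -/
theorem ev_eq_zero_of_not_tendsto {f : RatFunc ℂ} {z₀ : ℂ}
    (h : ¬ ∃ L, Tendsto (ev f) (𝓝[≠] z₀) (𝓝 L)) : ev f z₀ = 0 := by
  by_cases hd : f.denom.eval z₀ = 0
  · change f.num.eval z₀ / f.denom.eval z₀ = 0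
    rw [hd, div_zero]
  · exact (h ⟨_, ((f.num.continuous.tendsto z₀).div (f.denom.continuous.tendsto z₀) hd).mono_left
      nhdsWithin_le_nhds⟩).elim

/-! ### The chain over `ℂ(X)` -/

section RatChain

variable (t x g : ℂ)

theorem evEq_bp (n : ℕ) :
    EvEq (bp (RatFunc.C t) (RatFunc.C x) (RatFunc.X / RatFunc.C g) n).1 (fun z => bC n (t, x, g, z)) ∧
    EvEq (bp (RatFunc.C t) (RatFunc.C x) (RatFunc.X / RatFunc.C g) n).2
      (fun z => pC n (t, x, g, z)) := by
  induction n with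
  | zero => exact ⟨EvEq.const x, EvEq.X.div (EvEq.const g)⟩
  | succ n ih =>
    have two : EvEq (2 : RatFunc ℂ) fun _ => 2 := by simpa using EvEq.natCast 2
    have hb : EvEq (bp (RatFunc.C t) (RatFunc.C x) (RatFunc.X / RatFunc.C g) (n + 1)).1
        (fun z => bC (n + 1) (t, x, g, z)) :=
      ih.1.add (((EvEq.natCast n).add (EvEq.one.div two)).div ih.2)
    exact ⟨hb, ih.2.sub ((((EvEq.natCast n).add EvEq.one).div two).mul
      (((EvEq.one.div hb).add (EvEq.one.div (hb.sub EvEq.one))).add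
        (EvEq.one.div (hb.sub (EvEq.const t)))))⟩

theorem evEq_chainQG (n : ℕ) :
    EvEq (chainQG (RatFunc.C t) (RatFunc.C x) (RatFunc.C g) RatFunc.X n).1
      (fun z => QC n (t, x, g, z)) ∧
    EvEq (chainQG (RatFunc.C t) (RatFunc.C x) (RatFunc.C g) RatFunc.X n).2.1
      (fun z => QC (n + 1) (t, x, g, z)) ∧
    EvEq (chainQG (RatFunc.C t) (RatFunc.C x) (RatFunc.C g) RatFunc.X n).2.2.1
      (fun z => QC (n + 2) (t, x, g, z)) ∧
    EvEq (chainQG (RatFunc.C t) (RatFunc.C x) (RatFunc.C g) RatFunc.X n).2.2.2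
      (fun z => GC n (t, x, g, z)) := by
  induction n with
  | zero => exact ⟨EvEq.one, EvEq.one, EvEq.X, EvEq.const g⟩
  | succ n ih =>
    obtain ⟨-, h2, h3, h4⟩ := ih
    obtain ⟨hb, hp⟩ := evEq_bp t x g (n + 1)
    have hG : EvEq (chainQG (RatFunc.C t) (RatFunc.C x) (RatFunc.C g) RatFunc.X (n + 1)).2.2.2
        (fun z => GC (n + 1) (t, x, g, z)) :=
      (((hb.mul (hb.sub EvEq.one)).mul (hb.sub (EvEq.const t))).mul ((h2.mul h3).pow 3)).div h4
    exact ⟨h2, h3, (hp.mul hG).div (h2.mul h3), hG⟩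

variable {t x g}

/-- Behaviour at X = ∞: p_n grows like X/g, so the corrections to b_n die out. This shows that over
ℂ(X) neither p_n nor b_n - c_i is zero. -/
theorem tendsto_cobounded_chain (hg : g ≠ 0) (h0 : x ≠ 0) (h1 : x ≠ 1) (ht : x ≠ t) (n : ℕ) :
    Tendsto (fun z => bC n (t, x, g, z)) (Bornology.cobounded ℂ) (𝓝 x) ∧
    Tendsto (fun z => pC n (t, x, g, z) / z) (Bornology.cobounded ℂ) (𝓝 g⁻¹) := by
  have hinv : Tendsto (fun z : ℂ => z⁻¹) (Bornology.cobounded ℂ) (𝓝 0) := tendsto_inv₀_cobounded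
  have hne : ∀ᶠ z : ℂ in Bornology.cobounded ℂ, z ≠ 0 :=
    Bornology.le_cofinite ℂ (eventually_cofinite_ne 0)
  induction n with
  | zero =>
    refine ⟨tendsto_const_nhds, tendsto_const_nhds.congr' ?_⟩
    filter_upwards [hne] with z hz
    simp only [pC, bp]
    field_simp
  | succ n ih =>
    have hg' : g⁻¹ ≠ 0 := inv_ne_zero hg
    have hb : Tendsto (fun z => bC (n + 1) (t, x, g, z)) (Bornology.cobounded ℂ) (𝓝 x) := by
      have := ih.1.add ((hinv.div ih.2 hg').const_mul ((n : ℂ) + 1 / 2))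
      rw [zero_div, mul_zero, add_zero] at this
      refine this.congr' ?_
      filter_upwards [hne] with z hz
      change _ = bC n (t, x, g, z) + ((n : ℂ) + 1 / 2) / pC n (t, x, g, z)
      simp only [Pi.div_apply]
      rw [div_div_eq_mul_div, inv_mul_cancel₀ hz]
      ring
    refine ⟨hb, ?_⟩
    have hs := ((tendsto_const_nhds (x := (1 : ℂ))).div hb h0).add
      ((tendsto_const_nhds (x := (1 : ℂ))).div (hb.sub_const 1) (sub_ne_zero.2 h1))
    have hs' := hs.add
      ((tendsto_const_nhds (x := (1 : ℂ))).div (hb.sub_const t) (sub_ne_zero.2 ht))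
    have := ih.2.sub (((hs'.const_mul (((n : ℂ) + 1) / 2))).mul hinv)
    rw [mul_zero, sub_zero] at this
    refine this.congr fun z => ?_
    change _ = (pC n (t, x, g, z) - ((n : ℂ) + 1) / 2 * (1 / bC (n + 1) (t, x, g, z) +
      1 / (bC (n + 1) (t, x, g, z) - 1) + 1 / (bC (n + 1) (t, x, g, z) - t))) / z
    simp only [Pi.div_apply]
    ring

theorem nonDeg_ratFunc (hg : g ≠ 0) (h0 : x ≠ 0) (h1 : x ≠ 1) (ht : x ≠ t) (n : ℕ) :
    NonDeg (RatFunc.C t) (RatFunc.C x) (RatFunc.C g) RatFunc.X n := by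
  obtain ⟨hb, hp⟩ := tendsto_cobounded_chain hg h0 h1 ht n
  obtain ⟨eb, ep⟩ := evEq_bp t x g n
  have hle : Bornology.cobounded ℂ ≤ cofinite := Bornology.le_cofinite ℂ
  have hbc : ∀ c, x ≠ c →
      (bp (RatFunc.C t) (RatFunc.C x) (RatFunc.X / RatFunc.C g) n).1 - RatFunc.C c ≠ 0 := by
    intro c hc h
    rw [sub_eq_zero] at h
    rw [h] at eb
    refine hc (tendsto_nhds_unique hb (tendsto_const_nhds.congr' ?_))
    filter_upwards [hle eb] with z hz
    rw [← hz]
    simp [ev]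
  refine ⟨by simpa using hg, fun h => ?_, by simpa using hbc 0 h0, by simpa using hbc 1 h1,
    hbc t ht⟩
  rw [h] at ep
  refine inv_ne_zero hg (tendsto_nhds_unique hp (tendsto_const_nhds.congr' ?_))
  filter_upwards [hle ep] with z hz
  rw [← hz]
  simp [ev]

theorem tendsto_nonDegFilter_X (hg : g ≠ 0) (h0 : x ≠ 0) (h1 : x ≠ 1) (ht : x ≠ t) (z₀ : ℂ) :
    Tendsto (fun z => ((t, x, g, z) : Params)) (𝓝[≠] z₀) (nonDegFilter (t, x, g, z₀)) := by
  refine tendsto_nonDegFilter.2 ⟨?_, fun k => ?_⟩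
  · exact ((by fun_prop : Continuous fun z => ((t, x, g, z) : Params)).tendsto z₀).mono_left
      nhdsWithin_le_nhds
  · obtain ⟨-, h2, h3, h4, h5⟩ := nonDeg_ratFunc (t := t) hg h0 h1 ht k
    obtain ⟨eb, ep⟩ := evEq_bp t x g k
    have ne : ∀ {f : RatFunc ℂ} {φ : ℂ → ℂ}, f ≠ 0 → EvEq f φ → ∀ᶠ z in cofinite, φ z ≠ 0 := by
      intro f φ hf he
      filter_upwards [he, eventually_denom_ne_zero f,
        eventually_eval_ne_zero (RatFunc.num_ne_zero hf)] with z e1 e2 e3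
      rw [← e1]
      exact div_ne_zero e3 e2
    filter_upwards [nhdsNE_le_cofinite z₀ (ne h2 ep), nhdsNE_le_cofinite z₀ (ne h3 eb),
      nhdsNE_le_cofinite z₀ (ne h4 (eb.sub EvEq.one)),
      nhdsNE_le_cofinite z₀ (ne h5 (eb.sub (EvEq.const t)))] with z e1 e2 e3 e4
    exact ⟨hg, e1, e2, e3, e4⟩

end RatChain

/-! ### The sequences `Q_n`, `G_n`, `R_n`, `p_n`, `q_n` and the chain over `ℂ(X)` -/

/-- Since φ = b'D and H is homogeneous of degree 3, H(φ; D) = D³ b'(b'-1)(b'-t), while H'/H produces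
the sum of the 1/(b' - c_i). The relation D = uvw = pΓ does the rest. -/
theorem QGR.next_eq {t u v w Γ b p : RatFunc ℂ} (n : ℕ) (hu : u ≠ 0) (hv : v ≠ 0) (hw : w ≠ 0)
    (hp : p ≠ 0) (hΓ : Γ ≠ 0) (hwe : w = p * Γ / (u * v)) {b' p' : RatFunc ℂ}
    (hb' : b' = b + ((n : RatFunc ℂ) + 1 / 2) / p)
    (hp' : p' = p - ((n : RatFunc ℂ) + 1) / 2 * (1 / b' + 1 / (b' - 1) + 1 / (b' - t)))
    (h0 : b' ≠ 0) (h1 : b' - 1 ≠ 0) (ht : b' - t ≠ 0) (hp0 : p' ≠ 0) :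
    QGR.next t n ⟨u, v, w, Γ, (b + ((n : RatFunc ℂ) + 1) / (2 * p)) * (u * w)⟩ =
      ⟨v, w, p' * (b' * (b' - 1) * (b' - t) * (v * w) ^ 3 / Γ) / (v * w),
        b' * (b' - 1) * (b' - t) * (v * w) ^ 3 / Γ,
        (b' + (((n + 1 : ℕ) : RatFunc ℂ) + 1) / (2 * p')) *
          (v * (p' * (b' * (b' - 1) * (b' - t) * (v * w) ^ 3 / Γ) / (v * w)))⟩ := by
  have hD : u * v * w = p * Γ := by rw [hwe]; field_simp
  have hφ : (b + ((n : RatFunc ℂ) + 1) / (2 * p)) * (u * w) * v + (n : RatFunc ℂ) / 2 * Γ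
      = b' * (u * v * w) := by
    rw [show (b + ((n : RatFunc ℂ) + 1) / (2 * p)) * (u * w) * v
      = (b + ((n : RatFunc ℂ) + 1) / (2 * p)) * (u * v * w) by ring, hD, hb']
    field_simp
    ring
  have hG : HH t (b' * (u * v * w)) (u * v * w) / (Γ * u ^ 3)
      = b' * (b' - 1) * (b' - t) * (v * w) ^ 3 / Γ := by
    rw [HH]
    field_simp
  have hQ : HH t (b' * (u * v * w)) (u * v * w) / (Γ ^ 2 * u ^ 2) - ((n : RatFunc ℂ) + 1) / 2 *
      (HH' t (b' * (u * v * w)) (u * v * w) / (Γ * u ^ 2))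
      = p' * (b' * (b' - 1) * (b' - t) * (v * w) ^ 3 / Γ) / (v * w) := by
    have e1 : HH t (b' * (u * v * w)) (u * v * w) / (Γ ^ 2 * u ^ 2)
        = (b' * (b' - 1) * (b' - t)) * p * (v * w) ^ 2 / Γ := by
      have : HH t (b' * (u * v * w)) (u * v * w)
          = b' * (b' - 1) * (b' - t) * (u * v * w) * (u * v * w) ^ 2 := by rw [HH]; ring
      rw [this]
      nth_rewrite 1 [hD]
      field_simp
    have e2 : HH' t (b' * (u * v * w)) (u * v * w) / (Γ * u ^ 2)
        = (b' * (b' - 1) * (b' - t)) * (1 / b' + 1 / (b' - 1) + 1 / (b' - t)) * (v * w) ^ 2 / Γ := by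
      rw [HH']
      field_simp
      ring
    rw [e1, e2, hp']
    field_simp
  unfold QGR.next
  simp only [hφ, hG, hQ]
  congr 1
  push_cast
  rw [div_eq_iff (mul_ne_zero hu hw)]
  field_simp
  ring

theorem qgr_eq {r s : ℂ} {τ : UpperHalfPlane} {t x g : ℂ} (ht : tt τ = t)
    (hx : (wp (aa r s τ) τ - e₁ τ) / (e₂ τ - e₁ τ) = x)
    (hg : wp' (aa r s τ) τ / (e₂ τ - e₁ τ) = g)
    (hN : ∀ n, NonDeg (RatFunc.C t) (RatFunc.C x) (RatFunc.C g) RatFunc.X n) (n : ℕ) :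
    qgr r s τ n =
      let S := chainQG (RatFunc.C t) (RatFunc.C x) (RatFunc.C g) RatFunc.X n
      let B := bp (RatFunc.C t) (RatFunc.C x) (RatFunc.X / RatFunc.C g) n
      ⟨S.1, S.2.1, S.2.2.1, S.2.2.2,
        (B.1 + ((n : RatFunc ℂ) + 1) / (2 * B.2)) * (S.1 * S.2.2.1)⟩ := by
  induction n with
  | zero =>
    have hg0 : RatFunc.C g ≠ 0 := (hN 0).1
    have hX : (RatFunc.X : RatFunc ℂ) ≠ 0 := RatFunc.X_ne_zero
    simp only [qgr, chainQG, bp, hx, hg, QGR.mk.injEq, true_and, Nat.cast_zero]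
    rw [map_mul, one_div, map_inv₀, map_ofNat]
    field_simp
    ring
  | succ n ih =>
    obtain ⟨h1, h2, h3, h4⟩ := chainQG_ne_zero (n := n) fun k _ => hN k
    obtain ⟨-, h5, -⟩ := hN n
    obtain ⟨-, h6, h7, h8, h9⟩ := hN (n + 1)
    rw [qgr, ih, ht]
    exact QGR.next_eq n h1 h2 h3 h5 h4 (chainQG_eq fun k _ => hN k) rfl rfl h7 h8 h9 h6

theorem pq_eq {r s : ℂ} {τ : UpperHalfPlane} {t x g : ℂ} (ht : tt τ = t)
    (hx : (wp (aa r s τ) τ - e₁ τ) / (e₂ τ - e₁ τ) = x)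
    (hg : wp' (aa r s τ) τ / (e₂ τ - e₁ τ) = g)
    (hN : ∀ n, NonDeg (RatFunc.C t) (RatFunc.C x) (RatFunc.C g) RatFunc.X n) (n : ℕ) :
    pq r s τ n =
      let B := bp (RatFunc.C t) (RatFunc.C x) (RatFunc.X / RatFunc.C g) n
      (B.2, B.1 + ((n : RatFunc ℂ) + 1) / (2 * B.2)) := by
  induction n with
  | zero =>
    have hg0 : RatFunc.C g ≠ 0 := (hN 0).1
    have hX : (RatFunc.X : RatFunc ℂ) ≠ 0 := RatFunc.X_ne_zero
    simp only [pq, Qf, Gf, Rf, qgr, bp, hx, hg, Nat.cast_zero, lt_irrefl, if_false, Int.toNat_zero]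
    congr 1
    rw [map_mul, one_div, map_inv₀, map_ofNat]
    field_simp
    ring
  | succ n ih =>
    obtain ⟨-, h5, -⟩ := hN n
    simp only [pq, ih]
    have hb : (bp (RatFunc.C t) (RatFunc.C x) (RatFunc.X / RatFunc.C g) n).1 +
        ((n : RatFunc ℂ) + 1) / (2 * (bp (RatFunc.C t) (RatFunc.C x) (RatFunc.X / RatFunc.C g) n).2)
        + (n : RatFunc ℂ) / (2 * (bp (RatFunc.C t) (RatFunc.C x) (RatFunc.X / RatFunc.C g) n).2)
        = (bp (RatFunc.C t) (RatFunc.C x) (RatFunc.X / RatFunc.C g) (n + 1)).1 := by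
      rw [bp]
      field_simp
      ring
    rw [hb, ht]
    have hp : (bp (RatFunc.C t) (RatFunc.C x) (RatFunc.X / RatFunc.C g) (n + 1)).2
      = _ - ((n : RatFunc ℂ) + 1) / 2 * (1 / (bp _ _ _ (n + 1)).1 + 1 / ((bp _ _ _ (n + 1)).1 - 1) +
        1 / ((bp _ _ _ (n + 1)).1 - _)) := rfl
    rw [← hp]
    push_cast
    congr 3
    ring

/-- What the chain over `ℂ(X)` says about the values at `z₀`. -/
structure ValuesAt (r s : ℂ) (τ : UpperHalfPlane) (n : ℕ) (z₀ u v w Γ ρ : ℂ) : Prop where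
  ev_Qpp : ev (Qf r s τ ((n : ℤ) - 2)) z₀ = u
  ev_Qp : ev (Qf r s τ ((n : ℤ) - 1)) z₀ = v
  ev_Q : ev (Qf r s τ n) z₀ = w
  ev_G : ev (Gf r s τ n) z₀ = Γ
  ev_R : ev (Rf r s τ n) z₀ = ρ
  ev_q : ev (qf r s τ n) z₀ = ρ / (u * w)
  ev_p : ev (pf r s τ n) z₀ = u * v * w / Γ

section

variable {r s : ℂ} {τ : UpperHalfPlane} {t x g : ℂ} (htt : tt τ = t)
  (hxx : (wp (aa r s τ) τ - e₁ τ) / (e₂ τ - e₁ τ) = x)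
  (hgg : wp' (aa r s τ) τ / (e₂ τ - e₁ τ) = g)
  (hg : g ≠ 0) (h0 : x ≠ 0) (h1 : x ≠ 1) (ht : x ≠ t)
include htt hxx hgg hg h0 h1 ht

theorem tendsto_ev_qgr (n : ℕ) {z₀ u v w Γ ρ : ℂ}
    (hC : Confined (nonDegFilter (t, x, g, z₀)) bC pC QC GC n u v w Γ ρ) :
    Tendsto (ev (Qf r s τ ((n : ℤ) - 2))) (𝓝[≠] z₀) (𝓝 u) ∧
    Tendsto (ev (Qf r s τ ((n : ℤ) - 1))) (𝓝[≠] z₀) (𝓝 v) ∧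
    Tendsto (ev (Qf r s τ n)) (𝓝[≠] z₀) (𝓝 w) ∧
    Tendsto (ev (Gf r s τ n)) (𝓝[≠] z₀) (𝓝 Γ) ∧
    Tendsto (ev (Rf r s τ n)) (𝓝[≠] z₀) (𝓝 ρ) := by
  have hN := nonDeg_ratFunc (t := t) hg h0 h1 ht
  have hγ := tendsto_nonDegFilter_X (t := t) hg h0 h1 ht z₀
  obtain ⟨e1, e2, e3, e4⟩ := evEq_chainQG t x g n
  obtain ⟨e5, e6⟩ := evEq_bp t x g n
  have hq := qgr_eq htt hxx hgg hN n
  have two : EvEq (2 : RatFunc ℂ) fun _ => 2 := by simpa using EvEq.natCast 2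
  have e7 := (e5.add (((EvEq.natCast n).add EvEq.one).div (two.mul e6))).mul (e1.mul e3)
  rw [← qgr_Qpp, ← qgr_Qp, ← qgr_Q, Gf, Rf, hq]
  refine ⟨(hC.u_lim.comp hγ).congr' ?_, (hC.v_lim.comp hγ).congr' ?_, (hC.w_lim.comp hγ).congr' ?_,
    (hC.Γ_lim.comp hγ).congr' ?_, (hC.ρ_lim.comp hγ).congr' ?_⟩
  · exact e1.nhdsNE z₀
  · exact e2.nhdsNE z₀
  · exact e3.nhdsNE z₀
  · exact e4.nhdsNE z₀
  · exact e7.nhdsNE z₀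

theorem isPoly_qgr (ht0 : t ≠ 0) (ht1 : t ≠ 1) (n : ℕ) :
    IsPoly (Qf r s τ n) ∧ IsPoly (Gf r s τ n) ∧ IsPoly (Rf r s τ n) := by
  have key := fun z₀ => exists_confined_nonDegFilter (P₀ := (t, x, g, z₀)) ht0 ht1 hg n
  refine ⟨isPoly_of_tendsto fun z₀ => ?_, isPoly_of_tendsto fun z₀ => ?_,
    isPoly_of_tendsto fun z₀ => ?_⟩ <;> obtain ⟨u, v, w, Γ, ρ, hC⟩ := key z₀
  · exact ⟨w, (tendsto_ev_qgr htt hxx hgg hg h0 h1 ht n hC).2.2.1⟩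
  · exact ⟨Γ, (tendsto_ev_qgr htt hxx hgg hg h0 h1 ht n hC).2.2.2.1⟩
  · exact ⟨ρ, (tendsto_ev_qgr htt hxx hgg hg h0 h1 ht n hC).2.2.2.2⟩

theorem valuesAt (n : ℕ) {z₀ u v w Γ ρ : ℂ}
    (hC : Confined (nonDegFilter (t, x, g, z₀)) bC pC QC GC n u v w Γ ρ) :
    ValuesAt r s τ n z₀ u v w Γ ρ := by
  have hN := nonDeg_ratFunc (t := t) hg h0 h1 ht
  obtain ⟨l1, l2, l3, l4, l5⟩ := tendsto_ev_qgr htt hxx hgg hg h0 h1 ht n hC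
  obtain ⟨n1, n2, n3, n4⟩ := chainQG_ne_zero (n := n) fun k _ => hN k
  have hq := qgr_eq htt hxx hgg hN n
  have hpq := pq_eq htt hxx hgg hN n
  have hwe := chainQG_eq (n := n) fun k _ => hN k
  have eself : ∀ f, EvEq f (ev f) := fun f => Eventually.of_forall fun _ => rfl
  have qR : Rf r s τ n = qf r s τ n * (Qf r s τ ((n : ℤ) - 2) * Qf r s τ n) := by
    rw [← qgr_Qpp, ← qgr_Q, Rf, qf, hq, hpq]
  have pG : Qf r s τ ((n : ℤ) - 2) * Qf r s τ ((n : ℤ) - 1) * Qf r s τ n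
      = pf r s τ n * Gf r s τ n := by
    rw [← qgr_Qpp, ← qgr_Q, ← qgr_Qp, Gf, pf, hq, hpq]
    simp only
    rw [hwe]
    field_simp
  have nQ : Qf r s τ ((n : ℤ) - 2) * Qf r s τ n ≠ 0 := by
    rw [← qgr_Qpp, ← qgr_Q, hq]
    exact mul_ne_zero n1 n3
  have nG : Gf r s τ n ≠ 0 := by
    rw [Gf, hq]
    exact n4
  have eqq : qf r s τ n = Rf r s τ n / (Qf r s τ ((n : ℤ) - 2) * Qf r s τ n) := by
    rw [qR, mul_div_cancel_right₀ _ nQ]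
  have epp : pf r s τ n = Qf r s τ ((n : ℤ) - 2) * Qf r s τ ((n : ℤ) - 1) * Qf r s τ n /
      Gf r s τ n := by
    rw [pG, mul_div_cancel_right₀ _ nG]
  refine ⟨ev_eq_of_tendsto l1, ev_eq_of_tendsto l2, ev_eq_of_tendsto l3, ev_eq_of_tendsto l4,
    ev_eq_of_tendsto l5, ?_, ?_⟩
  -- At a zero of uw the quotient is 0 by convention, and so is the value of q_n, provided that q_n
  -- really has a pole. This holds because ρ ≠ 0 there.
  · by_cases huw : u * w = 0
    · rw [huw, div_zero]
      refine ev_eq_zero_of_not_tendsto ?_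
      rintro ⟨L, hL⟩
      have h := ((eself (qf r s τ n)).mul
        ((eself (Qf r s τ ((n : ℤ) - 2))).mul (eself (Qf r s τ n)))).nhdsNE z₀
      rw [← qR] at h
      have h2 := hL.mul (l1.mul l3)
      rw [huw, mul_zero] at h2
      exact hC.of_uw huw (tendsto_nhds_unique l5 (h2.congr' h))
    · refine ev_eq_of_tendsto ((l5.div (l1.mul l3) huw).congr' ?_)
      have h := ((eself (Rf r s τ n)).div
        ((eself (Qf r s τ ((n : ℤ) - 2))).mul (eself (Qf r s τ n)))).nhdsNE z₀
      rw [← eqq] at h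
      exact h
  -- Likewise p_n has a genuine pole where Γ = 0, since uvw ≠ 0 there.
  · by_cases hΓ : Γ = 0
    · rw [hΓ, div_zero]
      refine ev_eq_zero_of_not_tendsto ?_
      rintro ⟨L, hL⟩
      have h := ((eself (pf r s τ n)).mul (eself (Gf r s τ n))).nhdsNE z₀
      have h' := (((eself (Qf r s τ ((n : ℤ) - 2))).mul
        (eself (Qf r s τ ((n : ℤ) - 1)))).mul (eself (Qf r s τ n))).nhdsNE z₀
      rw [← pG] at h
      have h2 := hL.mul l4
      rw [hΓ, mul_zero] at h2
      refine hC.of_Γ hΓ (tendsto_nhds_unique ((l1.mul l2).mul l3) (h2.congr' ?_))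
      filter_upwards [h, h'] with z e1 e2
      rw [e1, e2]
    · refine ev_eq_of_tendsto ((((l1.mul l2).mul l3).div l4 hΓ).congr' ?_)
      have h := ((((eself (Qf r s τ ((n : ℤ) - 2))).mul (eself (Qf r s τ ((n : ℤ) - 1)))).mul
        (eself (Qf r s τ n))).div (eself (Gf r s τ n))).nhdsNE z₀
      rw [← epp] at h
      exact h

end

/-! ### The Hamiltonian system along a curve -/

/-- The Hamiltonian system of Painlevé VI with `θ₁ = θ₂ = θ₃ = -ν/2` and
`θ₀(θ₀+θ₄) = (ν+1)(2ν+1)/4`, at the point `w` of a curve with `dt = m t(t-1) dw`. -/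
def Ham (m t b p : ℂ → ℂ) (ν w : ℂ) : Prop :=
  HasDerivAt b (m w * (2 * (b w * (b w - 1) * (b w - t w)) * p w
    + ν / 2 * (3 * b w ^ 2 - 2 * (1 + t w) * b w + t w) + b w * (b w - 1))) w ∧
  HasDerivAt p (m w * (-(3 * b w ^ 2 - 2 * (1 + t w) * b w + t w) * p w ^ 2
    - (ν / 2 * (6 * b w - 2 - 2 * t w) + 2 * b w - 1) * p w - (ν + 1) * (2 * ν + 1) / 4)) w

variable {m t : ℂ → ℂ}

/-- Shifting b by a function of p is canonical, and so is shifting p by a function of b and t. These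
two shifts take the parameter ν to -(ν+1), and then to ν+1. -/
theorem Ham.b_step {b p : ℂ → ℂ} {ν w : ℂ} (h : Ham m t b p ν w) (hp : p w ≠ 0) :
    Ham m t (fun w => b w + (ν + 1 / 2) / p w) p (-(ν + 1)) w := by
  obtain ⟨h1, h2⟩ := h
  refine ⟨(h1.add ((hasDerivAt_const w (ν + 1 / 2)).div h2 hp)).congr_deriv ?_,
    h2.congr_deriv ?_⟩
  · field_simp
    ring
  · field_simp
    ring

theorem Ham.p_step {b p : ℂ → ℂ} {ν w : ℂ} (ht : HasDerivAt t (m w * (t w * (t w - 1))) w)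
    (h : Ham m t b p (-(ν + 1)) w) (h0 : b w ≠ 0) (h1 : b w - 1 ≠ 0) (h2 : b w - t w ≠ 0) :
    Ham m t b (fun w => p w - (ν + 1) / 2 * (1 / b w + 1 / (b w - 1) + 1 / (b w - t w)))
      (ν + 1) w := by
  obtain ⟨hb, hp⟩ := h
  have hs := (((hasDerivAt_const w (1 : ℂ)).div hb h0).add
    ((hasDerivAt_const w (1 : ℂ)).div (hb.sub_const 1) h1)).add
    ((hasDerivAt_const w (1 : ℂ)).div (hb.sub ht) h2)
  refine ⟨hb.congr_deriv ?_, (hp.sub (hs.const_mul ((ν + 1) / 2))).congr_deriv ?_⟩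
  · field_simp
    ring
  · simp only [Pi.sub_apply]
    field_simp
    ring

/-- A meromorphic function that is not locally constant has no accumulating zeros. -/
theorem eventually_ne_zero_of_deriv {f : ℂ → ℂ} {w₀ : ℂ} (hf : MeromorphicAt f w₀)
    (h : ∀ᶠ w in 𝓝[≠] w₀, f w = 0 → ∃ d, d ≠ 0 ∧ HasDerivAt f d w) :
    ∀ᶠ w in 𝓝[≠] w₀, f w ≠ 0 := by
  refine hf.eventually_eq_zero_or_eventually_ne_zero.resolve_left fun h0 => ?_
  obtain ⟨w, hw, hw'⟩ := ((eventually_nhdsNE_eventually_nhds_iff.2 h0).and h).exists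
  obtain ⟨d, hd, hd'⟩ := hw' hw.self_of_nhds
  exact hd (hd'.unique ((hasDerivAt_const w (0 : ℂ)).congr_of_eventuallyEq hw))

/-- A curve in the space of parameters `(t, x, y)` along which `(x, y)` satisfies the Hamiltonian
system with `ν = 0`. -/
structure HamCurve (m t x y : ℂ → ℂ) (w₀ : ℂ) : Prop where
  t_mer : MeromorphicAt t w₀
  x_mer : MeromorphicAt x w₀
  y_mer : MeromorphicAt y w₀
  m_ne : ∀ᶠ w in 𝓝[≠] w₀, m w ≠ 0
  t_ne : ∀ᶠ w in 𝓝[≠] w₀, t w ≠ 0 ∧ t w - 1 ≠ 0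
  x_ne : ∀ᶠ w in 𝓝[≠] w₀, x w ≠ 0 ∧ x w - 1 ≠ 0 ∧ x w - t w ≠ 0
  t_deriv : ∀ᶠ w in 𝓝[≠] w₀, HasDerivAt t (m w * (t w * (t w - 1))) w
  ham : ∀ᶠ w in 𝓝[≠] w₀, Ham m t x y 0 w

namespace HamCurve

variable {x y : ℂ → ℂ} {w₀ : ℂ}

/-- Nondegeneracy is forced by the system. Where p_n = 0 its derivative is -m(n+1)(2n+1)/4, and
where b_{n+1} = c_i the derivative of b_{n+1} - c_i is a nonzero multiple of n+1. So none of these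
meromorphic functions vanishes identically, and their zeros are isolated. -/
theorem chain (h : HamCurve m t x y w₀) (n : ℕ) :
    (MeromorphicAt (fun w => (bp (t w) (x w) (y w) n).1) w₀ ∧
      MeromorphicAt (fun w => (bp (t w) (x w) (y w) n).2) w₀) ∧
    ∀ᶠ w in 𝓝[≠] w₀, (bp (t w) (x w) (y w) n).2 ≠ 0 ∧ (bp (t w) (x w) (y w) n).1 ≠ 0 ∧
      (bp (t w) (x w) (y w) n).1 - 1 ≠ 0 ∧ (bp (t w) (x w) (y w) n).1 - t w ≠ 0 ∧
      Ham m t (fun w => (bp (t w) (x w) (y w) n).1) (fun w => (bp (t w) (x w) (y w) n).2) n w := by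
  have p_ne : ∀ (n : ℕ), MeromorphicAt (fun w => (bp (t w) (x w) (y w) n).2) w₀ →
      (∀ᶠ w in 𝓝[≠] w₀, Ham m t (fun w => (bp (t w) (x w) (y w) n).1)
        (fun w => (bp (t w) (x w) (y w) n).2) n w) →
      ∀ᶠ w in 𝓝[≠] w₀, (bp (t w) (x w) (y w) n).2 ≠ 0 := by
    intro n hm hh
    refine eventually_ne_zero_of_deriv hm ?_
    filter_upwards [hh, h.m_ne] with w h1 h2 h0
    refine ⟨_, ?_, h1.2⟩
    have n1 : (n : ℂ) + 1 ≠ 0 := by simpa using natCast_add_ne_zero n 1 one_ne_zero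
    have n2 : 2 * (n : ℂ) + 1 ≠ 0 := by simpa using two_mul_natCast_add_ne_zero n 1 one_ne_zero
    simp [h0, h2, n1, n2]
  induction n with
  | zero =>
    have hh : ∀ᶠ w in 𝓝[≠] w₀, Ham m t (fun w => (bp (t w) (x w) (y w) 0).1)
        (fun w => (bp (t w) (x w) (y w) 0).2) ((0 : ℕ) : ℂ) w := by
      simpa [bp] using h.ham
    refine ⟨⟨h.x_mer, h.y_mer⟩, ?_⟩
    filter_upwards [p_ne 0 h.y_mer hh, h.x_ne, hh] with w h1 h2 h3
    exact ⟨h1, h2.1, h2.2.1, h2.2.2, h3⟩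
  | succ n ih =>
    obtain ⟨⟨mb, mp⟩, ih⟩ := ih
    have n1 : (n : ℂ) + 1 ≠ 0 := by simpa using natCast_add_ne_zero n 1 one_ne_zero
    have mb' : MeromorphicAt (fun w => (bp (t w) (x w) (y w) (n + 1)).1) w₀ :=
      mb.add ((MeromorphicAt.const _ w₀).div mp)
    have mp' : MeromorphicAt (fun w => (bp (t w) (x w) (y w) (n + 1)).2) w₀ :=
      mp.sub ((MeromorphicAt.const _ w₀).mul ((((MeromorphicAt.const _ w₀).div mb').add
        ((MeromorphicAt.const _ w₀).div (mb'.sub (MeromorphicAt.const _ w₀)))).add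
        ((MeromorphicAt.const _ w₀).div (mb'.sub h.t_mer))))
    have hh : ∀ᶠ w in 𝓝[≠] w₀, Ham m t (fun w => (bp (t w) (x w) (y w) (n + 1)).1)
        (fun w => (bp (t w) (x w) (y w) n).2) (-((n : ℂ) + 1)) w := by
      filter_upwards [ih] with w hw
      exact hw.2.2.2.2.b_step hw.1
    have b0 : ∀ᶠ w in 𝓝[≠] w₀, (bp (t w) (x w) (y w) (n + 1)).1 ≠ 0 := by
      refine eventually_ne_zero_of_deriv mb' ?_
      filter_upwards [hh, h.m_ne, h.t_ne] with w h1 h2 h3 h0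
      refine ⟨_, ?_, h1.1⟩
      have : -1 + -(n : ℂ) ≠ 0 := fun e => n1 (by linear_combination -e)
      simp [h0, h2, h3.1, this]
    have b1 : ∀ᶠ w in 𝓝[≠] w₀, (bp (t w) (x w) (y w) (n + 1)).1 - 1 ≠ 0 := by
      refine eventually_ne_zero_of_deriv (mb'.sub (MeromorphicAt.const 1 w₀)) ?_
      filter_upwards [hh, h.m_ne, h.t_ne] with w h1 h2 h3 h0
      refine ⟨_, ?_, h1.1.sub_const 1⟩
      have h0' : (bp (t w) (x w) (y w) (n + 1)).1 = 1 := sub_eq_zero.1 h0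
      simp only [h0']
      rw [show m w * (2 * (1 * (1 - 1) * (1 - t w)) * (bp (t w) (x w) (y w) n).2 +
        -((n : ℂ) + 1) / 2 * (3 * 1 ^ 2 - 2 * (1 + t w) * 1 + t w) + 1 * (1 - 1))
        = m w * ((n + 1) / 2 * (t w - 1)) by ring]
      exact mul_ne_zero h2 (mul_ne_zero (div_ne_zero n1 two_ne_zero) h3.2)
    have bt : ∀ᶠ w in 𝓝[≠] w₀, (bp (t w) (x w) (y w) (n + 1)).1 - t w ≠ 0 := by
      refine eventually_ne_zero_of_deriv (mb'.sub h.t_mer) ?_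
      filter_upwards [hh, h.m_ne, h.t_ne, h.t_deriv] with w h1 h2 h3 h4 h0
      refine ⟨_, ?_, h1.1.sub h4⟩
      have h0' : (bp (t w) (x w) (y w) (n + 1)).1 = t w := sub_eq_zero.1 h0
      simp only [h0']
      rw [show m w * (2 * (t w * (t w - 1) * (t w - t w)) * (bp (t w) (x w) (y w) n).2 +
        -((n : ℂ) + 1) / 2 * (3 * t w ^ 2 - 2 * (1 + t w) * t w + t w) + t w * (t w - 1))
        - m w * (t w * (t w - 1))
        = m w * (-((n + 1) / 2) * (t w * (t w - 1))) by ring]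
      exact mul_ne_zero h2 (mul_ne_zero (neg_ne_zero.2 (div_ne_zero n1 two_ne_zero))
        (mul_ne_zero h3.1 h3.2))
    have hh' : ∀ᶠ w in 𝓝[≠] w₀, Ham m t (fun w => (bp (t w) (x w) (y w) (n + 1)).1)
        (fun w => (bp (t w) (x w) (y w) (n + 1)).2) ((n + 1 : ℕ) : ℂ) w := by
      filter_upwards [hh, h.t_deriv, b0, b1, bt] with w h1 h2 h3 h4 h5
      push_cast
      exact h1.p_step h2 h3 h4 h5
    refine ⟨⟨mb', mp'⟩, ?_⟩
    filter_upwards [b0, b1, bt, hh', p_ne (n + 1) mp' hh'] with w h1 h2 h3 h4 h5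
    exact ⟨h5, h1, h2, h3, h4⟩

/-- The rate at which `p_n` vanishes. -/
theorem tendsto_div_p (h : HamCurve m t x y w₀) {n : ℕ} {β : ℂ}
    (hm : ContinuousAt m w₀) (hm0 : m w₀ ≠ 0)
    (ht : HasDerivAt t (m w₀ * (t w₀ * (t w₀ - 1))) w₀)
    (hb : Tendsto (fun w => (bp (t w) (x w) (y w) n).1) (𝓝[≠] w₀) (𝓝 β))
    (hp : Tendsto (fun w => (bp (t w) (x w) (y w) n).2) (𝓝[≠] w₀) (𝓝 0)) :
    Tendsto (fun w => (t w - t w₀) / (bp (t w) (x w) (y w) n).2) (𝓝[≠] w₀)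
      (𝓝 (-(4 * (t w₀ * (t w₀ - 1)) / (((n : ℂ) + 1) * (2 * n + 1))))) := by
  obtain ⟨⟨-, mp⟩, hch⟩ := h.chain n
  have n1 : (n : ℂ) + 1 ≠ 0 := by simpa using natCast_add_ne_zero n 1 one_ne_zero
  have n2 : 2 * (n : ℂ) + 1 ≠ 0 := by simpa using two_mul_natCast_add_ne_zero n 1 one_ne_zero
  set p : ℂ → ℂ := fun w => (bp (t w) (x w) (y w) n).2 with hpdef
  -- The pointwise value of p_n at w₀ may be a default one. Replacing it by the limit 0 makes the
  -- function analytic.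
  set f : ℂ → ℂ := Function.update p w₀ 0 with hf
  have hfp : ∀ w, w ≠ w₀ → f w = p w := fun w hw => Function.update_of_ne hw _ _
  have hfp' : ∀ᶠ w in 𝓝[≠] w₀, f w = p w := by
    filter_upwards [self_mem_nhdsWithin] with w hw using hfp w hw
  have hf0 : f w₀ = 0 := Function.update_self _ _ _
  have hfan : AnalyticAt ℂ f w₀ := by
    refine MeromorphicAt.analyticAt (mp.congr (hfp'.mono fun w hw => hw.symm)) ?_
    exact continuousAt_update_same.2 hp
  have ht' : Tendsto t (𝓝[≠] w₀) (𝓝 (t w₀)) := ht.continuousAt.tendsto.mono_left nhdsWithin_le_nhds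
  have hm' : Tendsto m (𝓝[≠] w₀) (𝓝 (m w₀)) := hm.tendsto.mono_left nhdsWithin_le_nhds
  -- The derivative at w₀ is the limit of the derivatives nearby. In the equation for p_n only the
  -- constant term survives as p_n → 0.
  have hderiv : deriv f w₀ = m w₀ * (-(((n : ℂ) + 1) * (2 * n + 1) / 4)) := by
    have l1 : Tendsto (deriv f) (𝓝[≠] w₀) (𝓝 (deriv f w₀)) :=
      hfan.deriv.continuousAt.tendsto.mono_left nhdsWithin_le_nhds
    have l2 := hm'.mul ((((((hb.pow 2).const_mul 3).sub
      ((ht'.const_add 1).const_mul 2 |>.mul hb)).add ht').neg.mul (hp.pow 2)).sub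
      ((((((hb.const_mul 6).sub_const 2).sub (ht'.const_mul 2)).const_mul ((n : ℂ) / 2)).add
        (hb.const_mul 2)).sub_const 1 |>.mul hp) |>.sub_const (((n : ℂ) + 1) * (2 * n + 1) / 4))
    have l3 := tendsto_nhds_unique l1 (l2.congr' ?_)
    · rw [l3]
      ring
    · filter_upwards [hch, self_mem_nhdsWithin] with w hw hw0
      have e : f =ᶠ[𝓝 w] p := by
        filter_upwards [isOpen_ne.mem_nhds hw0] with v hv using hfp v hv
      rw [e.deriv_eq, hw.2.2.2.2.2.deriv]
  have hd : HasDerivAt f (m w₀ * (-(((n : ℂ) + 1) * (2 * n + 1) / 4))) w₀ :=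
    hderiv ▸ hfan.differentiableAt.hasDerivAt
  have s1 := hasDerivAt_iff_tendsto_slope.1 ht
  have s2 := hasDerivAt_iff_tendsto_slope.1 hd
  have hne : m w₀ * (-(((n : ℂ) + 1) * (2 * n + 1) / 4)) ≠ 0 :=
    mul_ne_zero hm0 (neg_ne_zero.2 (div_ne_zero (mul_ne_zero n1 n2) (by norm_num)))
  have s3 := s1.div s2 hne
  rw [show m w₀ * (t w₀ * (t w₀ - 1)) / (m w₀ * (-(((n : ℂ) + 1) * (2 * n + 1) / 4)))
    = -(4 * (t w₀ * (t w₀ - 1)) / (((n : ℂ) + 1) * (2 * n + 1))) by field_simp] at s3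
  refine s3.congr' ?_
  filter_upwards [hfp', self_mem_nhdsWithin] with w h1 h2
  have h3 : w - w₀ ≠ 0 := sub_ne_zero.2 h2
  simp only [Pi.div_apply, slope_def_field, hf0, h1, sub_zero]
  rw [div_div_div_cancel_right₀ h3]

end HamCurve

/-! ### Differentiation of lattice sums -/

/-- Weierstrass' theorem on normally convergent series. The finitely many terms in `S` lie outside
the uniform estimate and are bounded near w₀ by continuity. -/
theorem hasDerivAt_tsum_of_eventually {ι : Type*} {F : ι → ℂ → ℂ} {F' : ι → ℂ} {w₀ : ℂ}
    {u : ι → ℝ} (hu : Summable u) (S : Finset ι) (h1 : ∀ k, ∀ᶠ w in 𝓝 w₀, DifferentiableAt ℂ (F k) w)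
    (h2 : ∀ᶠ w in 𝓝 w₀, ∀ k ∉ S, DifferentiableAt ℂ (F k) w ∧ ‖F k w‖ ≤ u k)
    (h3 : ∀ k, HasDerivAt (F k) (F' k) w₀) :
    Summable F' ∧ HasDerivAt (fun w => ∑' k, F k w) (∑' k, F' k) w₀ := by
  classical
  have h4 : ∀ᶠ w in 𝓝 w₀, ∀ k ∈ S, DifferentiableAt ℂ (F k) w ∧ ‖F k w‖ ≤ ‖F k w₀‖ + 1 := by
    refine (Finset.eventually_all S).2 fun k _ => (h1 k).and ?_
    exact ((h3 k).continuousAt.norm.eventually_lt continuousAt_const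
      (lt_add_one ‖F k w₀‖)).mono fun w hw => hw.le
  obtain ⟨ε, hε, hball⟩ := Metric.eventually_nhds_iff_ball.1 (h2.and h4)
  set v : ι → ℝ := fun k => if k ∈ S then ‖F k w₀‖ + 1 else u k with hv
  have hvs : Summable v := by
    refine (summable_congr_cofinite ?_).2 hu
    filter_upwards [S.finite_toSet.compl_mem_cofinite] with k hk
    exact if_neg hk
  have hd : ∀ k, DifferentiableOn ℂ (F k) (Metric.ball w₀ ε) := fun k w hw => by
    by_cases hk : k ∈ S
    · exact ((hball w hw).2 k hk).1.differentiableWithinAt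
    · exact ((hball w hw).1 k hk).1.differentiableWithinAt
  have hle : ∀ k, ∀ w ∈ Metric.ball w₀ ε, ‖F k w‖ ≤ v k := fun k w hw => by
    by_cases hk : k ∈ S
    · simpa [hv, hk] using ((hball w hw).2 k hk).2
    · simpa [hv, hk] using ((hball w hw).1 k hk).2
  have hw₀ : w₀ ∈ Metric.ball w₀ ε := Metric.mem_ball_self hε
  have hs := Complex.hasSum_deriv_of_summable_norm hvs hd Metric.isOpen_ball hle hw₀
  have hdf := (Complex.differentiableOn_tsum_of_summable_norm hvs hd Metric.isOpen_ball
    hle).differentiableAt (Metric.isOpen_ball.mem_nhds hw₀)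
  have he : (fun k => deriv (F k) w₀) = F' := funext fun k => (h3 k).deriv
  rw [he] at hs
  refine ⟨hs.summable, ?_⟩
  rw [hs.tsum_eq]
  exact hdf.hasDerivAt

/-- The lattice point `k₀ τ + k₁`. -/
def om (k : Fin 2 → ℤ) (τ : ℂ) : ℂ := k 0 * τ + k 1

theorem om_zero (τ : ℂ) : om 0 τ = 0 := by simp [om]

theorem om_neg (k : Fin 2 → ℤ) (τ : ℂ) : om (-k) τ = -om k τ := by simp [om]; ring

theorem om_ne_zero {k : Fin 2 → ℤ} (hk : k ≠ 0) {τ : ℂ} (hτ : 0 < τ.im) : om k τ ≠ 0 := by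
  intro h
  have := EisensteinSeries.r_mul_max_le ⟨τ, hτ⟩ hk
  change _ ≤ ‖om k τ‖ at this
  rw [h, norm_zero] at this
  exact absurd this (not_le.2 (mul_pos (EisensteinSeries.r_pos _) (norm_pos_iff.2 hk)))

theorem summable_norm_inv_cube : Summable fun k : Fin 2 → ℤ => (‖k‖ ^ 3)⁻¹ := by
  refine (EisensteinSeries.summable_one_div_norm_rpow (k := 3) (by norm_num)).congr fun k => ?_
  rw [Real.rpow_neg (norm_nonneg _)]
  norm_cast

/-- Uniform lower bounds for all but finitely many lattice points, near a point of a curve. -/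
theorem exists_om_bound {a σ : ℂ → ℂ} {w₀ : ℂ} (ha : ContinuousAt a w₀) (hσ : ContinuousAt σ w₀)
    (hτ : 0 < (σ w₀).im) :
    ∃ R > 0, ∃ c > 0, ∃ S : Finset (Fin 2 → ℤ), ∀ᶠ w in 𝓝 w₀, 0 < (σ w).im ∧ ‖a w‖ < R ∧
      ∀ k ∉ S, 2 * R ≤ ‖om k (σ w)‖ ∧ c * ‖k‖ ≤ ‖om k (σ w)‖ ∧ 0 < ‖k‖ := by
  set A : ℝ := |(σ w₀).re| + 1
  set B : ℝ := (σ w₀).im / 2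
  have hB : 0 < B := half_pos hτ
  set c := EisensteinSeries.r ⟨⟨A, B⟩, hB⟩
  have hc : 0 < c := EisensteinSeries.r_pos _
  set R := ‖a w₀‖ + 1 with hR
  have hR0 : 0 < R := by positivity
  -- With this N, any index of norm greater than N gives a lattice point of norm at least cN = 2R.
  set N := 2 * R / c
  have hfin : {k : Fin 2 → ℤ | ‖k‖ ≤ N}.Finite := by
    have : {k : Fin 2 → ℤ | ‖k‖ ≤ N} = Metric.closedBall 0 N := by
      ext k
      simp
    rw [this]
    exact (isCompact_closedBall (0 : Fin 2 → ℤ) N).finite_of_discrete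
  refine ⟨R, hR0, c, hc, hfin.toFinset, ?_⟩
  have e1 : ∀ᶠ w in 𝓝 w₀, B < (σ w).im :=
    (Complex.continuous_im.continuousAt.comp hσ).eventually (lt_mem_nhds (half_lt_self hτ))
  have e2 : ∀ᶠ w in 𝓝 w₀, |(σ w).re| < A :=
    ((Complex.continuous_re.continuousAt.comp hσ).abs).eventually (gt_mem_nhds (lt_add_one _))
  have e3 : ∀ᶠ w in 𝓝 w₀, ‖a w‖ < R := ha.norm.eventually (gt_mem_nhds (lt_add_one _))
  filter_upwards [e1, e2, e3] with w h1 h2 h3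
  have him : 0 < (σ w).im := hB.trans h1
  refine ⟨him, h3, fun k hk => ?_⟩
  have hk : N < ‖k‖ := by simpa using hk
  have hN : 0 < N := by positivity
  have hk0 : k ≠ 0 := norm_pos_iff.1 (hN.trans hk)
  have hle : c * ‖k‖ ≤ ‖om k (σ w)‖ := by
    have h5 := EisensteinSeries.r_mul_max_le ⟨σ w, him⟩ hk0
    have h6 : c ≤ EisensteinSeries.r ⟨σ w, him⟩ :=
      EisensteinSeries.r_lower_bound_on_verticalStrip _ hB ⟨h2.le, h1.le⟩
    exact (mul_le_mul_of_nonneg_right h6 (norm_nonneg k)).trans h5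
  refine ⟨?_, hle, hN.trans hk⟩
  have : 2 * R = c * N := by
    simp only [N]
    field_simp
  rw [this]
  exact (mul_le_mul_of_nonneg_left hk.le hc.le).trans hle

/-! ### Estimates for single terms of the lattice sums. -/

section Bounds

variable {z l : ℂ} {R : ℝ}

theorem half_norm_le_norm_sub (hz : ‖z‖ < R) (hl : 2 * R ≤ ‖l‖) : ‖l‖ / 2 ≤ ‖z - l‖ := by
  rw [norm_sub_rev]
  have := norm_sub_norm_le l z
  linarith

theorem norm_zeta_term_le (hR : 0 < R) (hz : ‖z‖ < R) (hl : 2 * R ≤ ‖l‖) :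
    ‖1 / (z - l) + 1 / l + z / l ^ 2‖ ≤ 2 * R ^ 2 / ‖l‖ ^ 3 := by
  have h1 := half_norm_le_norm_sub hz hl
  have hl0 : 0 < ‖l‖ := by linarith
  have hl' : l ≠ 0 := norm_pos_iff.1 hl0
  have hzl : z - l ≠ 0 := norm_pos_iff.1 (by linarith)
  have e : 1 / (z - l) + 1 / l + z / l ^ 2 = z ^ 2 / (l ^ 2 * (z - l)) := by
    field_simp
    ring
  rw [e, norm_div, norm_mul, norm_pow, norm_pow]
  calc ‖z‖ ^ 2 / (‖l‖ ^ 2 * ‖z - l‖) ≤ R ^ 2 / (‖l‖ ^ 2 * (‖l‖ / 2)) := by gcongr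
    _ = 2 * R ^ 2 / ‖l‖ ^ 3 := by field_simp

theorem norm_wp_term_le (hR : 0 < R) (hz : ‖z‖ < R) (hl : 2 * R ≤ ‖l‖) :
    ‖1 / (z - l) ^ 2 - 1 / l ^ 2‖ ≤ 10 * R / ‖l‖ ^ 3 := by
  have := PeriodPair.weierstrassP_bound R hR z hz l hl
  rwa [Real.rpow_neg (norm_nonneg _), ← div_eq_mul_inv, show (3 : ℝ) = ((3 : ℕ) : ℝ) by norm_num,
    Real.rpow_natCast] at this

/-- Differentiation in τ brings out a factor k₀ of size |l|. The term -2z/l³ makes the bracket of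
order |l|⁻⁴, so cubic decay remains. -/
theorem norm_tauDeriv_term_le (hR : 0 < R) (hz : ‖z‖ < R) (hl : 2 * R ≤ ‖l‖) {c : ℝ} (hc : 0 < c)
    {k : Fin 2 → ℤ} (hk : c * ‖k‖ ≤ ‖l‖) :
    ‖(k 0 : ℂ) * (1 / (z - l) ^ 2 - 1 / l ^ 2 - 2 * z / l ^ 3)‖ ≤ 16 * R ^ 2 / c / ‖l‖ ^ 3 := by
  have h1 := half_norm_le_norm_sub hz hl
  have hl0 : 0 < ‖l‖ := by linarith
  have hl' : l ≠ 0 := norm_pos_iff.1 hl0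
  have hzl : z - l ≠ 0 := norm_pos_iff.1 (by linarith)
  have e : 1 / (z - l) ^ 2 - 1 / l ^ 2 - 2 * z / l ^ 3
      = z ^ 2 * (3 * l - 2 * z) / (l ^ 3 * (z - l) ^ 2) := by
    field_simp
    ring
  have hk0 : ‖(k 0 : ℂ)‖ ≤ ‖l‖ / c := by
    rw [le_div_iff₀' hc]
    refine le_trans ?_ hk
    gcongr
    calc ‖(k 0 : ℂ)‖ = ‖k 0‖ := by simp [Int.norm_eq_abs]
      _ ≤ ‖k‖ := norm_le_pi_norm k 0
  have h3 : ‖3 * l - 2 * z‖ ≤ 4 * ‖l‖ := by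
    refine (norm_sub_le _ _).trans ?_
    simp only [norm_mul, Complex.norm_ofNat]
    linarith
  rw [e, norm_mul, norm_div, norm_mul, norm_mul, norm_pow, norm_pow, norm_pow]
  calc ‖(k 0 : ℂ)‖ * (‖z‖ ^ 2 * ‖3 * l - 2 * z‖ / (‖l‖ ^ 3 * ‖z - l‖ ^ 2))
      ≤ ‖l‖ / c * (R ^ 2 * (4 * ‖l‖) / (‖l‖ ^ 3 * (‖l‖ / 2) ^ 2)) := by gcongr
    _ = 16 * R ^ 2 / c / ‖l‖ ^ 3 := by field_simp; norm_num

end Bounds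

/-- The sums over the lattice `ℤτ + ℤ` indexed by `ℤ²`. -/
def zetaTerm (k : Fin 2 → ℤ) (z τ : ℂ) : ℂ := 1 / (z - om k τ) + 1 / om k τ + z / om k τ ^ 2
def wpTerm (k : Fin 2 → ℤ) (z τ : ℂ) : ℂ := 1 / (z - om k τ) ^ 2 - 1 / om k τ ^ 2
def wpTerm' (k : Fin 2 → ℤ) (z τ : ℂ) : ℂ := -2 / (z - om k τ) ^ 3
def zetaTauTerm (k : Fin 2 → ℤ) (z τ : ℂ) : ℂ :=
  k 0 * (1 / (z - om k τ) ^ 2 - 1 / om k τ ^ 2 - 2 * z / om k τ ^ 3)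
def wpTauTerm (k : Fin 2 → ℤ) (z τ : ℂ) : ℂ := k 0 * (2 / (z - om k τ) ^ 3 + 2 / om k τ ^ 3)

def zetaC (z τ : ℂ) : ℂ := ∑' k, zetaTerm k z τ
def wpC (z τ : ℂ) : ℂ := ∑' k, wpTerm k z τ
def wpC' (z τ : ℂ) : ℂ := ∑' k, wpTerm' k z τ
/-- The derivative of `ζ(z|τ)` with respect to `τ`. -/
def zetaTau (z τ : ℂ) : ℂ := ∑' k, zetaTauTerm k z τ
/-- The derivative of `℘(z|τ)` with respect to `τ`. -/
def wpTau (z τ : ℂ) : ℂ := ∑' k, wpTauTerm k z τ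

/-! ### Term-by-term derivatives. -/

section TermDerivatives

variable {k : Fin 2 → ℤ} {a σ : ℂ → ℂ} {a' σ' w : ℂ}

theorem hasDerivAt_om (hσ : HasDerivAt σ σ' w) :
    HasDerivAt (fun w => om k (σ w)) (k 0 * σ') w := (hσ.const_mul (k 0 : ℂ)).add_const _

/-- The index k = 0 is included: there the function and the asserted derivative are both 0, because
1/0 = 0. -/
theorem hasDerivAt_inv_pow_om (hσ : HasDerivAt σ σ' w) (hτ : 0 < (σ w).im) (n : ℕ) :
    HasDerivAt (fun w => ((om k (σ w)) ^ (n + 1))⁻¹)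
      (-((n : ℂ) + 1) * (k 0 * σ') / om k (σ w) ^ (n + 2)) w := by
  by_cases hk : k = 0
  · subst hk
    simp only [om_zero]
    simpa using hasDerivAt_const w (0 : ℂ)
  · have h0 := om_ne_zero hk hτ
    refine (((hasDerivAt_om hσ).pow (n + 1)).inv (pow_ne_zero _ h0)).congr_deriv ?_
    push_cast
    simp only [Pi.pow_apply]
    field_simp
    ring

theorem hasDerivAt_zetaTerm (ha : HasDerivAt a a' w) (hσ : HasDerivAt σ σ' w)
    (hτ : 0 < (σ w).im) (hk : a w ≠ om k (σ w)) :
    HasDerivAt (fun w => zetaTerm k (a w) (σ w))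
      (-a' * wpTerm k (a w) (σ w) + σ' * zetaTauTerm k (a w) (σ w)) w := by
  have h0 : a w - om k (σ w) ≠ 0 := sub_ne_zero.2 hk
  have h1 := (ha.sub (hasDerivAt_om (k := k) hσ)).inv h0
  have h2 := hasDerivAt_inv_pow_om (k := k) hσ hτ 0
  have h3 := ha.mul (hasDerivAt_inv_pow_om (k := k) hσ hτ 1)
  refine ((h1.add h2).add h3).congr_of_eventuallyEq ?_ |>.congr_deriv ?_
  · filter_upwards with v
    simp [zetaTerm, div_eq_mul_inv]
  · simp only [wpTerm, zetaTauTerm, Pi.sub_apply, Nat.cast_zero, Nat.cast_one]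
    field_simp
    ring

theorem hasDerivAt_wpTerm (ha : HasDerivAt a a' w) (hσ : HasDerivAt σ σ' w)
    (hτ : 0 < (σ w).im) (hk : a w ≠ om k (σ w)) :
    HasDerivAt (fun w => wpTerm k (a w) (σ w))
      (a' * wpTerm' k (a w) (σ w) + σ' * wpTauTerm k (a w) (σ w)) w := by
  have h0 : a w - om k (σ w) ≠ 0 := sub_ne_zero.2 hk
  have h1 := ((ha.sub (hasDerivAt_om (k := k) hσ)).pow 2).inv (pow_ne_zero 2 h0)
  have h2 := hasDerivAt_inv_pow_om (k := k) hσ hτ 1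
  refine (h1.sub h2).congr_of_eventuallyEq ?_ |>.congr_deriv ?_
  · filter_upwards with v
    simp [wpTerm]
  · simp only [wpTerm', wpTauTerm, Pi.sub_apply, Pi.pow_apply, Nat.cast_ofNat, Nat.cast_one]
    field_simp
    ring

theorem hasDerivAt_zetaTauTerm {z τ : ℂ} (hk : z ≠ om k τ) :
    HasDerivAt (fun z => zetaTauTerm k z τ) (-wpTauTerm k z τ) z := by
  have h0 : z - om k τ ≠ 0 := sub_ne_zero.2 hk
  have h1 := (((hasDerivAt_id z).sub_const (om k τ)).pow 2).inv (pow_ne_zero 2 h0)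
  have h2 := ((h1.sub_const (1 / om k τ ^ 2)).sub
    (((hasDerivAt_id z).const_mul 2).div_const (om k τ ^ 3))).const_mul (k 0 : ℂ)
  refine h2.congr_of_eventuallyEq ?_ |>.congr_deriv ?_
  · filter_upwards with v
    simp [zetaTauTerm]
  · simp only [wpTauTerm, Pi.pow_apply, id, Nat.cast_ofNat]
    field_simp
    ring

end TermDerivatives

/-! ### Derivatives of the lattice sums along a curve (a(w), σ(w)). -/

section SumDerivatives

variable {a σ : ℂ → ℂ} {w₀ : ℂ}

theorem ne_om_of_bound {z τ : ℂ} {k : Fin 2 → ℤ} {R : ℝ} (hz : ‖z‖ < R) (h : 2 * R ≤ ‖om k τ‖) :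
    z ≠ om k τ := by
  rintro rfl
  linarith [norm_nonneg (om k τ)]

theorem inv_cube_le {l c K C : ℝ} (hC : 0 ≤ C) (hc : 0 < c) (hK : 0 < K) (h : c * K ≤ l) :
    C / l ^ 3 ≤ C / c ^ 3 * (K ^ 3)⁻¹ := by
  rw [← div_eq_mul_inv, div_div, ← mul_pow]
  gcongr

theorem eventually_ne_om (ha : ContinuousAt a w₀) (hσ : ContinuousAt σ w₀) {k : Fin 2 → ℤ}
    (h : a w₀ ≠ om k (σ w₀)) : ∀ᶠ w in 𝓝 w₀, a w ≠ om k (σ w) := by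
  have hom : ContinuousAt (fun w => om k (σ w)) w₀ := by
    unfold om
    fun_prop
  exact ((ha.sub hom).eventually_ne (sub_ne_zero.2 h)).mono fun w hw => sub_ne_zero.1 hw

theorem hasDerivAt_zetaC (ha : Differentiable ℂ a) (hσ : Differentiable ℂ σ)
    (hτ : 0 < (σ w₀).im) (h : ∀ k, a w₀ ≠ om k (σ w₀)) :
    Summable (fun k => -deriv a w₀ * wpTerm k (a w₀) (σ w₀)
      + deriv σ w₀ * zetaTauTerm k (a w₀) (σ w₀)) ∧
    HasDerivAt (fun w => zetaC (a w) (σ w)) (∑' k, (-deriv a w₀ * wpTerm k (a w₀) (σ w₀)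
      + deriv σ w₀ * zetaTauTerm k (a w₀) (σ w₀))) w₀ := by
  have hac := ha.continuous.continuousAt (x := w₀)
  have hσc := hσ.continuous.continuousAt (x := w₀)
  obtain ⟨R, hR, c, hc, S, hS⟩ := exists_om_bound hac hσc hτ
  have him : ∀ᶠ w in 𝓝 w₀, 0 < (σ w).im := hS.mono fun w hw => hw.1
  refine hasDerivAt_tsum_of_eventually
    (summable_norm_inv_cube.mul_left (2 * R ^ 2 / c ^ 3)) S (fun k => ?_) ?_ (fun k => ?_)
  · filter_upwards [him, eventually_ne_om hac hσc (h k)] with w h1 h2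
    exact (hasDerivAt_zetaTerm (ha w).hasDerivAt (hσ w).hasDerivAt h1 h2).differentiableAt
  · filter_upwards [hS] with w ⟨h1, h2, h3⟩ k hk
    obtain ⟨h4, h5, h6⟩ := h3 k hk
    refine ⟨(hasDerivAt_zetaTerm (ha w).hasDerivAt (hσ w).hasDerivAt h1
      (ne_om_of_bound h2 h4)).differentiableAt, ?_⟩
    exact (norm_zeta_term_le hR h2 h4).trans (inv_cube_le (by positivity) hc h6 h5)
  · exact hasDerivAt_zetaTerm (ha w₀).hasDerivAt (hσ w₀).hasDerivAt hτ (h k)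

theorem hasDerivAt_wpC (ha : Differentiable ℂ a) (hσ : Differentiable ℂ σ)
    (hτ : 0 < (σ w₀).im) (h : ∀ k, a w₀ ≠ om k (σ w₀)) :
    Summable (fun k => deriv a w₀ * wpTerm' k (a w₀) (σ w₀)
      + deriv σ w₀ * wpTauTerm k (a w₀) (σ w₀)) ∧
    HasDerivAt (fun w => wpC (a w) (σ w)) (∑' k, (deriv a w₀ * wpTerm' k (a w₀) (σ w₀)
      + deriv σ w₀ * wpTauTerm k (a w₀) (σ w₀))) w₀ := by
  have hac := ha.continuous.continuousAt (x := w₀)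
  have hσc := hσ.continuous.continuousAt (x := w₀)
  obtain ⟨R, hR, c, hc, S, hS⟩ := exists_om_bound hac hσc hτ
  have him : ∀ᶠ w in 𝓝 w₀, 0 < (σ w).im := hS.mono fun w hw => hw.1
  refine hasDerivAt_tsum_of_eventually
    (summable_norm_inv_cube.mul_left (10 * R / c ^ 3)) S (fun k => ?_) ?_ (fun k => ?_)
  · filter_upwards [him, eventually_ne_om hac hσc (h k)] with w h1 h2
    exact (hasDerivAt_wpTerm (ha w).hasDerivAt (hσ w).hasDerivAt h1 h2).differentiableAt
  · filter_upwards [hS] with w ⟨h1, h2, h3⟩ k hk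
    obtain ⟨h4, h5, h6⟩ := h3 k hk
    refine ⟨(hasDerivAt_wpTerm (ha w).hasDerivAt (hσ w).hasDerivAt h1
      (ne_om_of_bound h2 h4)).differentiableAt, ?_⟩
    exact (norm_wp_term_le hR h2 h4).trans (inv_cube_le (by positivity) hc h6 h5)
  · exact hasDerivAt_wpTerm (ha w₀).hasDerivAt (hσ w₀).hasDerivAt hτ (h k)

end SumDerivatives

/-! ### Absolute convergence of the lattice sums. -/

section Summability

variable {z τ : ℂ} (hτ : 0 < τ.im)
include hτ

theorem summable_of_bound {f : (Fin 2 → ℤ) → ℂ} {C : ℝ → ℝ → ℝ}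
    (hC : ∀ R c, 0 < R → 0 < c → 0 ≤ C R c)
    (h : ∀ R > 0, ∀ c > 0, ‖z‖ < R → ∀ k, 2 * R ≤ ‖om k τ‖ → c * ‖k‖ ≤ ‖om k τ‖ →
      ‖f k‖ ≤ C R c / ‖om k τ‖ ^ 3) : Summable f := by
  obtain ⟨R, hR, c, hc, S, hS⟩ := exists_om_bound (a := fun _ => z) (σ := fun _ => τ) (w₀ := 0)
    continuousAt_const continuousAt_const hτ
  obtain ⟨-, hz, hk⟩ := hS.self_of_nhds
  refine Summable.of_norm_bounded_eventually
    (summable_norm_inv_cube.mul_left (C R c / c ^ 3)) ?_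
  filter_upwards [S.finite_toSet.compl_mem_cofinite] with k hkS
  obtain ⟨h4, h5, h6⟩ := hk k hkS
  exact (h R hR c hc hz k h4 h5).trans (inv_cube_le (hC R c hR hc) hc h6 h5)

theorem summable_zetaTerm : Summable fun k => zetaTerm k z τ :=
  summable_of_bound hτ (C := fun R _ => 2 * R ^ 2) (fun R c _ _ => by positivity)
    fun R hR c _ hz k h1 _ => norm_zeta_term_le hR hz h1

theorem summable_wpTerm : Summable fun k => wpTerm k z τ :=
  summable_of_bound hτ (C := fun R _ => 10 * R) (fun R c _ _ => by positivity)
    fun R hR c _ hz k h1 _ => norm_wp_term_le hR hz h1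

theorem summable_zetaTauTerm : Summable fun k => zetaTauTerm k z τ :=
  summable_of_bound hτ (C := fun R c => 16 * R ^ 2 / c) (fun R c _ _ => by positivity)
    fun R hR c hc hz k h1 h2 => norm_tauDeriv_term_le hR hz h1 hc h2

end Summability

/-- `d/dw ζ(a|σ) = -a' ℘ + σ' ∂ζ/∂τ`. -/
theorem hasDerivAt_zetaC' {a σ : ℂ → ℂ} {w₀ : ℂ} (ha : Differentiable ℂ a)
    (hσ : Differentiable ℂ σ) (hτ : 0 < (σ w₀).im) (h : ∀ k, a w₀ ≠ om k (σ w₀)) :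
    HasDerivAt (fun w => zetaC (a w) (σ w))
      (-deriv a w₀ * wpC (a w₀) (σ w₀) + deriv σ w₀ * zetaTau (a w₀) (σ w₀)) w₀ := by
  refine (hasDerivAt_zetaC ha hσ hτ h).2.congr_deriv ?_
  rw [Summable.tsum_add ((summable_wpTerm hτ).mul_left _) ((summable_zetaTauTerm hτ).mul_left _),
    tsum_mul_left, tsum_mul_left]
  rfl

/-- Convergence is a by-product of differentiating ℘ in z with τ fixed; differentiating in τ with z
fixed gives the next one. -/
theorem summable_wpTerm' {z τ : ℂ} (hτ : 0 < τ.im) (h : ∀ k, z ≠ om k τ) :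
    Summable fun k => wpTerm' k z τ := by
  simpa using (hasDerivAt_wpC (a := fun w => w) (σ := fun _ => τ) (w₀ := z) differentiable_id
    (differentiable_const τ) hτ h).1

theorem summable_wpTauTerm {z τ : ℂ} (hτ : 0 < τ.im) (h : ∀ k, z ≠ om k τ) :
    Summable fun k => wpTauTerm k z τ := by
  simpa using (hasDerivAt_wpC (a := fun _ => z) (σ := fun w => w) (w₀ := τ)
    (differentiable_const z) differentiable_id hτ h).1

/-- `d/dw ℘(a|σ) = a' ℘' + σ' ∂℘/∂τ`. -/
theorem hasDerivAt_wpC_comp {a σ : ℂ → ℂ} {w₀ : ℂ} (ha : Differentiable ℂ a)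
    (hσ : Differentiable ℂ σ) (hτ : 0 < (σ w₀).im) (h : ∀ k, a w₀ ≠ om k (σ w₀)) :
    HasDerivAt (fun w => wpC (a w) (σ w))
      (deriv a w₀ * wpC' (a w₀) (σ w₀) + deriv σ w₀ * wpTau (a w₀) (σ w₀)) w₀ := by
  refine (hasDerivAt_wpC ha hσ hτ h).2.congr_deriv ?_
  rw [Summable.tsum_add ((summable_wpTerm' hτ h).mul_left _)
    ((summable_wpTauTerm hτ h).mul_left _), tsum_mul_left, tsum_mul_left]
  rfl

theorem zetaTauTerm_zero (z τ : ℂ) : zetaTauTerm 0 z τ = 0 := by simp [zetaTauTerm]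

/-- `∂ζ/∂τ` is holomorphic in `z` also at `z = 0`, with derivative `-∂℘/∂τ`. -/
theorem hasDerivAt_zetaTau {z τ : ℂ} (hτ : 0 < τ.im) (h : ∀ k, k ≠ 0 → z ≠ om k τ) :
    HasDerivAt (fun z => zetaTau z τ) (-wpTau z τ) z := by
  obtain ⟨R, hR, c, hc, S, hS⟩ := exists_om_bound (a := fun w => w) (σ := fun _ => τ) (w₀ := z)
    continuousAt_id continuousAt_const hτ
  have term : ∀ {k : Fin 2 → ℤ} {w : ℂ}, (k ≠ 0 → w ≠ om k τ) →
      HasDerivAt (fun z => zetaTauTerm k z τ) (-wpTauTerm k w τ) w := by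
    intro k w hk
    by_cases h0 : k = 0
    · subst h0
      simp only [zetaTauTerm_zero]
      simpa [wpTauTerm] using hasDerivAt_const w (0 : ℂ)
    · exact hasDerivAt_zetaTauTerm (hk h0)
  refine (hasDerivAt_tsum_of_eventually (F := fun k z => zetaTauTerm k z τ)
    (summable_norm_inv_cube.mul_left (16 * R ^ 2 / c / c ^ 3)) S (fun k => ?_) ?_
    (fun k => term (h k))).2.congr_deriv (by rw [tsum_neg]; rfl)
  · by_cases h0 : k = 0
    · exact Eventually.of_forall fun w => (term fun hk => (hk h0).elim).differentiableAt
    · filter_upwards [eventually_ne_om (σ := fun _ => τ) continuousAt_id continuousAt_const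
        (h k h0)] with w hw
      exact (term fun _ => hw).differentiableAt
  · filter_upwards [hS] with w ⟨_, h2, h3⟩ k hk
    obtain ⟨h4, h5, h6⟩ := h3 k hk
    exact ⟨(term fun _ => ne_om_of_bound h2 h4).differentiableAt,
      (norm_tauDeriv_term_le hR h2 h4 hc h5).trans (inv_cube_le (by positivity) hc h6 h5)⟩

/-- `ζ(z|τ) - 1/z`. -/
def zetaReg (z τ : ℂ) : ℂ := ∑' k : Fin 2 → ℤ, if k = 0 then 0 else zetaTerm k z τ

/-- `℘(z|τ) - 1/z²`. -/
def wpReg (z τ : ℂ) : ℂ := ∑' k : Fin 2 → ℤ, if k = 0 then 0 else wpTerm k z τ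

theorem hasDerivAt_zetaReg {z τ : ℂ} (hτ : 0 < τ.im) (h : ∀ k, k ≠ 0 → z ≠ om k τ) :
    HasDerivAt (fun z => zetaReg z τ) (-wpReg z τ) z := by
  obtain ⟨R, hR, c, hc, S, hS⟩ := exists_om_bound (a := fun w => w) (σ := fun _ => τ) (w₀ := z)
    continuousAt_id continuousAt_const hτ
  have term : ∀ {k : Fin 2 → ℤ} {w : ℂ}, (k ≠ 0 → w ≠ om k τ) →
      HasDerivAt (fun z => if k = 0 then 0 else zetaTerm k z τ)
        (-(if k = 0 then 0 else wpTerm k w τ)) w := by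
    intro k w hk
    by_cases h0 : k = 0
    · simpa [h0] using hasDerivAt_const w (0 : ℂ)
    · simpa [h0] using hasDerivAt_zetaTerm (hasDerivAt_id w) (hasDerivAt_const w τ) hτ (hk h0)
  refine (hasDerivAt_tsum_of_eventually (F := fun k z => if k = 0 then 0 else zetaTerm k z τ)
    (summable_norm_inv_cube.mul_left (2 * R ^ 2 / c ^ 3)) S (fun k => ?_) ?_
    (fun k => term (h k))).2.congr_deriv (by rw [tsum_neg]; rfl)
  · by_cases h0 : k = 0
    · exact Eventually.of_forall fun w => (term fun hk => (hk h0).elim).differentiableAt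
    · filter_upwards [eventually_ne_om (σ := fun _ => τ) continuousAt_id continuousAt_const
        (h k h0)] with w hw
      exact (term fun _ => hw).differentiableAt
  · filter_upwards [hS] with w ⟨_, h2, h3⟩ k hk
    obtain ⟨h4, h5, h6⟩ := h3 k hk
    refine ⟨(term fun _ => ne_om_of_bound h2 h4).differentiableAt, ?_⟩
    rw [if_neg (norm_pos_iff.1 h6)]
    exact (norm_zeta_term_le hR h2 h4).trans (inv_cube_le (by positivity) hc h6 h5)

theorem zetaReg_zero (τ : ℂ) : zetaReg 0 τ = 0 := by
  rw [zetaReg]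
  refine (tsum_congr fun k => ?_).trans tsum_zero
  simp [zetaTerm]

theorem zetaC_eq (z : ℂ) {τ : ℂ} (hτ : 0 < τ.im) : zetaC z τ = 1 / z + zetaReg z τ := by
  rw [zetaC, (summable_zetaTerm hτ).tsum_eq_add_tsum_ite 0]
  congr 1
  simp [zetaTerm, om_zero]

theorem zetaC_neg (z τ : ℂ) : zetaC (-z) τ = -zetaC z τ := by
  rw [zetaC, ← (Equiv.neg _).tsum_eq, zetaC, ← tsum_neg]
  refine tsum_congr fun k => ?_
  simp only [Equiv.neg_apply, zetaTerm, om_neg]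
  rw [show -z - -om k τ = -(z - om k τ) by ring, neg_sq]
  simp only [div_neg, neg_div]
  ring

/-! ### Comparison with the sums over the lattice -/

/-- The indexing of the lattice by `ℤ²`. -/
def latticeEquiv (τ : UpperHalfPlane) : (Fin 2 → ℤ) ≃ (periods τ).lattice :=
  ((finTwoArrowEquiv ℤ).trans (Equiv.prodComm ℤ ℤ)).trans
    (periods τ).latticeEquivProd.symm.toEquiv

theorem latticeEquiv_apply (τ : UpperHalfPlane) (k : Fin 2 → ℤ) :
    (latticeEquiv τ k : ℂ) = om k τ := by
  have := (periods τ).latticeEquiv_symm_apply (k 1, k 0)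
  change (latticeEquiv τ k : ℂ) = _ at this
  rw [this]
  simp [om, periods]
  ring

theorem zeta_eq (z : ℂ) (τ : UpperHalfPlane) : zeta z τ = zetaC z τ := by
  rw [zeta, ← (latticeEquiv τ).tsum_eq]
  exact tsum_congr fun k => by rw [latticeEquiv_apply, zetaTerm]

theorem wp_eq (z : ℂ) (τ : UpperHalfPlane) : wp z τ = wpC z τ := by
  rw [wp, PeriodPair.weierstrassP, ← (latticeEquiv τ).tsum_eq]
  exact tsum_congr fun k => by rw [latticeEquiv_apply, wpTerm]

theorem wp'_eq (z : ℂ) (τ : UpperHalfPlane) : wp' z τ = wpC' z τ := by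
  rw [wp', PeriodPair.derivWeierstrassP, ← (latticeEquiv τ).tsum_eq, ← tsum_neg]
  exact tsum_congr fun k => by rw [latticeEquiv_apply, wpTerm', neg_div]

theorem wpReg_eq (z : ℂ) (τ : UpperHalfPlane) :
    wpReg z τ = (periods τ).weierstrassPExcept 0 z := by
  rw [PeriodPair.weierstrassPExcept, ← (latticeEquiv τ).tsum_eq]
  refine tsum_congr fun k => ?_
  rw [latticeEquiv_apply, wpTerm]
  by_cases hk : k = 0
  · simp [hk, om_zero]
  · rw [if_neg hk, if_neg (om_ne_zero hk τ.im_pos)]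

theorem notMem_lattice_iff {z : ℂ} {τ : UpperHalfPlane} :
    z ∉ (periods τ).lattice ↔ ∀ k, z ≠ om k τ := by
  rw [← not_exists_not, not_iff_not]
  simp only [ne_eq, not_not]
  constructor
  · intro h
    refine ⟨(latticeEquiv τ).symm ⟨z, h⟩, ?_⟩
    rw [← latticeEquiv_apply, Equiv.apply_symm_apply]
  · rintro ⟨k, rfl⟩
    rw [← latticeEquiv_apply]
    exact (latticeEquiv τ k).2

/-! ### Elliptic functions for a fixed lattice -/

section Lattice

variable {τ : UpperHalfPlane}

theorem mem_lattice_iff {z : ℂ} :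
    z ∈ (periods τ).lattice ↔ ∃ m n : ℤ, (m : ℂ) * 1 + n * (τ : ℂ) = z :=
  PeriodPair.mem_lattice

theorem one_mem_lattice : (1 : ℂ) ∈ (periods τ).lattice := (periods τ).ω₁_mem_lattice

theorem tau_mem_lattice : (τ : ℂ) ∈ (periods τ).lattice := (periods τ).ω₂_mem_lattice

theorem half_notMem_lattice : (1 / 2 : ℂ) ∉ (periods τ).lattice :=
  (periods τ).ω₁_div_two_notMem_lattice

theorem tau_half_notMem_lattice : (τ / 2 : ℂ) ∉ (periods τ).lattice :=
  (periods τ).ω₂_div_two_notMem_lattice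

theorem one_add_tau_half_notMem_lattice : ((1 + τ) / 2 : ℂ) ∉ (periods τ).lattice := by
  have := ((periods τ).mul_ω₁_add_mul_ω₂_mem_lattice (α := 1 / 2) (β := 1 / 2)).not.mpr
    (by norm_num)
  rwa [show ((1 / 2 : ℚ) : ℂ) * (periods τ).ω₁ + ((1 / 2 : ℚ) : ℂ) * (periods τ).ω₂
    = (1 + τ) / 2 by simp [periods]; ring] at this

theorem tau_half_sub_half_notMem_lattice : (τ / 2 - 1 / 2 : ℂ) ∉ (periods τ).lattice := by
  intro h
  refine one_add_tau_half_notMem_lattice (τ := τ) ?_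
  have := add_mem h (one_mem_lattice (τ := τ))
  rwa [show (τ / 2 - 1 / 2 + 1 : ℂ) = (1 + τ) / 2 by ring] at this

/-- A function that is periodic under `1` and `τ` is periodic under the lattice. -/
theorem periodic_of_mem_lattice {α : Type*} {f : ℂ → α} (h1 : Function.Periodic f 1)
    (hτ : Function.Periodic f τ) {l : ℂ} (hl : l ∈ (periods τ).lattice) :
    Function.Periodic f l := by
  obtain ⟨m, n, rfl⟩ := mem_lattice_iff.1 hl
  exact (h1.int_mul m).add_period (hτ.int_mul n)

theorem add_notMem_lattice {z l : ℂ} (hl : l ∈ (periods τ).lattice) :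
    z + l ∉ (periods τ).lattice ↔ z ∉ (periods τ).lattice :=
  (Submodule.add_mem_iff_left _ hl).not

theorem eventually_notMem_lattice (z : ℂ) : ∀ᶠ w in 𝓝[≠] z, w ∉ (periods τ).lattice := by
  filter_upwards [self_mem_nhdsWithin, mem_nhdsWithin_of_mem_nhds
    ((periods τ).compl_lattice_sdiff_singleton_mem_nhds z)] with w hw hw' h
  exact hw' ⟨h, hw⟩

theorem eventually_notMem_lattice_nhds {z : ℂ} (hz : z ∉ (periods τ).lattice) :
    ∀ᶠ w in 𝓝 z, w ∉ (periods τ).lattice :=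
  (periods τ).isClosed_lattice.isOpen_compl.mem_nhds hz

theorem isPreconnected_compl_lattice : IsPreconnected ((periods τ).lattice : Set ℂ)ᶜ := by
  refine (Set.Countable.isConnected_compl_of_one_lt_rank ?_ ?_).isPreconnected
  · rw [Complex.rank_real_complex]
    norm_num
  · have : Countable (periods τ).lattice := (latticeEquiv τ).symm.injective.countable
    exact Set.to_countable _

theorem eq_of_hasDerivAt_zero {f : ℂ → ℂ} (hf : ∀ z ∉ (periods τ).lattice, HasDerivAt f 0 z)
    {z w : ℂ} (hz : z ∉ (periods τ).lattice) (hw : w ∉ (periods τ).lattice) : f z = f w := by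
  obtain ⟨a, ha⟩ := (periods τ).isClosed_lattice.isOpen_compl.exists_is_const_of_deriv_eq_zero
    isPreconnected_compl_lattice
    (fun z hz => (hf z hz).differentiableAt.differentiableWithinAt) (fun z hz => (hf z hz).deriv)
  rw [ha z hz, ha w hw]

theorem tendsto_add_punctured (z l : ℂ) : Tendsto (fun w => w + l) (𝓝[≠] z) (𝓝[≠] (z + l)) := by
  refine tendsto_nhdsWithin_iff.2 ⟨?_, ?_⟩
  · exact ((continuous_add_const l).tendsto z).mono_left nhdsWithin_le_nhds
  · filter_upwards [self_mem_nhdsWithin] with w hw h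
    exact hw (add_right_cancel h)

/-- Liouville's theorem for functions on `ℂ` with removable singularities that have period `1` and
are changed by a constant under `z ↦ z + τ`. -/
theorem exists_tendsto_of_periodic {f : ℂ → ℂ} {d : ℂ}
    (hd : ∀ z, ∀ᶠ w in 𝓝[≠] z, DifferentiableAt ℂ f w)
    (hlim : ∀ z, ∃ l, Tendsto f (𝓝[≠] z) (𝓝 l))
    (h1 : ∀ z, ∀ᶠ w in 𝓝[≠] z, f (w + 1) = f w)
    (hτ : ∀ z, ∀ᶠ w in 𝓝[≠] z, f (w + τ) = f w + d) :
    d = 0 ∧ ∃ C, ∀ z, Tendsto f (𝓝[≠] z) (𝓝 C) := by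
  choose F hF using hlim
  have hFf : ∀ z, F =ᶠ[𝓝[≠] z] f := fun z => by
    filter_upwards [hd z] with w hw
    exact tendsto_nhds_unique (hF w) (hw.continuousAt.tendsto.mono_left nhdsWithin_le_nhds)
  have hdiff : Differentiable ℂ F := fun z => by
    refine (Complex.analyticAt_of_differentiable_on_punctured_nhds_of_continuousAt ?_
      ?_).differentiableAt
    · filter_upwards [hd z, hFf z] with w hw hw'
      refine hw.congr_of_eventuallyEq ?_
      filter_upwards [eventually_nhdsWithin_iff.1 (hFf w)] with v hv
      by_cases h : v = w
      · rw [h, hw']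
      · exact hv h
    · exact continuousAt_iff_punctured_nhds.2 ((hF z).congr' (hFf z).symm)
  have hF1 : ∀ z, F (z + 1) = F z := fun z => by
    refine tendsto_nhds_unique ((hF (z + 1)).comp (tendsto_add_punctured z 1))
      ((hF z).congr' ?_)
    filter_upwards [h1 z] with w hw using hw.symm
  have hFτ : ∀ z, F (z + τ) = F z + d := fun z => by
    refine tendsto_nhds_unique ((hF (z + τ)).comp (tendsto_add_punctured z τ))
      (((hF z).add_const d).congr' ?_)
    filter_upwards [hτ z] with w hw using hw.symm
  -- F' is entire and doubly periodic, hence bounded, hence constant. So F is affine; the period 1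
  -- makes its slope 0, and then d = 0.
  have hp1 : Function.Periodic (deriv F) 1 := fun z => by
    rw [← deriv_comp_add_const F 1 z, funext hF1]
  have hpτ : Function.Periodic (deriv F) τ := fun z => by
    rw [← deriv_comp_add_const F τ z, funext hFτ, deriv_add_const]
  have hdF : Differentiable ℂ (deriv F) := hdiff.deriv
  have hb := (IsZLattice.isCompact_range_of_periodic (periods τ).lattice (deriv F)
    hdF.continuous fun z w hw => periodic_of_mem_lattice hp1 hpτ hw z).isBounded
  have hc : ∀ z, deriv F z = deriv F 0 := fun z => hdF.apply_eq_apply_of_bounded hb z 0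
  have hlin : ∀ z, F z = F 0 + deriv F 0 * z := fun z => by
    have : ∀ w, HasDerivAt (fun z => F z - deriv F 0 * z) 0 w := fun w => by
      have := (hdiff w).hasDerivAt.sub ((hasDerivAt_id w).const_mul (deriv F 0))
      exact this.congr_deriv (by rw [hc w]; ring)
    have := is_const_of_deriv_eq_zero (fun w => (this w).differentiableAt)
      (fun w => (this w).deriv) z 0
    simp only [mul_zero, sub_zero] at this
    linear_combination this
  have h0 : deriv F 0 = 0 := by
    have := hF1 0
    rw [hlin (0 + 1)] at this
    simpa using this
  have hconst : ∀ z, F z = F 0 := fun z => by rw [hlin z, h0]; ring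
  refine ⟨?_, F 0, fun z => hconst z ▸ hF z⟩
  have := hFτ 0
  rw [hconst (0 + τ)] at this
  simpa using this

/-- The values of `℘` near a lattice point. -/
theorem wp_eq_add (z : ℂ) : wp z τ = 1 / z ^ 2 + (periods τ).weierstrassPExcept 0 z := by
  have := (periods τ).weierstrassPExcept_add 0 z
  rw [wp, ← this]
  simp
  ring

theorem wp'_eq_add (z : ℂ) : wp' z τ = -2 / z ^ 3 + (periods τ).derivWeierstrassPExcept 0 z := by
  have := (periods τ).derivWeierstrassPExcept_sub 0 z
  rw [wp', ← this]
  simp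
  ring

theorem wp_add_of_mem {l : ℂ} (hl : l ∈ (periods τ).lattice) (z : ℂ) : wp (z + l) τ = wp z τ :=
  (periods τ).weierstrassP_add_coe z ⟨l, hl⟩

theorem wp'_add_of_mem {l : ℂ} (hl : l ∈ (periods τ).lattice) (z : ℂ) :
    wp' (z + l) τ = wp' z τ :=
  (periods τ).derivWeierstrassP_add_coe z ⟨l, hl⟩

theorem wp_neg (z : ℂ) : wp (-z) τ = wp z τ := (periods τ).weierstrassP_neg z

theorem wp'_neg (z : ℂ) : wp' (-z) τ = -wp' z τ := (periods τ).derivWeierstrassP_neg z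

theorem analyticAt_wp {z : ℂ} (hz : z ∉ (periods τ).lattice) :
    AnalyticAt ℂ (fun z => wp z τ) z := (periods τ).analyticOnNhd_weierstrassP z hz

theorem analyticAt_wp' {z : ℂ} (hz : z ∉ (periods τ).lattice) :
    AnalyticAt ℂ (fun z => wp' z τ) z := (periods τ).analyticOnNhd_derivWeierstrassP z hz

theorem hasDerivAt_wp {z : ℂ} (hz : z ∉ (periods τ).lattice) :
    HasDerivAt (fun z => wp z τ) (wp' z τ) z := by
  have := (analyticAt_wp hz).differentiableAt.hasDerivAt
  exact this.congr_deriv (congrFun (periods τ).deriv_weierstrassP z)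

theorem wp'_eq_zero_of_two_mul_mem {ω : ℂ} (h : 2 * ω ∈ (periods τ).lattice) : wp' ω τ = 0 := by
  have h1 := wp'_add_of_mem h (-ω)
  rw [wp'_neg, show -ω + 2 * ω = ω by ring] at h1
  linear_combination h1 / 2

theorem analyticAt_wpExcept : AnalyticAt ℂ ((periods τ).weierstrassPExcept 0) 0 :=
  (periods τ).analyticAt_weierstrassPExcept 0

theorem tendsto_wp_cobounded : Tendsto (fun z => wp z τ) (𝓝[≠] 0) (Bornology.cobounded ℂ) := by
  have h := (periods τ).order_weierstrassP 0 (zero_mem _)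
  refine (tendsto_cobounded_iff_meromorphicOrderAt_neg
    ((periods τ).meromorphic_weierstrassP 0)).2 ?_
  rw [h]
  decide

/-- A function with a double zero is divisible by the square. -/
theorem exists_tendsto_div_sq {h : ℂ → ℂ} (ha : AnalyticAt ℂ h 0) (h0 : h 0 = 0)
    (h1 : deriv h 0 = 0) : ∃ l, Tendsto (fun z => h z / z ^ 2) (𝓝[≠] 0) (𝓝 l) := by
  have : (2 : ℕ) ≤ analyticOrderAt h 0 := by
    rw [natCast_le_analyticOrderAt_iff_iteratedDeriv_eq_zero ha]
    intro i hi
    interval_cases i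
    · simpa using h0
    · simpa using h1
  obtain ⟨g, hg, he⟩ := (natCast_le_analyticOrderAt ha).1 this
  refine ⟨g 0, (hg.continuousAt.tendsto.mono_left nhdsWithin_le_nhds).congr' ?_⟩
  filter_upwards [mem_nhdsWithin_of_mem_nhds he, self_mem_nhdsWithin] with z hz hne
  rw [hz]
  have : z ≠ 0 := hne
  simp
  field_simp

/-- `℘` is not locally constant. -/
theorem not_eventually_wp_eq {z c : ℂ} (hz : z ∉ (periods τ).lattice) :
    ¬ ∀ᶠ w in 𝓝 z, wp w τ = c := by
  intro h
  have hE := AnalyticOnNhd.eqOn_of_preconnected_of_eventuallyEq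
    (f := fun z => wp z τ) (g := fun _ => c) (fun w hw => analyticAt_wp hw)
    (fun w _ => analyticAt_const) isPreconnected_compl_lattice hz h
  have h1 : Tendsto (fun z => wp z τ) (𝓝[≠] 0) (𝓝 c) := by
    refine tendsto_const_nhds.congr' ?_
    filter_upwards [eventually_notMem_lattice (τ := τ) 0] with w hw using (hE hw).symm
  exact not_tendsto_nhds_of_tendsto_atTop (tendsto_norm_cobounded_atTop.comp
    (tendsto_wp_cobounded (τ := τ))) _ h1.norm

/-- `℘` takes its value at a half-period only there. -/
theorem sub_mem_of_wp_eq {ω z : ℂ} (hω : ω ∉ (periods τ).lattice)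
    (h2 : 2 * ω ∈ (periods τ).lattice) (hz : z ∉ (periods τ).lattice) (h : wp z τ = wp ω τ) :
    z - ω ∈ (periods τ).lattice := by
  by_contra hzω
  -- The double pole of each factor meets a double zero of the other, as ℘' vanishes at
  -- half-periods. So P is constant by Liouville.
  set P : ℂ → ℂ := fun z => (wp z τ - wp ω τ) * (wp (z - ω) τ - wp ω τ) with hP
  -- P is symmetric under translation by ω, so the singularities at ω + Λ reduce to the one at 0.
  have hshift : ∀ w, P (w + ω) = P w := fun w => by
    have := wp_add_of_mem h2 (w - ω)
    rw [show w - ω + 2 * ω = w + ω by ring] at this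
    simp only [hP, this, add_sub_cancel_right]
    ring
  have hper : ∀ l ∈ (periods τ).lattice, ∀ w, P (w + l) = P w := fun l hl w => by
    simp only [hP, wp_add_of_mem hl, add_sub_right_comm]
  have hda : ∀ w, w ∉ (periods τ).lattice → w - ω ∉ (periods τ).lattice →
      DifferentiableAt ℂ P w := fun w h1 h2 => by
    have h4 : DifferentiableAt ℂ (fun w => wp (w - ω) τ) w :=
      (analyticAt_wp h2).differentiableAt.comp w (differentiableAt_id.sub_const ω)
    exact ((analyticAt_wp h1).differentiableAt.sub_const _).mul (h4.sub_const _)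
  have hnω : -ω ∉ (periods τ).lattice := by rwa [neg_mem_iff]
  have hsub : ∀ z, ∀ᶠ w in 𝓝[≠] z, w - ω ∉ (periods τ).lattice := fun z => by
    have := (tendsto_add_punctured z (-ω)).eventually (eventually_notMem_lattice (τ := τ) _)
    simpa only [← sub_eq_add_neg] using this
  have h0 : ∃ l, Tendsto P (𝓝[≠] 0) (𝓝 l) := by
    have hd : HasDerivAt (fun w => wp (w - ω) τ - wp ω τ) (wp' (-ω) τ) 0 := by
      have h4 : HasDerivAt (fun z => wp z τ) (wp' (-ω) τ) (0 - ω) := by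
        rw [zero_sub]
        exact hasDerivAt_wp hnω
      simpa using (h4.comp_sub_const 0 ω).sub_const (wp ω τ)
    have han : AnalyticAt ℂ (fun w => wp (w - ω) τ - wp ω τ) 0 := by
      have h4 : AnalyticAt ℂ (fun z => wp z τ) (0 - ω) := by
        rw [zero_sub]
        exact analyticAt_wp hnω
      have h5 : AnalyticAt ℂ (fun w => wp (w - ω) τ) 0 :=
        h4.comp (f := fun w : ℂ => w - ω) (by fun_prop)
      exact h5.sub analyticAt_const
    obtain ⟨l, hl⟩ := exists_tendsto_div_sq han (by simp [wp_neg])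
      (by rw [hd.deriv, wp'_neg, wp'_eq_zero_of_two_mul_mem h2, neg_zero])
    have h3 : Tendsto (fun z => 1 + z ^ 2 * ((periods τ).weierstrassPExcept 0 z - wp ω τ))
        (𝓝[≠] 0) (𝓝 (1 + 0 ^ 2 * ((periods τ).weierstrassPExcept 0 0 - wp ω τ))) := by
      have : ContinuousAt (fun z => 1 + z ^ 2 * ((periods τ).weierstrassPExcept 0 z - wp ω τ)) 0 := by
        have := (analyticAt_wpExcept (τ := τ)).continuousAt
        fun_prop
      exact this.tendsto.mono_left nhdsWithin_le_nhds
    refine ⟨_, (h3.mul hl).congr' ?_⟩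
    filter_upwards [self_mem_nhdsWithin] with w hw
    have hw : w ≠ 0 := hw
    simp only [hP]
    rw [wp_eq_add w]
    field_simp
    ring
  have hlim : ∀ z, ∃ l, Tendsto P (𝓝[≠] z) (𝓝 l) := fun z => by
    have tr : ∀ z a, (∀ w, P (w + a) = P w) → (∃ l, Tendsto P (𝓝[≠] z) (𝓝 l)) →
        ∃ l, Tendsto P (𝓝[≠] (z + a)) (𝓝 l) := by
      rintro z a ha ⟨l, hl⟩
      have h3 := tendsto_add_punctured (z + a) (-a)
      rw [add_neg_cancel_right] at h3
      refine ⟨l, (hl.comp h3).congr fun w => ?_⟩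
      rw [Function.comp_apply, ← ha, neg_add_cancel_right]
    by_cases h1 : z ∈ (periods τ).lattice
    · simpa using tr 0 z (hper z h1) h0
    · by_cases h3 : z - ω ∈ (periods τ).lattice
      · simpa using tr (0 + (z - ω)) ω hshift (tr 0 _ (hper _ h3) h0)
      · exact ⟨_, (hda z h1 h3).continuousAt.tendsto.mono_left nhdsWithin_le_nhds⟩
  obtain ⟨-, C, hC⟩ := exists_tendsto_of_periodic (τ := τ) (f := P) (d := 0)
    (fun z => ((eventually_notMem_lattice z).and (hsub z)).mono fun w hw => hda w hw.1 hw.2) hlim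
    (fun z => Eventually.of_forall fun w => hper 1 one_mem_lattice w)
    (fun z => Eventually.of_forall fun w => by rw [add_zero, hper _ tau_mem_lattice])
  have hval : ∀ w, w ∉ (periods τ).lattice → w - ω ∉ (periods τ).lattice → P w = C :=
    fun w h1 h3 => tendsto_nhds_unique
      ((hda w h1 h3).continuousAt.tendsto.mono_left nhdsWithin_le_nhds) (hC w)
  -- A further solution z would make P vanish identically. Near 0 the first factor is nonzero, so ℘
  -- would be constant near -ω.
  have hC0 : C = 0 := by
    rw [← hval z hz hzω]
    simp [hP, h]
  have hev : ∀ᶠ w in 𝓝[≠] 0, wp (w - ω) τ = wp ω τ := by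
    have h5 := (tendsto_wp_cobounded (τ := τ)).eventually
      (Bornology.eventually_ne_cobounded (wp ω τ))
    filter_upwards [h5, eventually_notMem_lattice (τ := τ) 0, hsub 0] with w h6 h7 h8
    have := hval w h7 h8
    rw [hC0] at this
    exact sub_eq_zero.1 ((mul_eq_zero.1 this).resolve_left (sub_ne_zero.2 h6))
  refine not_eventually_wp_eq hnω (c := wp ω τ) ?_
  have h6 : ∀ᶠ w in 𝓝 (0 : ℂ), wp (w - ω) τ = wp ω τ := by
    filter_upwards [eventually_nhdsWithin_iff.1 hev] with w hw
    by_cases hw0 : w = 0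
    · rw [hw0, zero_sub, wp_neg]
    · exact hw hw0
  have h7 : Tendsto (fun w => w + ω) (𝓝 (-ω)) (𝓝 0) := by
    have := (continuous_add_const ω).tendsto (-ω)
    rwa [neg_add_cancel] at this
  filter_upwards [h7.eventually h6] with w hw
  rwa [add_sub_cancel_right] at hw

/-- If ℘ omitted c, then 1/(℘ - c) would extend to an entire elliptic function, hence be constant,
with limit 0 at the lattice points: absurd for a reciprocal. -/
theorem exists_wp_eq (τ : UpperHalfPlane) (c : ℂ) : ∃ z ∉ (periods τ).lattice, wp z τ = c := by
  by_contra! hne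
  have h0 : Tendsto (fun z => (wp z τ - c)⁻¹) (𝓝[≠] 0) (𝓝 0) :=
    tendsto_inv₀_cobounded.comp ((tendsto_sub_const_cobounded c).comp tendsto_wp_cobounded)
  have hda : ∀ w ∉ (periods τ).lattice, DifferentiableAt ℂ (fun z => (wp z τ - c)⁻¹) w :=
    fun w hw => ((analyticAt_wp hw).differentiableAt.sub_const c).inv (sub_ne_zero.2 (hne w hw))
  have hlim : ∀ z, ∃ l, Tendsto (fun z => (wp z τ - c)⁻¹) (𝓝[≠] z) (𝓝 l) := fun z => by
    by_cases h1 : z ∈ (periods τ).lattice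
    · have h3 := tendsto_add_punctured z (-z)
      rw [add_neg_cancel] at h3
      refine ⟨0, (h0.comp h3).congr fun w => ?_⟩
      rw [Function.comp_apply, wp_add_of_mem (neg_mem h1)]
    · exact ⟨_, (hda z h1).continuousAt.tendsto.mono_left nhdsWithin_le_nhds⟩
  obtain ⟨-, C, hC⟩ := exists_tendsto_of_periodic (τ := τ) (d := 0)
    (fun z => (eventually_notMem_lattice z).mono fun w hw => hda w hw) hlim
    (fun z => Eventually.of_forall fun w => by rw [wp_add_of_mem one_mem_lattice])
    (fun z => Eventually.of_forall fun w => by rw [add_zero, wp_add_of_mem tau_mem_lattice])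
  have hC0 := tendsto_nhds_unique (hC 0) h0
  have := tendsto_nhds_unique (hC (1 / 2)) ((hda _ half_notMem_lattice).continuousAt.tendsto.mono_left
    nhdsWithin_le_nhds)
  rw [hC0] at this
  exact inv_ne_zero (sub_ne_zero.2 (hne _ half_notMem_lattice)) this.symm

theorem two_mul_half_mem : 2 * (1 / 2 : ℂ) ∈ (periods τ).lattice := by
  simpa using one_mem_lattice

theorem two_mul_tau_half_mem : 2 * (τ / 2 : ℂ) ∈ (periods τ).lattice := by
  rw [mul_div_cancel₀ _ two_ne_zero]
  exact tau_mem_lattice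

theorem two_mul_one_add_tau_half_mem : 2 * ((1 + τ) / 2 : ℂ) ∈ (periods τ).lattice := by
  rw [mul_div_cancel₀ _ two_ne_zero]
  exact add_mem one_mem_lattice tau_mem_lattice

theorem e₂_ne_e₁ : e₂ τ ≠ e₁ τ := fun h => tau_half_sub_half_notMem_lattice
  (sub_mem_of_wp_eq half_notMem_lattice two_mul_half_mem tau_half_notMem_lattice h)

theorem e₃_ne_e₁ : e₃ τ ≠ e₁ τ := fun h => by
  have := sub_mem_of_wp_eq half_notMem_lattice two_mul_half_mem one_add_tau_half_notMem_lattice h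
  rw [show ((1 + τ) / 2 - 1 / 2 : ℂ) = τ / 2 by ring] at this
  exact tau_half_notMem_lattice this

theorem e₃_ne_e₂ : e₃ τ ≠ e₂ τ := fun h => by
  have := sub_mem_of_wp_eq tau_half_notMem_lattice two_mul_tau_half_mem
    one_add_tau_half_notMem_lattice h
  rw [show ((1 + τ) / 2 - τ / 2 : ℂ) = 1 / 2 by ring] at this
  exact half_notMem_lattice this

/-! ### The half-period values as roots of the Weierstrass cubic. -/

section Cubic

variable (τ)

theorem cubic_e₁ : 4 * e₁ τ ^ 3 - (periods τ).g₂ * e₁ τ - (periods τ).g₃ = 0 := by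
  have := (periods τ).derivWeierstrassP_sq _ (half_notMem_lattice (τ := τ))
  change wp' _ τ ^ 2 = _ at this
  rw [wp'_eq_zero_of_two_mul_mem two_mul_half_mem] at this
  rw [e₁, wp, ← this]
  norm_num

theorem cubic_e₂ : 4 * e₂ τ ^ 3 - (periods τ).g₂ * e₂ τ - (periods τ).g₃ = 0 := by
  have := (periods τ).derivWeierstrassP_sq _ (tau_half_notMem_lattice (τ := τ))
  change wp' _ τ ^ 2 = _ at this
  rw [wp'_eq_zero_of_two_mul_mem two_mul_tau_half_mem] at this
  rw [e₂, wp, ← this]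
  norm_num

theorem cubic_e₃ : 4 * e₃ τ ^ 3 - (periods τ).g₂ * e₃ τ - (periods τ).g₃ = 0 := by
  have := (periods τ).derivWeierstrassP_sq _ (one_add_tau_half_notMem_lattice (τ := τ))
  change wp' _ τ ^ 2 = _ at this
  rw [wp'_eq_zero_of_two_mul_mem two_mul_one_add_tau_half_mem] at this
  rw [e₃, wp, ← this]
  norm_num

theorem e_sum : e₁ τ + e₂ τ + e₃ τ = 0 := by
  have h1 := cubic_e₁ τ
  have h2 := cubic_e₂ τ
  have h3 := cubic_e₃ τ
  have h12 : 4 * (e₂ τ ^ 2 + e₂ τ * e₁ τ + e₁ τ ^ 2) - (periods τ).g₂ = 0 :=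
    mul_left_cancel₀ (sub_ne_zero.2 (e₂_ne_e₁ (τ := τ))) (by linear_combination h2 - h1)
  have h13 : 4 * (e₃ τ ^ 2 + e₃ τ * e₁ τ + e₁ τ ^ 2) - (periods τ).g₂ = 0 :=
    mul_left_cancel₀ (sub_ne_zero.2 (e₃_ne_e₁ (τ := τ))) (by linear_combination h3 - h1)
  exact mul_left_cancel₀ (sub_ne_zero.2 (e₃_ne_e₂ (τ := τ)))
    (by linear_combination (h13 - h12) / 4)

theorem g₂_eq : (periods τ).g₂ = -4 * (e₁ τ * e₂ τ + e₁ τ * e₃ τ + e₂ τ * e₃ τ) := by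
  have h1 := cubic_e₁ τ
  have h2 := cubic_e₂ τ
  have h12 : 4 * (e₂ τ ^ 2 + e₂ τ * e₁ τ + e₁ τ ^ 2) - (periods τ).g₂ = 0 :=
    mul_left_cancel₀ (sub_ne_zero.2 (e₂_ne_e₁ (τ := τ))) (by linear_combination h2 - h1)
  have h := e_sum τ
  linear_combination -h12 + 4 * (e₁ τ + e₂ τ) * h

theorem g₃_eq : (periods τ).g₃ = 4 * (e₁ τ * e₂ τ * e₃ τ) := by
  have h1 := cubic_e₁ τ
  rw [g₂_eq] at h1
  have h := e_sum τ
  linear_combination -h1 + 4 * e₁ τ ^ 2 * h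

end Cubic

theorem wp'_sq {z : ℂ} (hz : z ∉ (periods τ).lattice) :
    wp' z τ ^ 2 = 4 * ((wp z τ - e₁ τ) * (wp z τ - e₂ τ) * (wp z τ - e₃ τ)) := by
  have h := (periods τ).derivWeierstrassP_sq z hz
  change wp' z τ ^ 2 = 4 * wp z τ ^ 3 - (periods τ).g₂ * wp z τ - (periods τ).g₃ at h
  rw [h, g₂_eq, g₃_eq]
  linear_combination 4 * wp z τ ^ 2 * e_sum τ

theorem notMem_lattice_of_notMem_twoTorsion {z : ℂ} (hz : z ∉ twoTorsion τ) :
    z ∉ (periods τ).lattice := fun h => hz (by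
  change 2 * z ∈ (periods τ).lattice
  rw [two_mul]
  exact add_mem h h)

theorem wp_ne_of_notMem_twoTorsion {z ω : ℂ} (hz : z ∉ twoTorsion τ)
    (hω : ω ∉ (periods τ).lattice) (h2 : 2 * ω ∈ (periods τ).lattice) : wp z τ ≠ wp ω τ := by
  intro h
  have h3 := sub_mem_of_wp_eq hω h2 (notMem_lattice_of_notMem_twoTorsion hz) h
  refine hz ?_
  change 2 * z ∈ (periods τ).lattice
  rw [show 2 * z = (z - ω) + (z - ω) + 2 * ω by ring]
  exact add_mem (add_mem h3 h3) h2

section TwoTorsion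

variable {z : ℂ} (hz : z ∉ twoTorsion τ)
include hz

theorem wp_ne_e₁ : wp z τ ≠ e₁ τ :=
  wp_ne_of_notMem_twoTorsion hz half_notMem_lattice two_mul_half_mem

theorem wp_ne_e₂ : wp z τ ≠ e₂ τ :=
  wp_ne_of_notMem_twoTorsion hz tau_half_notMem_lattice two_mul_tau_half_mem

theorem wp_ne_e₃ : wp z τ ≠ e₃ τ :=
  wp_ne_of_notMem_twoTorsion hz one_add_tau_half_notMem_lattice two_mul_one_add_tau_half_mem

theorem wp'_ne_zero : wp' z τ ≠ 0 := by
  intro h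
  have := wp'_sq (notMem_lattice_of_notMem_twoTorsion hz)
  rw [h] at this
  have h1 := sub_ne_zero.2 (wp_ne_e₁ hz)
  have h2 := sub_ne_zero.2 (wp_ne_e₂ hz)
  have h3 := sub_ne_zero.2 (wp_ne_e₃ hz)
  refine mul_ne_zero (by norm_num : (4 : ℂ) ≠ 0) (mul_ne_zero (mul_ne_zero h1 h2) h3) ?_
  rw [← this]
  norm_num

end TwoTorsion

theorem eventually_notMem_twoTorsion (z : ℂ) : ∀ᶠ w in 𝓝[≠] z, w ∉ twoTorsion τ := by
  have : Tendsto (fun w : ℂ => 2 * w) (𝓝[≠] z) (𝓝[≠] (2 * z)) := by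
    refine tendsto_nhdsWithin_iff.2 ⟨?_, ?_⟩
    · exact ((continuous_const_mul (2 : ℂ)).tendsto z).mono_left nhdsWithin_le_nhds
    · filter_upwards [self_mem_nhdsWithin] with w hw h
      exact hw (mul_left_cancel₀ two_ne_zero h)
  exact this.eventually (eventually_notMem_lattice _)

/-- Differentiate the cubic equation and cancel 2℘', which is possible away from half-periods; there
the formula follows by continuity. -/
theorem hasDerivAt_wp' {z : ℂ} (hz : z ∉ (periods τ).lattice) :
    HasDerivAt (fun z => wp' z τ) (6 * wp z τ ^ 2 - (periods τ).g₂ / 2) z := by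
  have key : ∀ w ∉ twoTorsion τ, deriv (fun z => wp' z τ) w
      = 6 * wp w τ ^ 2 - (periods τ).g₂ / 2 := fun w hw => by
    have hw' := notMem_lattice_of_notMem_twoTorsion hw
    have h1 := (analyticAt_wp' hw').differentiableAt.hasDerivAt
    have h2 := hasDerivAt_wp hw'
    have h3 : (fun z => wp' z τ ^ 2) =ᶠ[𝓝 w]
        fun z => 4 * wp z τ ^ 3 - (periods τ).g₂ * wp z τ - (periods τ).g₃ := by
      filter_upwards [eventually_notMem_lattice_nhds hw'] with v hv
      exact (periods τ).derivWeierstrassP_sq v hv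
    have h4 := (h1.fun_pow 2).unique ((((((h2.fun_pow 3).const_mul 4).fun_sub
      (h2.const_mul (periods τ).g₂)).sub_const (periods τ).g₃)).congr_of_eventuallyEq h3)
    refine mul_left_cancel₀ (mul_ne_zero two_ne_zero (wp'_ne_zero hw)) ?_
    norm_num at h4
    linear_combination h4
  have h1 := (analyticAt_wp' hz).deriv.continuousAt
  have h2 : ContinuousAt (fun z => 6 * wp z τ ^ 2 - (periods τ).g₂ / 2) z := by
    have := (analyticAt_wp hz).continuousAt
    fun_prop
  have h3 := tendsto_nhds_unique (h1.tendsto.mono_left (nhdsWithin_le_nhds (s := {z}ᶜ)))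
    ((h2.tendsto.mono_left nhdsWithin_le_nhds).congr'
      ((eventually_notMem_twoTorsion (τ := τ) z).mono fun w hw => (key w hw).symm))
  exact (analyticAt_wp' hz).differentiableAt.hasDerivAt.congr_deriv h3

end Lattice

/-! ### The heat equation for the zeta function -/

section Heat

open UpperHalfPlane

variable {τ : UpperHalfPlane}

theorem eventually_coe_ofComplex (τ : UpperHalfPlane) :
    ∀ᶠ w in 𝓝 (τ : ℂ), 0 < w.im ∧ ((ofComplex w : UpperHalfPlane) : ℂ) = w := by
  filter_upwards [Complex.continuous_im.continuousAt.eventually (lt_mem_nhds τ.im_pos)] with w hw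
  refine ⟨hw, ?_⟩
  rw [ofComplex_apply_of_im_pos hw]

theorem forall_ne_om_aa {r s : ℂ} (h : aa r s τ ∉ (periods τ).lattice) (k : Fin 2 → ℤ) :
    r + s * (τ : ℂ) ≠ om k τ := notMem_lattice_iff.1 h k

/-- The condition `r + sτ ∉ Λ_τ` is open in `τ`. -/
theorem eventually_aa_notMem_lattice {r s : ℂ} (h : aa r s τ ∉ (periods τ).lattice) :
    ∀ᶠ w in 𝓝 (τ : ℂ), aa r s (ofComplex w) ∉ (periods (ofComplex w)).lattice := by
  have ha : ContinuousAt (fun w : ℂ => r + s * w) τ := by fun_prop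
  have hσ : ContinuousAt (fun w : ℂ => w) (τ : ℂ) := continuousAt_id
  obtain ⟨R, hR, c, hc, S, hS⟩ := exists_om_bound ha hσ τ.im_pos
  filter_upwards [hS, (Finset.eventually_all S).2 fun k _ =>
    eventually_ne_om ha hσ (forall_ne_om_aa h k), eventually_coe_ofComplex τ] with w h1 h2 h3
  refine notMem_lattice_iff.2 fun k => ?_
  rw [aa, h3.2]
  by_cases hk : k ∈ S
  · exact h2 k hk
  · exact ne_om_of_bound h1.2.1 (h1.2.2 k hk).1

theorem eventually_aa_notMem_twoTorsion {r s : ℂ} (h : aa r s τ ∉ twoTorsion τ) :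
    ∀ᶠ w in 𝓝 (τ : ℂ), aa r s (ofComplex w) ∉ twoTorsion (ofComplex w) := by
  have e : ∀ τ, 2 * aa r s τ = aa (2 * r) (2 * s) τ := fun τ => by simp only [aa]; ring
  have h' : aa (2 * r) (2 * s) τ ∉ (periods τ).lattice := e τ ▸ h
  filter_upwards [eventually_aa_notMem_lattice h'] with w hw h2
  exact hw (e (ofComplex w) ▸ h2)

theorem hasDerivAt_zeta_curve {r s : ℂ} (h : aa r s τ ∉ (periods τ).lattice) :
    HasDerivAt (fun w => zeta (aa r s (ofComplex w)) (ofComplex w))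
      (-s * wp (aa r s τ) τ + zetaTau (aa r s τ) τ) τ := by
  have h1 := hasDerivAt_zetaC' (a := fun w : ℂ => r + s * w) (σ := fun w => w) (w₀ := τ)
    (by fun_prop) (by fun_prop) τ.im_pos (forall_ne_om_aa h)
  have hd : deriv (fun w : ℂ => r + s * w) τ = s := by
    simp
  rw [hd, deriv_id'', one_mul, ← wp_eq] at h1
  refine h1.congr_of_eventuallyEq ?_
  filter_upwards [eventually_coe_ofComplex τ] with w hw
  rw [zeta_eq, aa, hw.2]

theorem hasDerivAt_wp_curve {r s : ℂ} (h : aa r s τ ∉ (periods τ).lattice) :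
    HasDerivAt (fun w => wp (aa r s (ofComplex w)) (ofComplex w))
      (s * wp' (aa r s τ) τ + wpTau (aa r s τ) τ) τ := by
  have h1 := hasDerivAt_wpC_comp (a := fun w : ℂ => r + s * w) (σ := fun w => w) (w₀ := τ)
    (by fun_prop) (by fun_prop) τ.im_pos (forall_ne_om_aa h)
  have hd : deriv (fun w : ℂ => r + s * w) τ = s := by
    simp
  rw [hd, deriv_id'', one_mul, ← wp'_eq] at h1
  refine h1.congr_of_eventuallyEq ?_
  filter_upwards [eventually_coe_ofComplex τ] with w hw
  rw [wp_eq, aa, hw.2]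

theorem hasDerivAt_zeta {z : ℂ} (hz : z ∉ (periods τ).lattice) :
    HasDerivAt (fun z => zeta z τ) (-wp z τ) z := by
  have h1 := hasDerivAt_zetaC' (a := fun w : ℂ => w) (σ := fun _ => (τ : ℂ)) (w₀ := z)
    differentiable_id (differentiable_const _) τ.im_pos (notMem_lattice_iff.1 hz)
  simpa [← zeta_eq, ← wp_eq] using h1

theorem zeta_neg (z : ℂ) : zeta (-z) τ = -zeta z τ := by
  rw [zeta_eq, zeta_eq, zetaC_neg]

theorem zeta_add_sub {l z w : ℂ} (hl : l ∈ (periods τ).lattice) (hz : z ∉ (periods τ).lattice)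
    (hw : w ∉ (periods τ).lattice) : zeta (z + l) τ - zeta z τ = zeta (w + l) τ - zeta w τ := by
  refine eq_of_hasDerivAt_zero (f := fun z => zeta (z + l) τ - zeta z τ) (fun v hv => ?_) hz hw
  have h1 : HasDerivAt (fun z => zeta (z + l) τ) (-wp (v + l) τ) v :=
    (hasDerivAt_zeta ((add_notMem_lattice hl).2 hv)).comp_add_const v l
  refine (h1.sub (hasDerivAt_zeta hv)).congr_deriv ?_
  rw [wp_add_of_mem hl, sub_self]

theorem eta₁_eq : eta₁ τ = 2 * zeta (1 / 2) τ := by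
  rw [eta₁, neg_div, zeta_neg]
  ring

theorem eta₂_eq : eta₂ τ = 2 * zeta (τ / 2) τ := by
  rw [eta₂, neg_div, zeta_neg]
  ring

theorem zeta_add_one {z : ℂ} (hz : z ∉ (periods τ).lattice) :
    zeta (z + 1) τ = zeta z τ + eta₁ τ := by
  have hw : -(1 / 2 : ℂ) ∉ (periods τ).lattice := by
    rw [neg_mem_iff]
    exact half_notMem_lattice
  have := zeta_add_sub one_mem_lattice hz hw
  rw [show -(1 / 2 : ℂ) + 1 = 1 / 2 by norm_num, zeta_neg] at this
  rw [eta₁_eq]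
  linear_combination this

theorem zeta_add_tau {z : ℂ} (hz : z ∉ (periods τ).lattice) :
    zeta (z + τ) τ = zeta z τ + eta₂ τ := by
  have hw : -(τ / 2 : ℂ) ∉ (periods τ).lattice := by
    rw [neg_mem_iff]
    exact tau_half_notMem_lattice
  have := zeta_add_sub tau_mem_lattice hz hw
  rw [show -(τ / 2 : ℂ) + τ = τ / 2 by ring, zeta_neg] at this
  rw [eta₂_eq]
  linear_combination this

/-- The derivative of `η₁` with respect to `τ`. -/
def etaDer₁ (τ : UpperHalfPlane) : ℂ := 2 * zetaTau (1 / 2) τ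

/-- The derivative of `η₂` with respect to `τ`. -/
def etaDer₂ (τ : UpperHalfPlane) : ℂ := 2 * zetaTau (τ / 2) τ - e₂ τ

theorem hasDerivAt_eta₁ (τ : UpperHalfPlane) :
    HasDerivAt (fun w => eta₁ (ofComplex w)) (etaDer₁ τ) τ := by
  have h : aa (1 / 2) 0 τ ∉ (periods τ).lattice := by
    simpa [aa] using half_notMem_lattice (τ := τ)
  have := (hasDerivAt_zeta_curve h).const_mul 2
  simp only [aa, zero_mul, add_zero, neg_zero, zero_add] at this
  simpa only [eta₁_eq, etaDer₁] using this

theorem hasDerivAt_eta₂ (τ : UpperHalfPlane) :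
    HasDerivAt (fun w => eta₂ (ofComplex w)) (etaDer₂ τ) τ := by
  have e : ∀ τ : UpperHalfPlane, aa 0 (1 / 2) τ = τ / 2 := fun τ => by simp only [aa]; ring
  have h : aa 0 (1 / 2) τ ∉ (periods τ).lattice := by
    rw [e]
    exact tau_half_notMem_lattice
  have := (hasDerivAt_zeta_curve h).const_mul 2
  simp only [e] at this
  simp only [eta₂_eq]
  refine this.congr_deriv ?_
  rw [etaDer₂, e₂]
  ring

theorem zetaTau_add_one {z : ℂ} (hz : z ∉ (periods τ).lattice) :
    zetaTau (z + 1) τ = zetaTau z τ + etaDer₁ τ := by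
  have e : ∀ (z : ℂ) (τ : UpperHalfPlane), aa z 0 τ = z := fun z τ => by simp [aa]
  have h0 : aa z 0 τ ∉ (periods τ).lattice := by rwa [e]
  have h1 : aa (z + 1) 0 τ ∉ (periods τ).lattice := by
    rwa [e, add_notMem_lattice one_mem_lattice]
  have := (hasDerivAt_zeta_curve h1).unique (((hasDerivAt_zeta_curve h0).fun_add
    (hasDerivAt_eta₁ τ)).congr_of_eventuallyEq ?_)
  · simpa [e] using this
  · filter_upwards [eventually_aa_notMem_lattice h0] with w hw
    rw [e] at hw
    simp only [e]
    exact zeta_add_one hw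

/-- The quasi-periodicity of ζ is differentiated in τ. The argument z + τ moves too, which accounts
for the extra ℘. -/
theorem zetaTau_add_tau {z : ℂ} (hz : z ∉ (periods τ).lattice) :
    zetaTau (z + τ) τ = zetaTau z τ + etaDer₂ τ + wp z τ := by
  have e : ∀ (z : ℂ) (τ : UpperHalfPlane), aa z 0 τ = z := fun z τ => by simp [aa]
  have e1 : ∀ (z : ℂ) (τ : UpperHalfPlane), aa z 1 τ = z + τ := fun z τ => by simp [aa]
  have h0 : aa z 0 τ ∉ (periods τ).lattice := by rwa [e]
  have h1 : aa z 1 τ ∉ (periods τ).lattice := by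
    rwa [e1, add_notMem_lattice tau_mem_lattice]
  have := (hasDerivAt_zeta_curve h1).unique (((hasDerivAt_zeta_curve h0).fun_add
    (hasDerivAt_eta₂ τ)).congr_of_eventuallyEq ?_)
  · simp only [e, e1, wp_add_of_mem tau_mem_lattice] at this
    linear_combination this
  · filter_upwards [eventually_aa_notMem_lattice h0] with w hw
    rw [e] at hw
    simp only [e, e1]
    exact zeta_add_tau hw

/-- The determinant `τη₁ - η₂` of the Legendre relation. -/
def legendre (τ : UpperHalfPlane) : ℂ := τ * eta₁ τ - eta₂ τ

/-- The combination whose vanishing is the heat equation. -/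
def heat (z : ℂ) (τ : UpperHalfPlane) : ℂ :=
  2 * legendre τ * (zetaTau z τ - z * etaDer₁ τ) + wp' z τ
    + 2 * (zeta z τ - z * eta₁ τ) * (wp z τ + eta₁ τ)

theorem hasDerivAt_zetaTau' {z : ℂ} (hz : z ∉ (periods τ).lattice) :
    HasDerivAt (fun z => zetaTau z τ) (-wpTau z τ) z :=
  hasDerivAt_zetaTau τ.im_pos fun k _ => notMem_lattice_iff.1 hz k

theorem hasDerivAt_heat {z : ℂ} (hz : z ∉ (periods τ).lattice) :
    HasDerivAt (fun z => heat z τ) (2 * legendre τ * (-wpTau z τ - etaDer₁ τ)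
      + (6 * wp z τ ^ 2 - (periods τ).g₂ / 2) - 2 * (wp z τ + eta₁ τ) ^ 2
      + 2 * (zeta z τ - z * eta₁ τ) * wp' z τ) z := by
  have h1 := ((hasDerivAt_zetaTau' hz).fun_sub ((hasDerivAt_id z).mul_const
    (etaDer₁ τ))).const_mul (2 * legendre τ)
  have h2 := ((hasDerivAt_zeta hz).fun_sub ((hasDerivAt_id z).mul_const (eta₁ τ))).const_mul 2
  have h3 := (hasDerivAt_wp hz).add_const (eta₁ τ)
  refine ((h1.fun_add (hasDerivAt_wp' hz)).fun_add (h2.fun_mul h3)).congr_deriv ?_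
  simp only [id]
  ring

theorem eventually_ne_om_of_ne_zero (τ : UpperHalfPlane) :
    ∀ᶠ z in 𝓝 (0 : ℂ), ∀ k, k ≠ 0 → z ≠ om k τ := by
  filter_upwards [(periods τ).compl_lattice_sdiff_singleton_mem_nhds 0] with z hz k hk h
  refine hz ⟨?_, ?_⟩
  · rw [h, ← latticeEquiv_apply]
    exact (latticeEquiv τ k).2
  · rw [Set.mem_singleton_iff, h]
    exact om_ne_zero hk τ.im_pos

/-- The triple poles of ℘' and 2ζ℘ cancel, and so do the two terms η₁/z. What remains is 2(z·w + ζ -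
1/z)/z² with w = ℘ - 1/z², whose numerator vanishes to second order, because w and ζ - 1/z vanish at
0, the latter with derivative 0. -/
theorem exists_tendsto_heat_zero (τ : UpperHalfPlane) :
    ∃ l, Tendsto (fun z => heat z τ) (𝓝[≠] 0) (𝓝 l) := by
  set w := (periods τ).weierstrassPExcept 0 with hw
  set w' := (periods τ).derivWeierstrassPExcept 0 with hw'
  have hne := eventually_ne_om_of_ne_zero τ
  have aw : AnalyticAt ℂ w 0 := (periods τ).analyticAt_weierstrassPExcept 0
  have aw' : AnalyticAt ℂ w' 0 := (periods τ).analyticAt_derivWeierstrassPExcept 0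
  have ah : AnalyticAt ℂ (fun z => zetaReg z τ) 0 :=
    Complex.analyticAt_iff_eventually_differentiableAt.2
      (hne.mono fun z hz => (hasDerivAt_zetaReg τ.im_pos hz).differentiableAt)
  have dh := hasDerivAt_zetaReg τ.im_pos hne.self_of_nhds
  have w0 : w 0 = 0 := (periods τ).weierstrassPExcept_zero 0
  have dwz := aw.differentiableAt.hasDerivAt.fun_mul (hasDerivAt_id (0 : ℂ))
  obtain ⟨l, hl⟩ := exists_tendsto_div_sq (h := fun z => w z * id z + zetaReg z τ)
    ((aw.mul analyticAt_id).add ah) (by simp [zetaReg_zero])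
    (by rw [(dwz.fun_add dh).deriv, wpReg_eq, ← hw, w0]; simp)
  have hT := (hasDerivAt_zetaTau τ.im_pos hne.self_of_nhds).continuousAt
  have hc : ContinuousAt (fun z => 2 * legendre τ * (zetaTau z τ - z * etaDer₁ τ) + w' z
      + 2 * (zetaReg z τ - z * eta₁ τ) * (w z + eta₁ τ)) 0 := by
    have h1 := aw.continuousAt
    have h2 := aw'.continuousAt
    have h3 := ah.continuousAt
    fun_prop
  refine ⟨_, ((hc.tendsto.mono_left nhdsWithin_le_nhds).add (hl.const_mul 2)).congr' ?_⟩
  filter_upwards [self_mem_nhdsWithin] with z hz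
  have hz : z ≠ 0 := hz
  rw [heat, wp_eq_add, wp'_eq_add, zeta_eq, zetaC_eq z τ.im_pos, ← hw, ← hw']
  simp only [id]
  field_simp
  ring

theorem heat_add_one {z : ℂ} (hz : z ∉ (periods τ).lattice) : heat (z + 1) τ = heat z τ := by
  simp only [heat, wp_add_of_mem one_mem_lattice, wp'_add_of_mem one_mem_lattice,
    zeta_add_one hz, zetaTau_add_one hz]
  ring

theorem heat_add_tau {z : ℂ} (hz : z ∉ (periods τ).lattice) :
    heat (z + τ) τ
      = heat z τ + -(2 * legendre τ * (eta₁ τ + τ * etaDer₁ τ - etaDer₂ τ)) := by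
  simp only [heat, wp_add_of_mem tau_mem_lattice, wp'_add_of_mem tau_mem_lattice,
    zeta_add_tau hz, zetaTau_add_tau hz, legendre]
  ring

theorem heat_half (τ : UpperHalfPlane) : heat (1 / 2) τ = 0 := by
  rw [heat, wp'_eq_zero_of_two_mul_mem two_mul_half_mem, etaDer₁, eta₁_eq]
  ring

/-- The combination has removable singularities and is periodic up to an additive constant under τ.
Liouville's theorem makes it constant and that additive constant 0. Its value at z = 1/2 is 0. -/
theorem heat_eq_zero_aux (τ : UpperHalfPlane) :
    legendre τ * (eta₁ τ + τ * etaDer₁ τ - etaDer₂ τ) = 0 ∧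
      ∀ z ∉ (periods τ).lattice, heat z τ = 0 := by
  have hda : ∀ z ∉ (periods τ).lattice, DifferentiableAt ℂ (fun z => heat z τ) z :=
    fun z hz => (hasDerivAt_heat hz).differentiableAt
  have h1 : ∀ z, ∀ᶠ w in 𝓝[≠] z, heat (w + 1) τ = heat w τ := fun z =>
    (eventually_notMem_lattice z).mono fun w hw => heat_add_one hw
  have hτ : ∀ z, ∀ᶠ w in 𝓝[≠] z, heat (w + τ) τ
      = heat w τ + -(2 * legendre τ * (eta₁ τ + τ * etaDer₁ τ - etaDer₂ τ)) := fun z =>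
    (eventually_notMem_lattice z).mono fun w hw => heat_add_tau hw
  -- Existence of a limit at z is a `Prop`-valued periodic function of z, so it passes from 0 to all
  -- lattice points.
  have tr : ∀ a d : ℂ, (∀ z, ∀ᶠ w in 𝓝[≠] z, heat (w + a) τ = heat w τ + d) →
      Function.Periodic (fun z => ∃ l, Tendsto (fun z => heat z τ) (𝓝[≠] z) (𝓝 l)) a := by
    refine fun a d h z => propext ⟨?_, ?_⟩
    · rintro ⟨l, hl⟩
      refine ⟨l - d, ((hl.comp (tendsto_add_punctured z a)).sub_const d).congr' ?_⟩
      filter_upwards [h z] with w hw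
      rw [Function.comp_apply, hw, add_sub_cancel_right]
    · rintro ⟨l, hl⟩
      have h3 := tendsto_add_punctured (z + a) (-a)
      rw [add_neg_cancel_right] at h3
      refine ⟨l + d, ((hl.comp h3).add_const d).congr' ?_⟩
      filter_upwards [h3.eventually (h z)] with w hw
      rw [neg_add_cancel_right] at hw
      rw [Function.comp_apply, hw]
  have hlim : ∀ z, ∃ l, Tendsto (fun z => heat z τ) (𝓝[≠] z) (𝓝 l) := fun z => by
    by_cases hz : z ∈ (periods τ).lattice
    · have := periodic_of_mem_lattice (tr 1 0 (by simpa using h1)) (tr τ _ hτ) hz 0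
      rw [zero_add] at this
      exact this.mpr (exists_tendsto_heat_zero τ)
    · exact ⟨_, (hda z hz).continuousAt.tendsto.mono_left nhdsWithin_le_nhds⟩
  obtain ⟨hd, C, hC⟩ := exists_tendsto_of_periodic
    (fun z => (eventually_notMem_lattice z).mono fun w hw => hda w hw) hlim h1 hτ
  have hval : ∀ z ∉ (periods τ).lattice, heat z τ = C := fun z hz =>
    tendsto_nhds_unique ((hda z hz).continuousAt.tendsto.mono_left nhdsWithin_le_nhds) (hC z)
  refine ⟨?_, fun z hz => ?_⟩
  · linear_combination -hd / 2
  · rw [hval z hz, ← hval _ half_notMem_lattice, heat_half]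

theorem heat_eq_zero {z : ℂ} (hz : z ∉ (periods τ).lattice) : heat z τ = 0 :=
  (heat_eq_zero_aux τ).2 z hz

/-- If the determinant were 0, the heat equation would make (ζ - zη₁)² - ℘ constant in z. At 1/2 and
τ/2 the square vanishes, so e₁ = e₂. The exact value in the Legendre relation is not needed, only
that it is nonzero and constant. -/
theorem legendre_ne_zero (τ : UpperHalfPlane) : legendre τ ≠ 0 := by
  intro h0
  have key : ∀ z ∉ (periods τ).lattice,
      HasDerivAt (fun z => (zeta z τ - z * eta₁ τ) ^ 2 - wp z τ) 0 z := fun z hz => by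
    have h2 := ((hasDerivAt_zeta hz).fun_sub ((hasDerivAt_id z).mul_const (eta₁ τ))).fun_pow 2
    refine (h2.fun_sub (hasDerivAt_wp hz)).congr_deriv ?_
    have := heat_eq_zero hz
    rw [heat, h0] at this
    simp only [id]
    push_cast
    linear_combination -this
  have := eq_of_hasDerivAt_zero key (half_notMem_lattice (τ := τ)) tau_half_notMem_lattice
  have h1 := eta₁_eq (τ := τ)
  have h2 := eta₂_eq (τ := τ)
  rw [legendre] at h0
  have h3 : zeta (1 / 2) τ - 1 / 2 * eta₁ τ = 0 := by linear_combination -h1 / 2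
  have h4 : zeta (τ / 2) τ - τ / 2 * eta₁ τ = 0 := by linear_combination -h2 / 2 - h0 / 2
  rw [h3, h4] at this
  refine e₂_ne_e₁ (τ := τ) ?_
  rw [e₂, e₁]
  linear_combination this

theorem legendre_deriv_eq_zero (τ : UpperHalfPlane) :
    eta₁ τ + τ * etaDer₁ τ - etaDer₂ τ = 0 :=
  (mul_eq_zero.1 (heat_eq_zero_aux τ).1).resolve_left (legendre_ne_zero τ)

theorem hasDerivAt_legendre (τ : UpperHalfPlane) :
    HasDerivAt (fun w => legendre (ofComplex w)) 0 τ := by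
  have h1 := ((hasDerivAt_id (τ : ℂ)).fun_mul (hasDerivAt_eta₁ τ)).fun_sub (hasDerivAt_eta₂ τ)
  refine (h1.congr_of_eventuallyEq ?_).congr_deriv ?_
  · filter_upwards [eventually_coe_ofComplex τ] with w hw
    simp [legendre, hw.2]
  · rw [← legendre_deriv_eq_zero τ]
    simp

/-- `A dZ/dτ = -(℘' + 2Z(℘ + η₁))`, where `A = 2(τη₁ - η₂)`. -/
theorem hasDerivAt_ZZ {r s : ℂ} (h : aa r s τ ∉ (periods τ).lattice) :
    HasDerivAt (fun w => ZZ r s (ofComplex w))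
      (-(wp' (aa r s τ) τ + 2 * ZZ r s τ * (wp (aa r s τ) τ + eta₁ τ)) / (2 * legendre τ)) τ := by
  have h1 := ((hasDerivAt_zeta_curve h).fun_sub ((hasDerivAt_eta₁ τ).const_mul r)).fun_sub
    ((hasDerivAt_eta₂ τ).const_mul s)
  refine h1.congr_deriv ?_
  have hL := legendre_ne_zero τ
  rw [eq_div_iff (mul_ne_zero two_ne_zero hL), ZZ]
  have h2 := heat_eq_zero h
  have h3 := legendre_deriv_eq_zero τ
  have e : aa r s τ = r + s * τ := rfl
  rw [heat, legendre] at h2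
  rw [legendre]
  linear_combination h2 + 2 * (τ * eta₁ τ - eta₂ τ) * s * h3
    + (2 * (τ * eta₁ τ - eta₂ τ) * etaDer₁ τ + 2 * eta₁ τ * (wp (aa r s τ) τ + eta₁ τ)) * e

/-- `A d℘/dτ = ℘'' + 2Z℘' - 2(℘ + η₁)² - A dη₁/dτ`, where `A = 2(τη₁ - η₂)`. -/
theorem hasDerivAt_wp_aa {r s : ℂ} (h : aa r s τ ∉ (periods τ).lattice) :
    HasDerivAt (fun w => wp (aa r s (ofComplex w)) (ofComplex w))
      ((6 * wp (aa r s τ) τ ^ 2 - (periods τ).g₂ / 2 + 2 * ZZ r s τ * wp' (aa r s τ) τ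
        - 2 * (wp (aa r s τ) τ + eta₁ τ) ^ 2) / (2 * legendre τ) - etaDer₁ τ) τ := by
  refine (hasDerivAt_wp_curve h).congr_deriv ?_
  have hL := legendre_ne_zero τ
  -- The z-derivative of the heat equation expresses ∂℘/∂τ without lattice sums over τ-derivatives,
  -- up to dη₁/dτ.
  have h2 := (hasDerivAt_heat h).unique ((hasDerivAt_const _ (0 : ℂ)).congr_of_eventuallyEq
    ((eventually_notMem_lattice_nhds h).mono fun z hz => heat_eq_zero hz))
  have e : aa r s τ = r + s * τ := rfl
  rw [eq_sub_iff_add_eq, eq_div_iff (mul_ne_zero two_ne_zero hL), ZZ, legendre]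
  rw [legendre] at h2
  linear_combination -h2 - 2 * eta₁ τ * wp' (aa r s τ) τ * e

end Heat

open UpperHalfPlane

/-! ### The Hamiltonian system satisfied by `℘(r + sτ|τ)` and `Z_{r,s}(τ)` -/

/-- `x = (℘(a) - e₁)/(e₂ - e₁)`. -/
def xx (r s : ℂ) (τ : UpperHalfPlane) : ℂ := (wp (aa r s τ) τ - e₁ τ) / (e₂ τ - e₁ τ)

/-- `g = ℘'(a)/(e₂ - e₁)`. -/
def gg (r s : ℂ) (τ : UpperHalfPlane) : ℂ := wp' (aa r s τ) τ / (e₂ τ - e₁ τ)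

/-- `dt/dτ` divided by `t(t-1)`. -/
def mm (τ : UpperHalfPlane) : ℂ := 4 * (e₂ τ - e₁ τ) / (2 * legendre τ)

/-- The derivative of a half-period value `e` of `℘`. -/
def eDer (e : ℂ) (τ : UpperHalfPlane) : ℂ :=
  (6 * e ^ 2 - (periods τ).g₂ / 2 - 2 * (e + eta₁ τ) ^ 2) / (2 * legendre τ) - etaDer₁ τ

/-! ### Derivatives of the half-period values and of t. -/

section Half

variable {τ : UpperHalfPlane}

/-- At a half-period ℘' = 0 removes the term containing Z, so e₁, e₂, e₃ all obey one and the same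
equation. -/
theorem hasDerivAt_half_period {r s : ℂ} (h : aa r s τ ∉ (periods τ).lattice)
    (h2 : 2 * aa r s τ ∈ (periods τ).lattice) :
    HasDerivAt (fun w => wp (aa r s (ofComplex w)) (ofComplex w)) (eDer (wp (aa r s τ) τ) τ) τ := by
  have := hasDerivAt_wp_aa h
  rwa [wp'_eq_zero_of_two_mul_mem h2, mul_zero, add_zero] at this

theorem hasDerivAt_e₁ (τ : UpperHalfPlane) :
    HasDerivAt (fun w => e₁ (ofComplex w)) (eDer (e₁ τ) τ) τ := by
  have e : ∀ τ, aa (1 / 2) 0 τ = 1 / 2 := fun τ => by simp [aa]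
  have := hasDerivAt_half_period (τ := τ) (r := 1 / 2) (s := 0)
    (by rw [e]; exact half_notMem_lattice) (by rw [e]; exact two_mul_half_mem)
  simp only [e] at this
  exact this

theorem hasDerivAt_e₂ (τ : UpperHalfPlane) :
    HasDerivAt (fun w => e₂ (ofComplex w)) (eDer (e₂ τ) τ) τ := by
  have e : ∀ τ : UpperHalfPlane, aa 0 (1 / 2) τ = τ / 2 := fun τ => by simp only [aa]; ring
  have := hasDerivAt_half_period (τ := τ) (r := 0) (s := 1 / 2)
    (by rw [e]; exact tau_half_notMem_lattice) (by rw [e]; exact two_mul_tau_half_mem)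
  simp only [e] at this
  exact this

theorem hasDerivAt_e₃ (τ : UpperHalfPlane) :
    HasDerivAt (fun w => e₃ (ofComplex w)) (eDer (e₃ τ) τ) τ := by
  have e : ∀ τ : UpperHalfPlane, aa (1 / 2) (1 / 2) τ = (1 + τ) / 2 := fun τ => by
    simp only [aa]; ring
  have := hasDerivAt_half_period (τ := τ) (r := 1 / 2) (s := 1 / 2)
    (by rw [e]; exact one_add_tau_half_notMem_lattice)
    (by rw [e]; exact two_mul_one_add_tau_half_mem)
  simp only [e] at this
  exact this

theorem eDer_sub (e e' : ℂ) (τ : UpperHalfPlane) :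
    eDer e τ - eDer e' τ = (e - e') * (4 * (e + e') - 4 * eta₁ τ) / (2 * legendre τ) := by
  rw [eDer, eDer]
  ring

theorem hasDerivAt_e₂_sub_e₁ (τ : UpperHalfPlane) :
    HasDerivAt (fun w => e₂ (ofComplex w) - e₁ (ofComplex w))
      ((e₂ τ - e₁ τ) * (4 * (e₂ τ + e₁ τ) - 4 * eta₁ τ) / (2 * legendre τ)) τ := by
  rw [← eDer_sub]
  exact (hasDerivAt_e₂ τ).fun_sub (hasDerivAt_e₁ τ)

theorem tt_ne_zero (τ : UpperHalfPlane) : tt τ ≠ 0 :=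
  div_ne_zero (sub_ne_zero.2 e₃_ne_e₁) (sub_ne_zero.2 e₂_ne_e₁)

theorem tt_sub_one (τ : UpperHalfPlane) : tt τ - 1 = (e₃ τ - e₂ τ) / (e₂ τ - e₁ τ) := by
  have := sub_ne_zero.2 (e₂_ne_e₁ (τ := τ))
  rw [tt]
  field_simp
  ring

theorem tt_sub_one_ne_zero (τ : UpperHalfPlane) : tt τ - 1 ≠ 0 := by
  rw [tt_sub_one]
  exact div_ne_zero (sub_ne_zero.2 e₃_ne_e₂) (sub_ne_zero.2 e₂_ne_e₁)

theorem mm_ne_zero (τ : UpperHalfPlane) : mm τ ≠ 0 :=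
  div_ne_zero (mul_ne_zero (by norm_num) (sub_ne_zero.2 e₂_ne_e₁))
    (mul_ne_zero two_ne_zero (legendre_ne_zero τ))

theorem hasDerivAt_tt (τ : UpperHalfPlane) :
    HasDerivAt (fun w => tt (ofComplex w)) (mm τ * (tt τ * (tt τ - 1))) τ := by
  have hc := sub_ne_zero.2 (e₂_ne_e₁ (τ := τ))
  have hL := legendre_ne_zero τ
  have h1 := ((hasDerivAt_e₃ τ).fun_sub (hasDerivAt_e₁ τ)).fun_div (hasDerivAt_e₂_sub_e₁ τ)
    (by simpa using hc)
  refine h1.congr_deriv ?_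
  rw [eDer_sub, tt_sub_one, tt, mm]
  simp only [ofComplex_apply]
  field_simp
  ring

theorem hasDerivAt_mm (τ : UpperHalfPlane) :
    ∃ d, HasDerivAt (fun w => mm (ofComplex w)) d τ :=
  ⟨_, ((hasDerivAt_e₂_sub_e₁ τ).const_mul 4).fun_div ((hasDerivAt_legendre τ).const_mul 2)
    (by simpa using legendre_ne_zero τ)⟩

end Half

/-! ### The equations for x and y = Z/g. -/

section Curve

variable {r s : ℂ} {τ : UpperHalfPlane} (h : aa r s τ ∉ twoTorsion τ)
include h

theorem xx_ne_zero : xx r s τ ≠ 0 :=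
  div_ne_zero (sub_ne_zero.2 (wp_ne_e₁ h)) (sub_ne_zero.2 e₂_ne_e₁)

theorem xx_sub_one_ne_zero : xx r s τ - 1 ≠ 0 := by
  have hc := sub_ne_zero.2 (e₂_ne_e₁ (τ := τ))
  rw [show xx r s τ - 1 = (wp (aa r s τ) τ - e₂ τ) / (e₂ τ - e₁ τ) by
    rw [xx]; field_simp; ring]
  exact div_ne_zero (sub_ne_zero.2 (wp_ne_e₂ h)) hc

theorem xx_sub_tt_ne_zero : xx r s τ - tt τ ≠ 0 := by
  have hc := sub_ne_zero.2 (e₂_ne_e₁ (τ := τ))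
  rw [show xx r s τ - tt τ = (wp (aa r s τ) τ - e₃ τ) / (e₂ τ - e₁ τ) by
    rw [xx, tt]; field_simp; ring]
  exact div_ne_zero (sub_ne_zero.2 (wp_ne_e₃ h)) hc

theorem gg_ne_zero : gg r s τ ≠ 0 := div_ne_zero (wp'_ne_zero h) (sub_ne_zero.2 e₂_ne_e₁)

theorem gg_sq : gg r s τ ^ 2
    = 4 * ((e₂ τ - e₁ τ) * (xx r s τ * (xx r s τ - 1) * (xx r s τ - tt τ))) := by
  have hc := sub_ne_zero.2 (e₂_ne_e₁ (τ := τ))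
  rw [gg, div_pow, wp'_sq (notMem_lattice_of_notMem_twoTorsion h), xx, tt]
  field_simp
  ring

theorem hasDerivAt_xx : HasDerivAt (fun w => xx r s (ofComplex w))
    (mm τ * (2 * (xx r s τ * (xx r s τ - 1) * (xx r s τ - tt τ)) * (ZZ r s τ / gg r s τ)
      + xx r s τ * (xx r s τ - 1))) τ := by
  have hc := sub_ne_zero.2 (e₂_ne_e₁ (τ := τ))
  have hL := legendre_ne_zero τ
  have hg := gg_ne_zero h
  have h1 := ((hasDerivAt_wp_aa (notMem_lattice_of_notMem_twoTorsion h)).fun_sub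
    (hasDerivAt_e₁ τ)).fun_div (hasDerivAt_e₂_sub_e₁ τ) (by simpa using hc)
  refine h1.congr_deriv ?_
  have e1 : 2 * (xx r s τ * (xx r s τ - 1) * (xx r s τ - tt τ)) * (ZZ r s τ / gg r s τ)
      = gg r s τ * ZZ r s τ / (2 * (e₂ τ - e₁ τ)) := by
    have := gg_sq h
    field_simp
    linear_combination -ZZ r s τ * this
  rw [e1, gg, xx, mm, eDer]
  simp only [ofComplex_apply]
  field_simp
  ring

/-- The formula for dZ/dτ is solved for ℘'(a). The other quantities in it are differentiable, dZ/dτ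
because Z is holomorphic. -/
theorem differentiableAt_wp'_aa :
    DifferentiableAt ℂ (fun w => wp' (aa r s (ofComplex w)) (ofComplex w)) τ := by
  have hZ : ∀ᶠ w in 𝓝 (τ : ℂ), HasDerivAt (fun w => ZZ r s (ofComplex w))
      (-(wp' (aa r s (ofComplex w)) (ofComplex w) + 2 * ZZ r s (ofComplex w)
        * (wp (aa r s (ofComplex w)) (ofComplex w) + eta₁ (ofComplex w)))
        / (2 * legendre (ofComplex w))) w := by
    filter_upwards [eventually_aa_notMem_twoTorsion h, eventually_coe_ofComplex τ] with w h1 h2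
    have := hasDerivAt_ZZ (notMem_lattice_of_notMem_twoTorsion h1)
    rwa [h2.2] at this
  have hZa : AnalyticAt ℂ (fun w => ZZ r s (ofComplex w)) τ :=
    Complex.analyticAt_iff_eventually_differentiableAt.2
      (hZ.mono fun w hw => hw.differentiableAt)
  have h' := notMem_lattice_of_notMem_twoTorsion h
  have h1 := hZa.deriv.differentiableAt
  have h2 := hZa.differentiableAt
  have h3 := (hasDerivAt_wp_aa h').differentiableAt
  have h4 := (hasDerivAt_eta₁ τ).differentiableAt
  have h5 := (hasDerivAt_legendre τ).differentiableAt
  have h6 : DifferentiableAt ℂ (fun w => -(2 * legendre (ofComplex w))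
      * deriv (fun w => ZZ r s (ofComplex w)) w - 2 * ZZ r s (ofComplex w)
        * (wp (aa r s (ofComplex w)) (ofComplex w) + eta₁ (ofComplex w))) τ := by fun_prop
  refine h6.congr_of_eventuallyEq ?_
  filter_upwards [hZ] with w hw
  have := legendre_ne_zero (ofComplex w)
  rw [hw.deriv]
  field_simp
  ring

/-- The derivative of g is obtained by differentiating g² = 4(e₂ - e₁)x(x-1)(x-t). -/
theorem hasDerivAt_yy : HasDerivAt (fun w => ZZ r s (ofComplex w) / gg r s (ofComplex w))
    (mm τ * (-(3 * xx r s τ ^ 2 - 2 * (1 + tt τ) * xx r s τ + tt τ) * (ZZ r s τ / gg r s τ) ^ 2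
      - (2 * xx r s τ - 1) * (ZZ r s τ / gg r s τ) - 1 / 4)) τ := by
  have hc := sub_ne_zero.2 (e₂_ne_e₁ (τ := τ))
  have hL := legendre_ne_zero τ
  have hg := gg_ne_zero h
  have dc := hasDerivAt_e₂_sub_e₁ τ
  have dx := hasDerivAt_xx h
  have dt := hasDerivAt_tt τ
  have dZ := hasDerivAt_ZZ (notMem_lattice_of_notMem_twoTorsion h)
  have hgd : DifferentiableAt ℂ (fun w => gg r s (ofComplex w)) τ :=
    (differentiableAt_wp'_aa h).fun_div dc.differentiableAt (by simpa using hc)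
  obtain ⟨g', dg⟩ : ∃ g', HasDerivAt (fun w => gg r s (ofComplex w)) g' τ := ⟨_, hgd.hasDerivAt⟩
  have hsq := (dg.fun_pow 2).unique
    (((dc.fun_mul ((dx.fun_mul (dx.sub_const 1)).fun_mul (dx.fun_sub dt))).const_mul
      4).congr_of_eventuallyEq ((eventually_aa_notMem_twoTorsion h).mono fun w hw => gg_sq hw))
  have hg2 := gg_sq h
  have hsum := e_sum τ
  have hct : (e₂ τ - e₁ τ) * tt τ = e₃ τ - e₁ τ := by rw [tt]; field_simp
  have hwp : wp (aa r s τ) τ = (e₂ τ - e₁ τ) * xx r s τ + e₁ τ := by rw [xx]; field_simp; ring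
  have hwp' : wp' (aa r s τ) τ = (e₂ τ - e₁ τ) * gg r s τ := by rw [gg]; field_simp
  refine (dZ.fun_div dg (by simpa using hg)).congr_deriv ?_
  simp only [ofComplex_apply] at hsq ⊢
  rw [hwp, hwp', mm]
  rw [mm] at hsq
  -- From here on the claim is an algebraic identity modulo the relation for g², its derivative, e₁
  -- + e₂ + e₃ = 0 and the definition of t.
  generalize ZZ r s τ = Z at *
  generalize gg r s τ = g at *
  generalize xx r s τ = x at *
  generalize tt τ = t at *
  generalize hcc : e₂ τ - e₁ τ = c at *
  generalize legendre τ = L at *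
  generalize eta₁ τ = η at *
  have hA : 2 * L ≠ 0 := mul_ne_zero two_ne_zero hL
  generalize 2 * L = A at *
  have hHZ : x * (x - 1) * (x - t) * (Z / g) = g * Z / (4 * c) := by
    field_simp
    linear_combination -Z * hg2
  have hsq' : A * (2 * g * g') = 4 * (c * (4 * (e₂ τ + e₁ τ) - 4 * η) * (x * (x - 1) * (x - t))
      + c * ((3 * x ^ 2 - 2 * (1 + t) * x + t) * (2 * g * Z + 4 * c * (x * (x - 1)))
        - 4 * c * (x * (x - 1) * (t * (t - 1))))) := by
    have h8 : 2 * (x * (x - 1) * (x - t)) * (Z / g) = g * Z / (2 * c) := by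
      rw [mul_assoc, hHZ]
      field_simp
      ring
    rw [h8] at hsq
    have h9 : 2 * g * g' = _ := (by ring : 2 * g * g' = ((2 : ℕ) : ℂ) * g ^ (2 - 1) * g').trans hsq
    rw [h9]
    field_simp
    ring
  rw [div_eq_iff (pow_ne_zero 2 hg)]
  refine mul_left_cancel₀ (mul_ne_zero (mul_ne_zero two_ne_zero hg) hA) ?_
  have h10 : 2 * g * A * (-(c * g + 2 * Z * (c * x + e₁ τ + η)) / A * g - Z * g')
      = 2 * g ^ 2 * -(c * g + 2 * Z * (c * x + e₁ τ + η)) - Z * (A * (2 * g * g')) := by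
    field_simp
  have h11 : 2 * g * A * (4 * c / A * (-(3 * x ^ 2 - 2 * (1 + t) * x + t) * (Z / g) ^ 2
      - (2 * x - 1) * (Z / g) - 1 / 4) * g ^ 2)
      = 8 * c * g * (-(3 * x ^ 2 - 2 * (1 + t) * x + t) * Z ^ 2 - (2 * x - 1) * Z * g
        - g ^ 2 / 4) := by
    field_simp
    ring
  rw [h10, h11, hsq']
  linear_combination Z * (-4 * (c * x + e₁ τ + η) + 8 * c * (2 * x - 1)) * hg2
    - 16 * c * (x * (x - 1) * (x - t)) * Z * (hsum + hct)

end Curve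

/-- The curve of the parameters `(t, x, y)`, as functions of `τ`. -/
theorem hamCurve {r s : ℂ} {τ : UpperHalfPlane} (h : aa r s τ ∉ twoTorsion τ) :
    HamCurve (fun w => mm (ofComplex w)) (fun w => tt (ofComplex w))
      (fun w => xx r s (ofComplex w)) (fun w => ZZ r s (ofComplex w) / gg r s (ofComplex w)) τ := by
  have hev := (eventually_aa_notMem_twoTorsion h).and (eventually_coe_ofComplex τ)
  have mer : ∀ f : ℂ → ℂ, (∀ᶠ w in 𝓝 (τ : ℂ), DifferentiableAt ℂ f w) → MeromorphicAt f τ :=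
    fun f hf => (Complex.analyticAt_iff_eventually_differentiableAt.2 hf).meromorphicAt
  have dt : ∀ᶠ w in 𝓝 (τ : ℂ), HasDerivAt (fun w => tt (ofComplex w))
      (mm (ofComplex w) * (tt (ofComplex w) * (tt (ofComplex w) - 1))) w := by
    filter_upwards [hev] with w hw
    simpa only [hw.2.2] using hasDerivAt_tt (ofComplex w)
  have dh : ∀ᶠ w in 𝓝 (τ : ℂ), Ham (fun w => mm (ofComplex w)) (fun w => tt (ofComplex w))
      (fun w => xx r s (ofComplex w)) (fun w => ZZ r s (ofComplex w) / gg r s (ofComplex w))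
      0 w := by
    filter_upwards [hev] with w hw
    have h1 := hasDerivAt_xx hw.1
    have h2 := hasDerivAt_yy hw.1
    rw [hw.2.2] at h1 h2
    refine ⟨h1.congr_deriv ?_, h2.congr_deriv ?_⟩ <;> ring
  exact
    { t_mer := mer _ (dt.mono fun w hw => hw.differentiableAt)
      x_mer := mer _ (dh.mono fun w hw => hw.1.differentiableAt)
      y_mer := mer _ (dh.mono fun w hw => hw.2.differentiableAt)
      m_ne := Eventually.of_forall fun w => mm_ne_zero _
      t_ne := Eventually.of_forall fun w => ⟨tt_ne_zero _, tt_sub_one_ne_zero _⟩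
      x_ne := (hev.filter_mono nhdsWithin_le_nhds).mono fun w hw =>
        ⟨xx_ne_zero hw.1, xx_sub_one_ne_zero hw.1, xx_sub_tt_ne_zero hw.1⟩
      t_deriv := mem_nhdsWithin_of_mem_nhds dt
      ham := mem_nhdsWithin_of_mem_nhds dh }

/-! ### Okamoto transformations and the chain -/

/-- The state reached after `n` steps. -/
def chainState (t x y : ℂ) (n : ℕ) : OkState :=
  ⟨-((n : ℂ) + 1) / 2, 1 / 2, 1 / 2, 1 / 2, (n : ℂ) + 1 / 2,
    (bp t x y n).1 + ((n : ℂ) + 1) / (2 * (bp t x y n).2), (bp t x y n).2⟩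

/-- Each block κ₃κ₂κ₁ is a step in p and each middle κ₀ a step in b; the outer κ₀'s pass from q_n to
b_{n+1} and from b_{n+2} to q_{n+2}. Divisions are the same on both sides, so no denominator has to
be nonzero. -/
theorem kappa₅_chainState (t x y : ℂ) (n : ℕ) :
    kappa₅ t (chainState t x y n) = chainState t x y (n + 2) := by
  have hb : ∀ k, (bp t x y (k + 1)).1 = (bp t x y k).1 + ((k : ℂ) + 1 / 2) / (bp t x y k).2 :=
    fun k => rfl
  have hp : ∀ k, (bp t x y (k + 1)).2 = (bp t x y k).2 - ((k : ℂ) + 1) / 2 *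
      (1 / (bp t x y (k + 1)).1 + 1 / ((bp t x y (k + 1)).1 - 1)
        + 1 / ((bp t x y (k + 1)).1 - t)) := fun k => rfl
  set b₁ := (bp t x y (n + 1)).1 with hb₁
  set p₁ := (bp t x y (n + 1)).2 with hp₁
  set b₂ := (bp t x y (n + 2)).1 with hb₂
  set p₂ := (bp t x y (n + 2)).2 with hp₂
  have e0 : kappa₀ (kappa₄ (chainState t x y n)) = ⟨-(n : ℂ) / 2, ((n : ℂ) + 1) / 2,
      ((n : ℂ) + 1) / 2, ((n : ℂ) + 1) / 2, -((n : ℂ) + 1) / 2, b₁, (bp t x y n).2⟩ := by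
    rw [hb₁, hb]
    simp only [kappa₀, kappa₄, chainState, OkState.mk.injEq]
    refine ⟨?_, ?_, ?_, ?_, ?_, ?_, trivial⟩ <;> ring
  have e1 : kappa₃ t (kappa₂ (kappa₁ ⟨-(n : ℂ) / 2, ((n : ℂ) + 1) / 2, ((n : ℂ) + 1) / 2,
      ((n : ℂ) + 1) / 2, -((n : ℂ) + 1) / 2, b₁, (bp t x y n).2⟩)) = ⟨(n : ℂ) + 3 / 2,
      -((n : ℂ) + 1) / 2, -((n : ℂ) + 1) / 2, -((n : ℂ) + 1) / 2, -((n : ℂ) + 1) / 2, b₁, p₁⟩ := by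
    rw [hp₁, hp, ← hb₁]
    simp only [kappa₁, kappa₂, kappa₃, OkState.mk.injEq]
    refine ⟨?_, ?_, ?_, ?_, trivial, trivial, ?_⟩ <;> ring
  have e2 : kappa₀ ⟨(n : ℂ) + 3 / 2, -((n : ℂ) + 1) / 2, -((n : ℂ) + 1) / 2, -((n : ℂ) + 1) / 2,
      -((n : ℂ) + 1) / 2, b₁, p₁⟩ = ⟨-((n : ℂ) + 3 / 2), ((n : ℂ) + 2) / 2, ((n : ℂ) + 2) / 2,
      ((n : ℂ) + 2) / 2, ((n : ℂ) + 2) / 2, b₂, p₁⟩ := by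
    rw [hb₂, hb (n + 1), ← hb₁, ← hp₁]
    simp only [kappa₀, OkState.mk.injEq]
    push_cast
    refine ⟨trivial, ?_, ?_, ?_, ?_, ?_, trivial⟩ <;> ring
  have e3 : kappa₃ t (kappa₂ (kappa₁ ⟨-((n : ℂ) + 3 / 2), ((n : ℂ) + 2) / 2, ((n : ℂ) + 2) / 2,
      ((n : ℂ) + 2) / 2, ((n : ℂ) + 2) / 2, b₂, p₁⟩)) = ⟨((n : ℂ) + 3) / 2, -((n : ℂ) + 2) / 2,
      -((n : ℂ) + 2) / 2, -((n : ℂ) + 2) / 2, ((n : ℂ) + 2) / 2, b₂, p₂⟩ := by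
    rw [hp₂, hp (n + 1), ← hb₂, ← hp₁]
    simp only [kappa₁, kappa₂, kappa₃, OkState.mk.injEq]
    push_cast
    refine ⟨?_, ?_, ?_, ?_, trivial, trivial, ?_⟩ <;> ring
  simp only [kappa₅, Function.comp_apply, Function.iterate_succ, Function.iterate_zero, id]
  rw [e0, e1, e2, e3]
  simp only [kappa₀, chainState, OkState.mk.injEq, ← hb₂, ← hp₂]
  push_cast
  refine ⟨?_, ?_, ?_, ?_, ?_, ?_, trivial⟩ <;> ring

theorem kappaZero_chainState (t x y : ℂ) (n : ℕ) :
    kappaZero n t (chainState t x y 0) = chainState t x y n := by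
  have iter : ∀ m k, (kappa₅ t)^[m] (chainState t x y k) = chainState t x y (k + 2 * m) := by
    intro m
    induction m with
    | zero => intro k; rfl
    | succ m ih =>
      intro k
      rw [Function.iterate_succ_apply, kappa₅_chainState, ih]
      congr 1
      ring
  rcases Nat.even_or_odd n with h | h
  · rw [kappaZero, if_pos h, Function.comp_id, iter, zero_add, Nat.two_mul_div_two_of_even h]
  -- For odd n the first step starts from q_0 = b_1, so no initial κ₀ is needed before the step in
  -- p.
  · have e : kappa₀ (kappa₃ t (kappa₂ (kappa₁ (chainState t x y 0)))) = chainState t x y 1 := by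
      have hb : (bp t x y 1).1 = x + 1 / 2 / y := by simp [bp]
      have hl : (bp t x y 0).1 + (((0 : ℕ) : ℂ) + 1) / (2 * y) = (bp t x y 1).1 := by
        rw [hb]
        simp only [bp, Nat.cast_zero]
        ring
      have hp : (bp t x y 1).2 = y - 1 / 2 * (1 / (bp t x y 1).1 + 1 / ((bp t x y 1).1 - 1)
        + 1 / ((bp t x y 1).1 - t)) := by simp [bp]
      have hy : (bp t x y 0).2 = y := rfl
      have e1 : kappa₃ t (kappa₂ (kappa₁ (chainState t x y 0)))
          = ⟨1, -1 / 2, -1 / 2, -1 / 2, 1 / 2, (bp t x y 1).1, (bp t x y 1).2⟩ := by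
        rw [hp]
        simp only [kappa₁, kappa₂, kappa₃, chainState, hy, hl, OkState.mk.injEq]
        refine ⟨?_, ?_, ?_, ?_, ?_, trivial, ?_⟩ <;> norm_num; ring
      rw [e1]
      simp only [kappa₀, chainState, OkState.mk.injEq]
      refine ⟨by norm_num, by norm_num, by norm_num, by norm_num, by norm_num, ?_, trivial⟩
      push_cast
      ring
    rw [kappaZero, if_neg (Nat.not_even_iff_odd.2 h)]
    simp only [Function.comp_apply]
    rw [e, iter]
    congr 1
    have := Nat.two_mul_div_two_add_one_of_odd h
    omega

/-- Hitchin's solution is q_0 = b_1. The summand 0 is the ν of `Ham.b_step`. -/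
theorem lamZeroRaw_eq (r s : ℂ) (τ : UpperHalfPlane) :
    lamZeroRaw r s τ = xx r s τ + (0 + 1 / 2) / (ZZ r s τ / gg r s τ) := by
  rw [lamZeroRaw, xx, gg, div_div_eq_mul_div, div_eq_mul_inv _ (2 * ZZ r s τ), mul_inv]
  ring

/-! ### The solutions as elements of the chain along the τ-curve. -/

section Points

variable {r s : ℂ} {τ : UpperHalfPlane}

/-- One step in b changes ν = 0 into ν = -1, that is θ₁ = θ₂ = θ₃ = 1/2. The first equation of the
new system is the one defining μ^{(0)}, and the step leaves p = Z/g unchanged. -/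
theorem muZeroRaw_eq (hN : NonDeg (tt τ) (xx r s τ) (gg r s τ) (ZZ r s τ) 0)
    (hN1 : NonDeg (tt τ) (xx r s τ) (gg r s τ) (ZZ r s τ) 1)
    (hH : Ham (fun w => mm (ofComplex w)) (fun w => tt (ofComplex w))
      (fun w => xx r s (ofComplex w)) (fun w => ZZ r s (ofComplex w) / gg r s (ofComplex w)) 0 τ) :
    muZeroRaw r s τ = ZZ r s τ / gg r s τ := by
  obtain ⟨hg, hy, -⟩ := hN
  have hy : ZZ r s τ / gg r s τ ≠ 0 := hy
  obtain ⟨-, -, h0, h1, ht⟩ := hN1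
  have hd := (hH.b_step (by simpa only [ofComplex_apply] using hy)).1
  have hl : (bp (tt τ) (xx r s τ) (ZZ r s τ / gg r s τ) 1).1 = lamZeroRaw r s τ := by
    rw [lamZeroRaw_eq]
    simp [bp]
  rw [hl] at h0 h1 ht
  have hf : (lamZeroRaw r s ∘ ofComplex) = fun w =>
      xx r s (ofComplex w) + (0 + 1 / 2) / (ZZ r s (ofComplex w) / gg r s (ofComplex w)) :=
    funext fun w => lamZeroRaw_eq r s _
  rw [← hf] at hd
  have hd2 : deriv (tt ∘ ofComplex) (τ : ℂ) = mm τ * (tt τ * (tt τ - 1)) := (hasDerivAt_tt τ).deriv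
  have hm := mm_ne_zero τ
  have ht0 := tt_ne_zero τ
  have ht1 := tt_sub_one_ne_zero τ
  simp only [Function.comp_apply, ofComplex_apply] at hd
  rw [muZeroRaw, derivLamZeroRaw, hd.deriv, hd2]
  generalize lamZeroRaw r s τ = l at *
  generalize tt τ = t at *
  field_simp
  ring

theorem okState_eq (hmu : muZeroRaw r s τ = ZZ r s τ / gg r s τ) (n : ℕ) :
    okState r s n τ = chainState (tt τ) (xx r s τ) (ZZ r s τ / gg r s τ) n := by
  rw [← kappaZero_chainState, okState, hmu]
  congr 1
  simp only [chainState, bp, OkState.mk.injEq, Nat.cast_zero]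
  refine ⟨?_, trivial, trivial, trivial, ?_, ?_, trivial⟩
  · ring
  · ring
  · rw [lamZeroRaw_eq]
    ring

/-- The curve of parameters through `τ`. -/
def paramCurve (r s : ℂ) (w : ℂ) : Params :=
  (tt (ofComplex w), xx r s (ofComplex w), gg r s (ofComplex w), ZZ r s (ofComplex w))

theorem tendsto_paramCurve (h : aa r s τ ∉ twoTorsion τ) :
    Tendsto (paramCurve r s) (𝓝[≠] (τ : ℂ))
      (nonDegFilter (tt τ, xx r s τ, gg r s τ, ZZ r s τ)) := by
  have hc := sub_ne_zero.2 (e₂_ne_e₁ (τ := τ))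
  refine tendsto_nonDegFilter.2 ⟨?_, fun k => ?_⟩
  · have h1 := (hasDerivAt_tt τ).continuousAt
    have h2 := (hasDerivAt_xx h).continuousAt
    have h3 : ContinuousAt (fun w => gg r s (ofComplex w)) τ :=
      ((differentiableAt_wp'_aa h).fun_div (hasDerivAt_e₂_sub_e₁ τ).differentiableAt
        (by simpa using hc)).continuousAt
    have h4 := (hasDerivAt_ZZ (notMem_lattice_of_notMem_twoTorsion h)).continuousAt
    have : ContinuousAt (paramCurve r s) τ := h1.prodMk (h2.prodMk (h3.prodMk h4))
    have := this.tendsto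
    simp only [paramCurve, ofComplex_apply] at this
    exact this.mono_left nhdsWithin_le_nhds
  · filter_upwards [((hamCurve h).chain k).2,
      (eventually_aa_notMem_twoTorsion h).filter_mono nhdsWithin_le_nhds] with w hw hw'
    exact ⟨gg_ne_zero hw', hw.1, hw.2.1, hw.2.2.1, hw.2.2.2.1⟩

/-- Near `τ`, the solutions are the `n`-th elements of the chain. -/
theorem eventually_okState_eq (h : aa r s τ ∉ twoTorsion τ) (n : ℕ) :
    ∀ᶠ w in 𝓝[≠] (τ : ℂ), lamRaw r s n (ofComplex w) = qOf bC pC n (paramCurve r s w) ∧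
      muRaw r s n (ofComplex w) = pC n (paramCurve r s w) := by
  have hN := (tendsto_nonDegFilter.1 (tendsto_paramCurve h)).2
  filter_upwards [hN 0, hN 1, (hamCurve h).ham,
    (eventually_coe_ofComplex τ).filter_mono nhdsWithin_le_nhds] with w h0 h1 h2 h3
  have h4 := okState_eq (muZeroRaw_eq h0 h1 (by rwa [h3.2])) n
  rw [lamRaw, muRaw, h4]
  exact ⟨rfl, rfl⟩

theorem meromorphicAt_raw (h : aa r s τ ∉ twoTorsion τ) (n : ℕ) :
    MeromorphicAt (lamRaw r s n ∘ ofComplex) τ ∧ MeromorphicAt (muRaw r s n ∘ ofComplex) τ := by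
  obtain ⟨⟨hb, hp⟩, -⟩ := (hamCurve h).chain n
  have he := eventually_okState_eq h n
  have hq : MeromorphicAt (fun w => qOf bC pC n (paramCurve r s w)) (τ : ℂ) :=
    hb.add ((MeromorphicAt.const _ _).div ((MeromorphicAt.const 2 _).mul hp))
  exact ⟨hq.congr (he.mono fun w hw => hw.1.symm), hp.congr (he.mono fun w hw => hw.2.symm)⟩

end Points

/-! ### Values of meromorphic functions -/

theorem toMeromorphicNFAt_eq_of_tendsto {f : ℂ → ℂ} {z L : ℂ} (hf : MeromorphicAt f z)
    (h : Tendsto f (𝓝[≠] z) (𝓝 L)) : toMeromorphicNFAt f z z = L := by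
  have h1 := (tendsto_nhds_iff_meromorphicOrderAt_nonneg hf).1 ⟨L, h⟩
  have h2 := hf.meromorphicOrderAt_nonneg_iff_analyticAt_toMeromorphicNFAt.1 h1
  exact tendsto_nhds_unique (h2.continuousAt.tendsto.mono_left nhdsWithin_le_nhds)
    (h.congr' hf.eq_nhdsNE_toMeromorphicNFAt)

theorem toMeromorphicNFAt_eq_zero_of_tendsto {f : ℂ → ℂ} {z : ℂ} (hf : MeromorphicAt f z)
    (h : Tendsto f (𝓝[≠] z) (Bornology.cobounded ℂ)) : toMeromorphicNFAt f z z = 0 :=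
  toMeromorphicNFAt_of_meromorphicOrderAt_ne_zero
    ((tendsto_cobounded_iff_meromorphicOrderAt_neg hf).1 h).ne

theorem tendsto_div_cobounded {α : Type*} {l : Filter α} {f g : α → ℂ} {a : ℂ} (ha : a ≠ 0)
    (hf : Tendsto f l (𝓝 a)) (hg : Tendsto g l (𝓝 0)) (hg0 : ∀ᶠ w in l, g w ≠ 0) :
    Tendsto (fun w => f w / g w) l (Bornology.cobounded ℂ) := by
  have h1 : Tendsto (fun w => g w / f w) l (𝓝[≠] 0) := by
    refine tendsto_nhdsWithin_iff.2 ⟨zero_div a ▸ hg.div hf ha, ?_⟩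
    filter_upwards [hg0, hf.eventually_ne ha] with w h1 h2
    exact div_ne_zero h1 h2
  refine (tendsto_inv₀_nhdsNE_zero.comp h1).congr fun w => ?_
  rw [Function.comp_apply, inv_div]

section Values

variable {r s : ℂ} {τ : UpperHalfPlane} {n : ℕ} {u v w Γ ρ : ℂ} (h : aa r s τ ∉ twoTorsion τ)
  (hC : Confined (nonDegFilter (tt τ, xx r s τ, gg r s τ, ZZ r s τ)) bC pC QC GC n u v w Γ ρ)
include h

theorem eventually_QC_ne_zero : ∀ᶠ z in 𝓝[≠] (τ : ℂ), QC n (paramCurve r s z) ≠ 0 ∧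
    QC (n + 2) (paramCurve r s z) ≠ 0 ∧ GC n (paramCurve r s z) ≠ 0 ∧
    pC n (paramCurve r s z) = QC n (paramCurve r s z) * QC (n + 1) (paramCurve r s z)
      * QC (n + 2) (paramCurve r s z) / GC n (paramCurve r s z) := by
  filter_upwards [(tendsto_paramCurve h).eventually (eventually_nonDeg _ n)] with z hz
  obtain ⟨h1, h2, h3, h4⟩ := chainQG_ne_zero hz
  have h5 := chainQG_eq hz
  refine ⟨h1, h3, h4, ?_⟩
  change pC n (paramCurve r s z) = _ * (chainQG _ _ _ _ n).2.1 * (chainQG _ _ _ _ n).2.2.1 / _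
  rw [h5]
  simp only [pC, QC, GC]
  field_simp

include hC

theorem tendsto_lamRaw : (u * w ≠ 0 → Tendsto (lamRaw r s n ∘ ofComplex) (𝓝[≠] (τ : ℂ))
      (𝓝 (ρ / (u * w)))) ∧
    (u * w = 0 → Tendsto (lamRaw r s n ∘ ofComplex) (𝓝[≠] (τ : ℂ)) (Bornology.cobounded ℂ)) := by
  have hγ := tendsto_paramCurve h
  have hρ := hC.ρ_lim.comp hγ
  have huw := (hC.u_lim.comp hγ).mul (hC.w_lim.comp hγ)
  have he : (fun z => qOf bC pC n (paramCurve r s z) *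
      (QC n (paramCurve r s z) * QC (n + 2) (paramCurve r s z)) /
      (QC n (paramCurve r s z) * QC (n + 2) (paramCurve r s z)))
      =ᶠ[𝓝[≠] (τ : ℂ)] lamRaw r s n ∘ ofComplex := by
    filter_upwards [eventually_QC_ne_zero (n := n) h, eventually_okState_eq h n] with z h1 h2
    rw [Function.comp_apply, h2.1, mul_div_cancel_right₀ _ (mul_ne_zero h1.1 h1.2.1)]
  refine ⟨fun h0 => (hρ.div huw h0).congr' he, fun h0 => ?_⟩
  refine (tendsto_div_cobounded (hC.of_uw h0) hρ (h0 ▸ huw) ?_).congr' he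
  filter_upwards [eventually_QC_ne_zero (n := n) h] with z h1
  exact mul_ne_zero h1.1 h1.2.1

theorem lam_eq : lam r s n τ = ρ / (u * w) := by
  have hm := (meromorphicAt_raw h n).1
  by_cases h0 : u * w = 0
  · rw [h0, div_zero]
    exact toMeromorphicNFAt_eq_zero_of_tendsto hm ((tendsto_lamRaw h hC).2 h0)
  · exact toMeromorphicNFAt_eq_of_tendsto hm ((tendsto_lamRaw h hC).1 h0)

theorem mu_eq : mu r s n τ = u * v * w / Γ := by
  have hm := (meromorphicAt_raw h n).2
  have hγ := tendsto_paramCurve h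
  have huvw := ((hC.u_lim.comp hγ).mul (hC.v_lim.comp hγ)).mul (hC.w_lim.comp hγ)
  have hΓ := hC.Γ_lim.comp hγ
  have he : (fun z => QC n (paramCurve r s z) * QC (n + 1) (paramCurve r s z)
      * QC (n + 2) (paramCurve r s z) / GC n (paramCurve r s z))
      =ᶠ[𝓝[≠] (τ : ℂ)] muRaw r s n ∘ ofComplex := by
    filter_upwards [eventually_QC_ne_zero (n := n) h, eventually_okState_eq h n] with z h1 h2
    rw [Function.comp_apply, h2.2, h1.2.2.2]
  by_cases h0 : Γ = 0
  · rw [h0, div_zero]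
    refine toMeromorphicNFAt_eq_zero_of_tendsto hm
      ((tendsto_div_cobounded (hC.of_Γ h0) huvw (h0 ▸ hΓ) ?_).congr' he)
    filter_upwards [eventually_QC_ne_zero (n := n) h] with z h1 using h1.2.2.1
  · exact toMeromorphicNFAt_eq_of_tendsto hm ((huvw.div hΓ h0).congr' he)

omit hC in
-- The normal form is taken separately at each point; it agrees with the raw formula wherever the
-- latter is analytic, that is, off isolated points.
theorem eventually_lam_eq (n : ℕ) :
    (lam r s n ∘ ofComplex) =ᶠ[𝓝[≠] (τ : ℂ)] lamRaw r s n ∘ ofComplex := by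
  filter_upwards [(meromorphicAt_raw h n).1.eventually_analyticAt,
    (eventually_coe_ofComplex τ).filter_mono nhdsWithin_le_nhds] with z h1 h2
  rw [Function.comp_apply, lam, h2.2]
  exact toMeromorphicNFAt_eq_of_tendsto h1.meromorphicAt
    (h1.continuousAt.tendsto.mono_left nhdsWithin_le_nhds)

theorem isPole_iff : IsPole r s n τ ↔ u * w = 0 := by
  have hm := (meromorphicAt_raw h n).1
  rw [IsPole, meromorphicOrderAt_congr (eventually_lam_eq h n)]
  constructor
  · intro h1
    by_contra h0
    exact absurd ((tendsto_nhds_iff_meromorphicOrderAt_nonneg hm).1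
      ⟨_, (tendsto_lamRaw h hC).1 h0⟩) (not_le.2 h1)
  · intro h0
    exact (tendsto_cobounded_iff_meromorphicOrderAt_neg hm).1 ((tendsto_lamRaw h hC).2 h0)

end Values

/-! ### Residues -/

theorem tendsto_coe_punctured (τ : UpperHalfPlane) :
    Tendsto (fun σ : UpperHalfPlane => (σ : ℂ)) (𝓝[≠] τ) (𝓝[≠] (τ : ℂ)) := by
  refine tendsto_nhdsWithin_iff.2 ⟨?_, ?_⟩
  · exact (UpperHalfPlane.continuous_coe.tendsto τ).mono_left nhdsWithin_le_nhds
  · filter_upwards [self_mem_nhdsWithin] with σ hσ h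
    exact hσ (UpperHalfPlane.ext h)

theorem neBot_punctured (τ : UpperHalfPlane) : (𝓝[≠] τ).NeBot := by
  infer_instance

section Residues

variable {r s : ℂ} {τ : UpperHalfPlane} {n : ℕ} {u v w Γ ρ : ℂ} (h : aa r s τ ∉ twoTorsion τ)
  (hC : Confined (nonDegFilter (tt τ, xx r s τ, gg r s τ, ZZ r s τ)) bC pC QC GC n u v w Γ ρ)
include h

/-- The residue of `λ^{(n)}` at a common zero of `p_k` and pole of `q_n`. -/
theorem tendsto_residue {k : ℕ} {β c : ℂ}
    (hb : Tendsto (bC k) (nonDegFilter (tt τ, xx r s τ, gg r s τ, ZZ r s τ)) (𝓝 β))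
    (hp : Tendsto (pC k) (nonDegFilter (tt τ, xx r s τ, gg r s τ, ZZ r s τ)) (𝓝 0))
    (hq : Tendsto (fun P => qOf bC pC n P * pC k P)
      (nonDegFilter (tt τ, xx r s τ, gg r s τ, ZZ r s τ)) (𝓝 c)) :
    Tendsto (fun σ : UpperHalfPlane => (tt σ - tt τ) * lam r s n σ) (𝓝[≠] τ)
      (𝓝 (-(4 * (tt τ * (tt τ - 1)) / (((k : ℂ) + 1) * (2 * k + 1))) * c)) := by
  have hγ := tendsto_paramCurve h
  obtain ⟨d, hd⟩ := hasDerivAt_mm τ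
  have h1 := (hamCurve h).tendsto_div_p (n := k) (β := β) hd.continuousAt (mm_ne_zero _)
    (by simpa only [ofComplex_apply] using hasDerivAt_tt τ) (hb.comp hγ) (hp.comp hγ)
  have h2 := h1.mul (hq.comp hγ)
  simp only [ofComplex_apply] at h2
  have h3 : Tendsto (fun z => (tt (ofComplex z) - tt τ) * lam r s n (ofComplex z)) (𝓝[≠] (τ : ℂ))
      (𝓝 (-(4 * (tt τ * (tt τ - 1)) / (((k : ℂ) + 1) * (2 * k + 1))) * c)) := by
    refine h2.congr' ?_
    filter_upwards [(hγ.eventually (eventually_nonDeg _ k)), eventually_lam_eq h n,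
      eventually_okState_eq h n] with z h3 h4 h5
    have h6 : pC k (paramCurve r s z) ≠ 0 := (h3 k le_rfl).2.1
    have h7 : lam r s n (ofComplex z) = qOf bC pC n (paramCurve r s z) := h4.trans h5.1
    rw [h7]
    change (tt (ofComplex z) - tt τ) / pC k (paramCurve r s z) *
      (qOf bC pC n (paramCurve r s z) * pC k (paramCurve r s z)) = _
    field_simp
  refine (h3.comp (tendsto_coe_punctured τ)).congr fun σ => ?_
  rw [Function.comp_apply, ofComplex_apply]

include hC

/-- The product of -4t(t-1)/((n+1)(2n+1)) and (n+1)/2 is -t(t-1)/(n+1/2). -/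
theorem isNegativePole_of_eq_zero (h0 : w = 0) : IsNegativePole r s n τ := by
  refine ⟨(isPole_iff h hC).2 (by rw [h0, mul_zero]), ?_⟩
  obtain ⟨-, β, hb, hp, hq⟩ := hC.of_w h0
  have n1 : (n : ℂ) + 1 ≠ 0 := by simpa using natCast_add_ne_zero n 1 one_ne_zero
  have n2 : 2 * (n : ℂ) + 1 ≠ 0 := by simpa using two_mul_natCast_add_ne_zero n 1 one_ne_zero
  have n3 : (n : ℂ) + 1 / 2 ≠ 0 := fun e => n2 (by linear_combination 2 * e)
  have := tendsto_residue h hb hp hq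
  convert this using 2
  field_simp
  ring

/-- The pole comes from the zero of p_k with k = n - 2. The negative limit of q_n p_k turns the sign
of the residue, and 2k + 5 = 2n + 1. -/
theorem isPositivePole_of_eq_zero (h0 : u = 0) : IsPositivePole r s n τ := by
  refine ⟨(isPole_iff h hC).2 (by rw [h0, zero_mul]), ?_⟩
  obtain ⟨-, k, rfl, β, hb, hp, hq⟩ := hC.of_u h0
  have n1 : (k : ℂ) + 1 ≠ 0 := by simpa using natCast_add_ne_zero k 1 one_ne_zero
  have n2 : 2 * (k : ℂ) + 1 ≠ 0 := by simpa using two_mul_natCast_add_ne_zero k 1 one_ne_zero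
  have n3 : 2 * (k : ℂ) + 5 ≠ 0 := by simpa using two_mul_natCast_add_ne_zero k 5 (by norm_num)
  have := tendsto_residue h hb hp hq
  convert this using 2
  push_cast
  rw [show (k : ℂ) + 2 + 1 / 2 = (2 * k + 5) / 2 by ring]
  field_simp
  ring

omit h hC in
theorem residue_ne_zero (τ : UpperHalfPlane) (n : ℕ) :
    tt τ * (tt τ - 1) / ((n : ℂ) + 1 / 2) ≠ 0 := by
  have n2 : 2 * (n : ℂ) + 1 ≠ 0 := by simpa using two_mul_natCast_add_ne_zero n 1 one_ne_zero
  exact div_ne_zero (mul_ne_zero (tt_ne_zero τ) (tt_sub_one_ne_zero τ))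
    fun e => n2 (by linear_combination 2 * e)

omit h hC in
theorem not_isPositivePole_and_isNegativePole :
    ¬ (IsPositivePole r s n τ ∧ IsNegativePole r s n τ) := by
  rintro ⟨⟨-, h1⟩, -, h2⟩
  have := neBot_punctured τ
  refine residue_ne_zero τ n ?_
  linear_combination (tendsto_nhds_unique h1 h2) / 2

/-- A pole means u = 0 or w = 0. The second would make the residue negative as well, while the two
possible residues differ. -/
theorem isPositivePole_iff : IsPositivePole r s n τ ↔ u = 0 := by
  refine ⟨fun hp => ?_, isPositivePole_of_eq_zero h hC⟩
  refine (mul_eq_zero.1 ((isPole_iff h hC).1 hp.1)).resolve_right fun h0 => ?_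
  exact not_isPositivePole_and_isNegativePole ⟨hp, isNegativePole_of_eq_zero h hC h0⟩

theorem isNegativePole_iff : IsNegativePole r s n τ ↔ w = 0 := by
  refine ⟨fun hp => ?_, isNegativePole_of_eq_zero h hC⟩
  refine (mul_eq_zero.1 ((isPole_iff h hC).1 hp.1)).resolve_left fun h0 => ?_
  exact not_isPositivePole_and_isNegativePole ⟨isPositivePole_of_eq_zero h hC h0, hp⟩

end Residues

/-! ### Real parameters -/

theorem aa_notMem_twoTorsion {r s : ℂ} (hrs : ¬ ∃ j k : ℤ, r = (j : ℂ) / 2 ∧ s = (k : ℂ) / 2)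
    (hr : r.im = 0) (hs : s.im = 0) (τ : UpperHalfPlane) : aa r s τ ∉ twoTorsion τ := by
  intro hmem
  obtain ⟨j, k, hjk⟩ := mem_lattice_iff.1 (show 2 * aa r s τ ∈ (periods τ).lattice from hmem)
  lift r to ℝ using hr
  lift s to ℝ using hs
  have h1 := LinearIndependent.pair_iff.1 (linearIndependent_one_tau τ) (2 * r - j) (2 * s - k)
    (by
      simp only [Complex.real_smul]
      push_cast
      rw [aa] at hjk
      linear_combination -hjk)
  refine hrs ⟨j, k, ?_, ?_⟩
  · have : (2 * r - j : ℂ) = 0 := by exact_mod_cast h1.1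
    linear_combination this / 2
  · have : (2 * s - k : ℂ) = 0 := by exact_mod_cast h1.2
    linear_combination this / 2

theorem ev_Qf_of_neg {r s : ℂ} {τ : UpperHalfPlane} {k : ℤ} (hk : k < 0) (z : ℂ) :
    ev (Qf r s τ k) z = 1 := by
  rw [Qf, if_pos hk, ev, RatFunc.eval_one]

end LamePVI

end

theorem mainTheorem9 (r s : ℂ) (hrs : ¬ ∃ j k : ℤ, r = (j : ℂ) / 2 ∧ s = (k : ℂ) / 2) :
    (∀ (n : ℕ) (τ : UpperHalfPlane), LamePVI.aa r s τ ∉ LamePVI.twoTorsion τ →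
      (LamePVI.IsPoly (LamePVI.Qf r s τ n) ∧ LamePVI.IsPoly (LamePVI.Gf r s τ n) ∧
        LamePVI.IsPoly (LamePVI.Rf r s τ n)) ∧
      (LamePVI.lam r s n τ = LamePVI.ev (LamePVI.qf r s τ n) (LamePVI.ZZ r s τ) ∧
        LamePVI.lam r s n τ =
          LamePVI.ev (LamePVI.Rf r s τ n) (LamePVI.ZZ r s τ) /
            (LamePVI.ev (LamePVI.Qf r s τ ((n : ℤ) - 2)) (LamePVI.ZZ r s τ) *
              LamePVI.ev (LamePVI.Qf r s τ n) (LamePVI.ZZ r s τ))) ∧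
      (LamePVI.mu r s n τ = LamePVI.ev (LamePVI.pf r s τ n) (LamePVI.ZZ r s τ) ∧
        LamePVI.mu r s n τ =
          LamePVI.ev (LamePVI.Qf r s τ ((n : ℤ) - 2)) (LamePVI.ZZ r s τ) *
            LamePVI.ev (LamePVI.Qf r s τ ((n : ℤ) - 1)) (LamePVI.ZZ r s τ) *
            LamePVI.ev (LamePVI.Qf r s τ n) (LamePVI.ZZ r s τ) /
            LamePVI.ev (LamePVI.Gf r s τ n) (LamePVI.ZZ r s τ)) ∧
      ((∃ p : ℂ, LamePVI.RepresentsP r s n τ p) ∧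
        ∀ p : ℂ, LamePVI.RepresentsP r s n τ p →
          (p ∈ (LamePVI.periods τ).lattice ↔
            LamePVI.ev (LamePVI.Qf r s τ ((n : ℤ) - 2)) (LamePVI.ZZ r s τ) *
              LamePVI.ev (LamePVI.Qf r s τ n) (LamePVI.ZZ r s τ) = 0) ∧
          (p ∉ (LamePVI.periods τ).lattice →
            LamePVI.wp p τ =
              (LamePVI.e₂ τ - LamePVI.e₁ τ) * LamePVI.ev (LamePVI.Rf r s τ n) (LamePVI.ZZ r s τ) /
                (LamePVI.ev (LamePVI.Qf r s τ ((n : ℤ) - 2)) (LamePVI.ZZ r s τ) *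
                  LamePVI.ev (LamePVI.Qf r s τ n) (LamePVI.ZZ r s τ)) + LamePVI.e₁ τ))) ∧
    (∀ (n : ℕ) (τ₀ : UpperHalfPlane), LamePVI.aa r s τ₀ ∉ LamePVI.twoTorsion τ₀ →
      (LamePVI.IsPositivePole r s n τ₀ ↔
        LamePVI.ev (LamePVI.Qf r s τ₀ ((n : ℤ) - 2)) (LamePVI.ZZ r s τ₀) = 0) ∧
      (LamePVI.IsNegativePole r s n τ₀ ↔
        LamePVI.ev (LamePVI.Qf r s τ₀ n) (LamePVI.ZZ r s τ₀) = 0)) ∧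
    (r.im = 0 → s.im = 0 → ∀ τ₀ : UpperHalfPlane,
      ¬ LamePVI.IsPositivePole r s 0 τ₀ ∧ ¬ LamePVI.IsPositivePole r s 1 τ₀) := by

  -- One set of limits serves both for the rational functions at Z and for the meromorphic functions
  -- at τ.
  open LamePVI in
  have data : ∀ (n : ℕ) (τ : UpperHalfPlane), aa r s τ ∉ twoTorsion τ →
      ∃ u v w Γ ρ, Confined (nonDegFilter (tt τ, xx r s τ, gg r s τ, ZZ r s τ)) bC pC QC GC
        n u v w Γ ρ ∧ ValuesAt r s τ n (ZZ r s τ) u v w Γ ρ := fun n τ h => by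
    obtain ⟨u, v, w, Γ, ρ, hC⟩ := exists_confined_nonDegFilter
      (P₀ := (tt τ, xx r s τ, gg r s τ, ZZ r s τ)) (tt_ne_zero τ)
      (sub_ne_zero.1 (tt_sub_one_ne_zero τ)) (gg_ne_zero h) n
    exact ⟨u, v, w, Γ, ρ, hC, valuesAt rfl rfl rfl (gg_ne_zero h) (xx_ne_zero h)
      (sub_ne_zero.1 (xx_sub_one_ne_zero h)) (sub_ne_zero.1 (xx_sub_tt_ne_zero h)) n hC⟩
  have poles : ∀ (n : ℕ) (τ₀ : UpperHalfPlane), LamePVI.aa r s τ₀ ∉ LamePVI.twoTorsion τ₀ →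
      (LamePVI.IsPositivePole r s n τ₀ ↔
        LamePVI.ev (LamePVI.Qf r s τ₀ ((n : ℤ) - 2)) (LamePVI.ZZ r s τ₀) = 0) ∧
      (LamePVI.IsNegativePole r s n τ₀ ↔
        LamePVI.ev (LamePVI.Qf r s τ₀ n) (LamePVI.ZZ r s τ₀) = 0) := fun n τ h => by
    obtain ⟨u, v, w, Γ, ρ, hC, hV⟩ := data n τ h
    rw [hV.ev_Qpp, hV.ev_Q]
    exact ⟨LamePVI.isPositivePole_iff h hC, LamePVI.isNegativePole_iff h hC⟩
  refine ⟨fun n τ h => ⟨?_, ?_⟩, poles, fun hr hs τ => ?_⟩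
  · exact LamePVI.isPoly_qgr rfl rfl rfl (LamePVI.gg_ne_zero h) (LamePVI.xx_ne_zero h)
      (sub_ne_zero.1 (LamePVI.xx_sub_one_ne_zero h)) (sub_ne_zero.1 (LamePVI.xx_sub_tt_ne_zero h))
      (LamePVI.tt_ne_zero τ) (sub_ne_zero.1 (LamePVI.tt_sub_one_ne_zero τ)) n
  · obtain ⟨u, v, w, Γ, ρ, hC, hV⟩ := data n τ h
    have hl := LamePVI.lam_eq h hC
    have hpole := LamePVI.isPole_iff h hC
    have hc := sub_ne_zero.2 (LamePVI.e₂_ne_e₁ (τ := τ))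
    rw [hV.ev_Qpp, hV.ev_Qp, hV.ev_Q, hV.ev_G, hV.ev_R, hV.ev_q, hV.ev_p, hl,
      LamePVI.mu_eq h hC]
    refine ⟨⟨rfl, rfl⟩, ⟨rfl, rfl⟩, ?_, ?_⟩
    · by_cases h0 : u * w = 0
      · exact ⟨0, Or.inl ⟨zero_mem _, hpole.2 h0⟩⟩
      · obtain ⟨p, hp, hpe⟩ := LamePVI.exists_wp_eq τ
          ((LamePVI.e₂ τ - LamePVI.e₁ τ) * (ρ / (u * w)) + LamePVI.e₁ τ)
        refine ⟨p, Or.inr ⟨hp, fun hP => h0 (hpole.1 hP), ?_⟩⟩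
        rw [hpe, hl, add_sub_cancel_right, mul_div_cancel_left₀ _ hc]
    · rintro p (⟨hp, hP⟩ | ⟨hp, hP, hpe⟩)
      · exact ⟨iff_of_true hp (hpole.1 hP), fun hn => absurd hp hn⟩
      · refine ⟨iff_of_false hp fun h0 => hP (hpole.2 h0), fun _ => ?_⟩
        rw [hl, div_eq_iff hc] at hpe
        linear_combination hpe
  -- For real (r, s) no τ is excluded, and Q_{-2} = Q_{-1} = 1 have no zeros.
  · have h := LamePVI.aa_notMem_twoTorsion hrs hr hs τ
    rw [(poles 0 τ h).1, (poles 1 τ h).1, LamePVI.ev_Qf_of_neg (by norm_num),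
      LamePVI.ev_Qf_of_neg (by norm_num)]
    exact ⟨one_ne_zero, one_ne_zero⟩
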